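/- Work over $\mathbb{C}$. Let $Z=\mathbb{P}^{n_1}\times\cdots\times\mathbb{P}^{n_t}$ be a product of projective spaces, $d\ge 2$ an integer, $L$ a line bundle on $Z$ with $-K_Z=(d-1)L$ in $\mathrm{Pic}(Z)$, and $T=(L_1,\dots,L_m)$ a tuple of line bundles on $Z$ with $L_1+\cdots+L_m=dL$ in $\mathrm{Pic}(Z)$, such that every $L_i$ is effective, i.e. $H^0(Z,L_i)\neq 0$. Then: 1. (a) $Z$ is a smooth projective variety with $H^{i,0}(Z)=H^0(Z,\Omega^i_Z)=0$ for $1\le i\le \dim Z-1$; (b) $Z$ is rigid, namely $H^1(Z,\mathcal{T}_Z)=0$; (c) there exists a simple normal crossing divisor of type $T$, i.e. there are nonzero sections $s_i\in H^0(Z,L_i)$ whose divisors $D_i$ are smooth (possibly empty or disconnected) and such that $D_1+\cdots+D_m$ is a simple normal crossing divisor; (d) $-K_Z=(d-1)L$. In particular, if $d\ge 3$, then $(Z,d,L,T)$ satisfies the Condition consisting of (a), (b), (c), (d) and $d\ge 3$. 2. Let $G=\mathrm{SL}(n_1+1)\times\cdots\times\mathrm{SL}(n_t+1)$, acting on $Z$,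 and let $\mathbb{P}_T=\prod_{i=1}^m\mathbb{P}(H^0(Z,L_i))$. The line bundle $L^d$ admits a $G$-linearization, and a generic point of $\mathbb{P}_T$ is GIT-stable for the resulting action of $G$ on $H^0(Z,L^d)$: there is a nonempty Zariski open subset $U\subset\mathbb{P}_T$ such that, for every $([s_1],\dots,[s_m])\in U$, every $G$-linearization of $L^d$ and every isomorphism $L_1\otimes\cdots\otimes L_m\cong L^d$, the section $s_1\cdots s_m\in H^0(Z,L^d)$ is nonzero, its $G$-orbit is Zariski closed in $H^0(Z,L^d)$, and its stabilizer in $G$ is finite. -/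

import Mathlib

open scoped BigOperators

noncomputable section

/-! ### Varieties in terms of their function field

Following Zariski and Chevalley, an integral separated scheme of finite type over `ℂ` with
function field `K` is described by the coordinate rings `A j ⊆ K` of the members of a finite affine
open cover; a closed point is identified with its local ring inside `K`.  The intersection of the
charts `j` and `k` is the affine open set whose coordinate ring is the compositum `A j ⊔ A k`. -/

/-- A finite family of `ℂ`-subalgebras of a field `K`, the candidates for the coordinate rings of
an affine open cover of a variety with function field `K`. (That such a family really comes from a
smooth projective variety is the predicate `Variety.IsSmoothProjective`.) -/
structure Variety (K : Type) [Field K] [Algebra ℂ K] where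
  ι : Type
  finite : Finite ι
  chart : ι → Subalgebra ℂ K

namespace Variety

variable {K : Type} [Field K] [Algebra ℂ K]

/-- The local ring, inside `K`, of the closed point of the chart `A` given by a maximal ideal. -/
def localRing (A : Subalgebra ℂ K) (P : Ideal A) [hP : P.IsMaximal] : LocalSubring K :=
  haveI : @Ideal.IsPrime A.toSubring _ P := hP.isPrime
  LocalSubring.ofPrime A.toSubring P

/-- The set of closed points, each given by its local ring. -/
def points (Z : Variety K) : Set (LocalSubring K) :=
  {O | ∃ (j : Z.ι) (P : Ideal (Z.chart j)) (_ : P.IsMaximal), O = localRing (Z.chart j) P}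

/-- For nonzero `s 0, …, s N` in `K`: the closed subvariety of `ℙ^N` which is the closure of the
image of the rational map `(s 0 : ⋯ : s N)`. Its charts have the coordinate rings
`ℂ[s 0 / s k, …, s N / s k]`. -/
def ofProjectiveEmbedding {N : ℕ} (s : Fin (N + 1) → Kˣ) : Variety K where
  ι := Fin (N + 1)
  finite := inferInstance
  chart k := Algebra.adjoin ℂ (Set.range fun l => (s l / s k : K))

/-- `Z` is a smooth projective variety (integral, over `ℂ`) with function field `K`: the charts are
of finite type, smooth, have fraction field `K`, and glue to a closed subvariety of some `ℙ^N`. -/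
structure IsSmoothProjective (Z : Variety K) : Prop where
  finiteType : ∀ j, (Z.chart j).FG
  isFractionRing : ∀ j, IsFractionRing (Z.chart j) K
  smooth : ∀ j, Algebra.Smooth ℂ (Z.chart j)
  projective : ∃ (N : ℕ) (s : Fin (N + 1) → Kˣ), Z.points = (ofProjectiveEmbedding s).points

/-- The dimension, as the transcendence degree of the function field. -/
def dim (_Z : Variety K) : ℕ := Cardinal.toNat (Algebra.trdeg ℂ K)

/-! ### Differential forms and vector fields -/

/-- The regular `p`-forms on the affine open set with coordinate ring `A`, as an `A`-submodule of
the rational `p`-forms `⋀^p Ω_{K/ℂ}`: the `A`-span of all `da₁ ∧ ⋯ ∧ daₚ` with `aᵢ ∈ A`. -/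
def regularForms (A : Subalgebra ℂ K) (p : ℕ) : Submodule A (⋀[K]^p (Ω[K⁄ℂ])) :=
  Submodule.span A
    (Set.range fun a : Fin p → A =>
      exteriorPower.ιMulti K p (fun i => KaehlerDifferential.D ℂ K (a i : K)))

/-- `H^{p,0}(Z) = H⁰(Z, Ω^p)`. -/
def globalForms (Z : Variety K) (p : ℕ) : Submodule ℂ (⋀[K]^p (Ω[K⁄ℂ])) :=
  ⨅ j, (regularForms (Z.chart j) p).restrictScalars ℂ

/-- The vector fields that are regular on the affine open set with coordinate ring `A`. -/
def vectorFields (A : Subalgebra ℂ K) : Submodule ℂ (Derivation ℂ K K) where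
  carrier := {D | ∀ a ∈ A, D a ∈ A}
  add_mem' hD hE a ha := A.add_mem (hD a ha) (hE a ha)
  zero_mem' _ _ := A.zero_mem
  smul_mem' c _ hD a ha := A.smul_mem (hD a ha) c

/-- Čech 1-cocycles of the tangent sheaf for the affine open cover by the charts. -/
def tangentCocycles (Z : Variety K) : Submodule ℂ (Z.ι → Z.ι → Derivation ℂ K K) where
  carrier := {D | (∀ j k, D j k ∈ vectorFields (Z.chart j ⊔ Z.chart k)) ∧
    ∀ j k l, D j k + D k l = D j l}
  add_mem' hD hE := ⟨fun j k => Submodule.add_mem _ (hD.1 j k) (hE.1 j k), fun j k l => by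
    simp only [Pi.add_apply, ← hD.2 j k l, ← hE.2 j k l]; abel⟩
  zero_mem' := ⟨fun _ _ => Submodule.zero_mem _, fun _ _ _ => by simp⟩
  smul_mem' c _ hD := ⟨fun j k => Submodule.smul_mem _ c (hD.1 j k), fun j k l => by
    simp only [Pi.smul_apply, ← hD.2 j k l, smul_add]⟩

/-- Čech 1-coboundaries of the tangent sheaf for the affine open cover by the charts. -/
def tangentCoboundaries (Z : Variety K) : Submodule ℂ (Z.ι → Z.ι → Derivation ℂ K K) where
  carrier := {D | ∃ E : Z.ι → Derivation ℂ K K, (∀ j, E j ∈ vectorFields (Z.chart j)) ∧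
    ∀ j k, D j k = E k - E j}
  add_mem' := by
    rintro _ _ ⟨E, hE, hD⟩ ⟨E', hE', hD'⟩
    refine ⟨E + E', fun j => Submodule.add_mem _ (hE j) (hE' j), fun j k => ?_⟩
    simp only [Pi.add_apply, hD, hD']; abel
  zero_mem' := ⟨0, fun _ => Submodule.zero_mem _, fun _ _ => by simp⟩
  smul_mem' := by
    rintro c _ ⟨E, hE, hD⟩
    exact ⟨c • E, fun j => Submodule.smul_mem _ c (hE j), fun j k => by
      simp only [Pi.smul_apply, hD, smul_sub]⟩

/-- `H¹(Z, T_Z)`, computed by the Čech complex of the affine open cover by the charts. -/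
abbrev tangentH1 (Z : Variety K) : Type :=
  Z.tangentCocycles ⧸ (Z.tangentCoboundaries.submoduleOf Z.tangentCocycles)

/-! ### Line bundles

A line bundle on an integral scheme is isomorphic to a subsheaf of the constant sheaf `K`.
Such a subsheaf is a family of invertible `A j`-submodules `M j ⊆ K` that agree on overlaps.
The tensor product is the product of submodules, and isomorphisms are the multiplications
by elements of `Kˣ`. -/

lemma span_span_of_le {A B : Subalgebra ℂ K} (h : A ≤ B) (X : Set K) :
    Submodule.span B (Submodule.span A X : Set K) = Submodule.span B X := by
  apply le_antisymm
  · rw [Submodule.span_le]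
    intro x hx
    induction hx using Submodule.span_induction with
    | mem x hx => exact Submodule.subset_span hx
    | zero => exact Submodule.zero_mem _
    | add x y _ _ hx hy => exact Submodule.add_mem _ hx hy
    | smul a x _ hx => exact Submodule.smul_mem _ (⟨a, h a.2⟩ : B) hx
  · exact Submodule.span_mono Submodule.subset_span

open scoped Pointwise in
lemma span_mul_of_le {A B : Subalgebra ℂ K} (h : A ≤ B) (M N : Submodule A K) :
    Submodule.span B ((M * N : Submodule A K) : Set K) =
      Submodule.span B (M : Set K) * Submodule.span B (N : Set K) := by
  rw [Submodule.span_mul_span, ← span_span_of_le h ((M : Set K) * (N : Set K)),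
    ← Submodule.span_mul_span, Submodule.span_eq, Submodule.span_eq]

lemma span_one_of_le {A B : Subalgebra ℂ K} (h : A ≤ B) :
    Submodule.span B ((1 : Submodule A K) : Set K) = 1 := by
  rw [Submodule.one_eq_span, span_span_of_le h, Submodule.one_eq_span]

lemma span_inv_of_le {A B : Subalgebra ℂ K} (h : A ≤ B) (M : (Submodule A K)ˣ) :
    Submodule.span B ((M : Submodule A K) : Set K) *
      Submodule.span B ((M⁻¹ : (Submodule A K)ˣ) : Set K) = 1 := by
  rw [← span_mul_of_le h, Units.mul_inv, span_one_of_le h]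

/-- The group (under tensor product) of line bundles on `Z`, given as subsheaves of `K`. -/
def lineBundles (Z : Variety K) :
    @Subgroup (∀ j, (Submodule (Z.chart j) K)ˣ) (@Pi.commGroup _ _ fun _ => inferInstance).toGroup where
  carrier := {M | ∀ j k,
    Submodule.span (Z.chart j ⊔ Z.chart k : Subalgebra ℂ K) ((M j : Submodule (Z.chart j) K) : Set K) =
    Submodule.span (Z.chart j ⊔ Z.chart k : Subalgebra ℂ K) ((M k : Submodule (Z.chart k) K) : Set K)}
  mul_mem' := by
    intro M N hM hN j k
    rw [Pi.mul_apply, Pi.mul_apply, Units.val_mul, Units.val_mul, span_mul_of_le le_sup_left,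
      span_mul_of_le le_sup_right, hM j k, hN j k]
  one_mem' := by
    intro j k
    rw [Pi.one_apply, Pi.one_apply, Units.val_one, Units.val_one, span_one_of_le le_sup_left,
      span_one_of_le le_sup_right]
  inv_mem' := by
    intro M hM j k
    have h1 := span_inv_of_le (le_sup_left : Z.chart j ≤ Z.chart j ⊔ Z.chart k) (M j)
    have h2 := span_inv_of_le (le_sup_right : Z.chart k ≤ Z.chart j ⊔ Z.chart k) (M k)
    rw [← hM j k] at h2
    exact left_inv_eq_right_inv ((mul_comm _ _).trans h1) h2

def LineBundle (Z : Variety K) : Type := Z.lineBundles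

instance (Z : Variety K) : CommGroup Z.LineBundle :=
  @Subgroup.toCommGroup _ (@Pi.commGroup _ _ fun _ => inferInstance) Z.lineBundles

/-- The module of sections of a line bundle over the chart `j`, inside `K`. -/
def LineBundle.sectionsOn {Z : Variety K} (M : Z.LineBundle) (j : Z.ι) :
    Submodule (Z.chart j) K := (M.1 j : Submodule (Z.chart j) K)

/-- The subsheaf `c · 𝒪_Z` of `K`. These are the line bundles that are trivial. -/
def principal (Z : Variety K) : Kˣ →* Z.LineBundle where
  toFun c := ⟨fun j => (Units.map (Submodule.spanSingleton (Z.chart j)).toMonoidHom) c, by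
    intro j k
    change Submodule.span _ (Submodule.span (Z.chart j) {(c : K)} : Set K) =
      Submodule.span _ (Submodule.span (Z.chart k) {(c : K)} : Set K)
    rw [span_span_of_le le_sup_left, span_span_of_le le_sup_right]⟩
  map_one' := Subtype.ext (funext fun j => map_one _)
  map_mul' a b := Subtype.ext (funext fun j => map_mul _ a b)

/-- The Picard group. -/
def Pic (Z : Variety K) : Type := Z.LineBundle ⧸ Z.principal.range

instance (Z : Variety K) : CommGroup Z.Pic := QuotientGroup.Quotient.commGroup Z.principal.range

/-- The isomorphism class of a line bundle. -/
def LineBundle.cls {Z : Variety K} (M : Z.LineBundle) : Z.Pic :=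
  QuotientGroup.mk (s := Z.principal.range) M

/-- `H⁰(Z, M)`. -/
def LineBundle.H0 {Z : Variety K} (M : Z.LineBundle) : Submodule ℂ K :=
  ⨅ j, (M.sectionsOn j).restrictScalars ℂ

/-- A line bundle is effective if it has a nonzero global section. -/
def LineBundle.IsEffective {Z : Variety K} (M : Z.LineBundle) : Prop := M.H0 ≠ ⊥

/-- `M` is a canonical line bundle: the choice of a rational top form `ω₀ ≠ 0` identifies the sheaf
of regular top forms with the subsheaf `M = {f | f ω₀ is regular}` of `K`. -/
def LineBundle.IsCanonical {Z : Variety K} (M : Z.LineBundle) : Prop :=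
  ∃ ω₀ : ⋀[K]^Z.dim (Ω[K⁄ℂ]), ω₀ ≠ 0 ∧
    ∀ (j : Z.ι) (f : K), f ∈ M.sectionsOn j ↔ f • ω₀ ∈ regularForms (Z.chart j) Z.dim

/-- `-K_Z = (d - 1) L` in `Pic Z`. -/
def AnticanonicalEq (Z : Variety K) (d : ℕ) (L : Z.LineBundle) : Prop :=
  ∃ M : Z.LineBundle, M.IsCanonical ∧ M.cls⁻¹ = L.cls ^ (d - 1)

/-! ### Simple normal crossing divisors -/

/-- `f ∈ 𝒪_p` is a local equation, at the closed point `p` of the chart `j` given by the maximal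
ideal `P`, for the divisor of the section `s` of `M`: one has `s = f e` with `e` generating the
stalk of `M` at `p`. -/
def LineBundle.IsLocalEquation {Z : Variety K} (M : Z.LineBundle) (s : K) (j : Z.ι)
    (P : Ideal (Z.chart j)) [P.IsMaximal] (f : (localRing (Z.chart j) P).toSubring) : Prop :=
  ∃ e : K, Submodule.span (localRing (Z.chart j) P).toSubring (M.sectionsOn j : Set K) =
      Submodule.span (localRing (Z.chart j) P).toSubring {e} ∧ s = f * e

/-- The sections `s i` of the line bundles `T i` are nonzero, their divisors `D i` are smooth
(possibly empty or disconnected), and `∑ D i` is a simple normal crossing divisor: at each closed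
point `p`, the local equations of those `D i` which pass through `p` are part of a regular
system of parameters, that is, are linearly independent in the cotangent space. -/
def IsSNC {Z : Variety K} {m : ℕ} (T : Fin m → Z.LineBundle) (s : ∀ i, (T i).H0) : Prop :=
  (∀ i, s i ≠ 0) ∧
  ∀ (j : Z.ι) (P : Ideal (Z.chart j)) [P.IsMaximal],
    ∃ f : Fin m → (localRing (Z.chart j) P).toSubring,
      (∀ i, (T i).IsLocalEquation (s i : K) j P (f i)) ∧
      LinearIndependent (IsLocalRing.ResidueField (localRing (Z.chart j) P).toSubring)
        (fun i : {i // f i ∈ IsLocalRing.maximalIdeal (localRing (Z.chart j) P).toSubring} =>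
          ((IsLocalRing.maximalIdeal (localRing (Z.chart j) P).toSubring).toCotangent ⟨f i, i.2⟩ :
            IsLocalRing.CotangentSpace (localRing (Z.chart j) P).toSubring))

/-! ### The condition on `(Z, d, L, T)` -/

/-- The part of the condition on `(Z, d, L, T)` that does not bound `d`. -/
structure BasicCondition (Z : Variety K) (d : ℕ) (L : Z.LineBundle) {m : ℕ}
    (T : Fin m → Z.LineBundle) : Prop where
  smoothProjective : Z.IsSmoothProjective
  forms_eq_bot : ∀ i : ℕ, 1 ≤ i → i < Z.dim → Z.globalForms i = ⊥
  rigid : Subsingleton Z.tangentH1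
  exists_snc : ∃ s : ∀ i, (T i).H0, IsSNC T s
  anticanonical : Z.AnticanonicalEq d L

/-- The full condition on `(Z, d, L, T)`. -/
structure Condition (Z : Variety K) (d : ℕ) (L : Z.LineBundle) {m : ℕ}
    (T : Fin m → Z.LineBundle) : Prop extends BasicCondition Z d L T where
  three_le : 3 ≤ d

end Variety

/-! ### Zariski topology and stability -/

/-- The value of a polynomial in linear forms on `V` at a point of `V`. -/
def evalAt {V : Type} [AddCommGroup V] [Module ℂ V]
    (F : MvPolynomial (Module.Dual ℂ V) ℂ) (v : V) : ℂ :=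
  MvPolynomial.eval (fun ℓ => ℓ v) F

/-- Zariski closed subsets of a vector space. -/
def IsZariskiClosed {V : Type} [AddCommGroup V] [Module ℂ V] (C : Set V) : Prop :=
  ∃ S : Set (MvPolynomial (Module.Dual ℂ V) ℂ), C = {v | ∀ F ∈ S, evalAt F v = 0}

/-- GIT stability of (the point of `ℙ V` given by) a nonzero vector `v` of a representation: the
orbit of `v` is closed and its stabilizer is finite. -/
def IsGITStable {G V : Type} [Group G] [AddCommGroup V] [Module ℂ V]
    (ρ : Representation ℂ G V) (v : V) : Prop :=
  v ≠ 0 ∧ IsZariskiClosed (Set.range fun g => ρ g v) ∧ {g | ρ g v = v}.Finite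

/-- Zariski open subsets of a product of projective spaces `∏ ℙ (V i)`: complements of zero sets of
families of multihomogeneous polynomials. -/
def IsZariskiOpenProd {m : ℕ} {V : Fin m → Type} [∀ i, AddCommGroup (V i)]
    [∀ i, Module ℂ (V i)] (U : Set (∀ i, Projectivization ℂ (V i))) : Prop :=
  ∃ S : Set (MvPolynomial (Σ i, Module.Dual ℂ (V i)) ℂ),
    (∀ F ∈ S, ∃ e : Fin m → ℕ, MvPolynomial.IsWeightedHomogeneous
      (fun q : Σ i, Module.Dual ℂ (V i) => (Pi.single q.1 1 : Fin m → ℕ)) F e) ∧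
    U = {x | ∃ F ∈ S, MvPolynomial.eval (fun q => q.2 (x q.1).rep) F ≠ 0}

/-! ### Products of projective spaces -/

namespace MultiProj

variable {t : ℕ} (n : Fin t → ℕ)

/-- The index set of the homogeneous coordinates `x_{i,k}`, `0 ≤ k ≤ n i`, on `∏ ℙ^{n i}`. -/
abbrev Idx : Type := Σ i : Fin t, Fin (n i + 1)

/-- The field of rational functions in the homogeneous coordinates. -/
abbrev BigField : Type := FractionRing (MvPolynomial (Idx n) ℂ)

/-- The homogeneous coordinate `x_{i,k}`. -/
def x (p : Idx n) : BigField n := algebraMap (MvPolynomial (Idx n) ℂ) (BigField n) (MvPolynomial.X p)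

/-- The function field of `∏ ℙ^{n i}`, generated by the ratios `x_{i,k} / x_{i,l}`. -/
def functionField : IntermediateField ℂ (BigField n) :=
  IntermediateField.adjoin ℂ {f | ∃ (i : Fin t) (k l : Fin (n i + 1)), f = x n ⟨i, k⟩ / x n ⟨i, l⟩}

end MultiProj

/-- `ℙ^{n 0} × ⋯ × ℙ^{n (t - 1)}`, with its standard charts `⋂ {x_{i, J i} ≠ 0}`, whose coordinate
rings are generated by the functions `x_{i,k} / x_{i, J i}`. -/
def multiProj {t : ℕ} (n : Fin t → ℕ) : Variety (MultiProj.functionField n) where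
  ι := ∀ i, Fin (n i + 1)
  finite := inferInstance
  chart J := Algebra.adjoin ℂ {f | ∃ (i : Fin t) (k : Fin (n i + 1)),
    (f : MultiProj.BigField n) = MultiProj.x n ⟨i, k⟩ / MultiProj.x n ⟨i, J i⟩}

namespace MultiProj

variable {t : ℕ} (n : Fin t → ℕ)

/-- The group `∏ SL(n i + 1)`. -/
abbrev SLProd : Type := ∀ i, Matrix.SpecialLinearGroup (Fin (n i + 1)) ℂ

/-- The action of `∏ SL(n i + 1)` on polynomial functions, `(g • f)(v) = f (g⁻¹ v)`. -/
def polyAction : SLProd n →* (MvPolynomial (Idx n) ℂ →ₐ[ℂ] MvPolynomial (Idx n) ℂ) where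
  toFun g := MvPolynomial.aeval fun p : Idx n =>
    ∑ l, ((g p.1)⁻¹ : Matrix.SpecialLinearGroup (Fin (n p.1 + 1)) ℂ).1 p.2 l •
      (MvPolynomial.X ⟨p.1, l⟩ : MvPolynomial (Idx n) ℂ)
  map_one' := by
    ext p
    simp [Matrix.one_apply]
  map_mul' g h := by
    apply MvPolynomial.algHom_ext
    intro p
    simp only [Pi.mul_apply, mul_inv_rev, MvPolynomial.aeval_X, AlgHom.mul_apply, map_sum,
      map_smul, Finset.smul_sum, smul_smul, Matrix.SpecialLinearGroup.coe_mul, Matrix.mul_apply,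
      Finset.sum_smul]
    exact Finset.sum_comm

/-- The induced action on the field of rational functions in the homogeneous coordinates. -/
def bigFieldAction : SLProd n →* (BigField n ≃ₐ[ℂ] BigField n) :=
  (IsFractionRing.fieldEquivOfAlgEquivHom (A := ℂ) (B := MvPolynomial (Idx n) ℂ) ℂ
    (BigField n)).comp
    ((AlgEquiv.algHomUnitsEquiv ℂ (MvPolynomial (Idx n) ℂ)).toMonoidHom.comp
      (polyAction n).toHomUnits)

lemma bigFieldAction_algebraMap (g : SLProd n) (f : MvPolynomial (Idx n) ℂ) :
    bigFieldAction n g (algebraMap _ _ f) = algebraMap _ _ (polyAction n g f) := by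
  simp [bigFieldAction]

lemma x_ne_zero (p : Idx n) : x n p ≠ 0 := by
  simp [x]

lemma linear_div_mem (i : Fin t) (j : Fin (n i + 1)) (a : Fin (n i + 1) → ℂ) :
    (∑ l, a l • x n ⟨i, l⟩) / x n ⟨i, j⟩ ∈ functionField n := by
  rw [Finset.sum_div]
  refine sum_mem fun l _ => ?_
  rw [smul_div_assoc]
  exact (functionField n).smul_mem (IntermediateField.subset_adjoin _ _ ⟨i, l, j, rfl⟩)

lemma bigFieldAction_x (g : SLProd n) (p : Idx n) :
    bigFieldAction n g (x n p) =
      ∑ l, ((g p.1)⁻¹ : Matrix.SpecialLinearGroup (Fin (n p.1 + 1)) ℂ).1 p.2 l • x n ⟨p.1, l⟩ := by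
  rw [x, bigFieldAction_algebraMap]
  rw [polyAction, MonoidHom.coe_mk, OneHom.coe_mk, MvPolynomial.aeval_X, map_sum]
  exact Finset.sum_congr rfl fun l _ =>
    map_smul (IsScalarTower.toAlgHom ℂ (MvPolynomial (Idx n) ℂ) (BigField n)) _ _

lemma bigFieldAction_div_mem (g : SLProd n) (i : Fin t) (k l : Fin (n i + 1)) :
    bigFieldAction n g (x n ⟨i, k⟩ / x n ⟨i, l⟩) ∈ functionField n := by
  rw [map_div₀, bigFieldAction_x, bigFieldAction_x,
    ← div_div_div_cancel_right₀ (x_ne_zero n ⟨i, 0⟩)]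
  exact div_mem (linear_div_mem n i 0 _) (linear_div_mem n i 0 _)

lemma bigFieldAction_mem (g : SLProd n) (f : BigField n) (hf : f ∈ functionField n) :
    bigFieldAction n g f ∈ functionField n := by
  generalize hσ : bigFieldAction n g = σ
  unfold functionField at hf
  induction hf using IntermediateField.adjoin_induction with
  | mem f hf =>
    obtain ⟨i, k, l, rfl⟩ := hf
    rw [← hσ]
    exact bigFieldAction_div_mem n g i k l
  | algebraMap c => rw [AlgEquiv.commutes]; exact (functionField n).algebraMap_mem c
  | add a b _ _ ha hb => rw [map_add]; exact add_mem ha hb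
  | inv a _ ha => rw [map_inv₀]; exact inv_mem ha
  | mul a b _ _ ha hb => rw [map_mul]; exact mul_mem ha hb

/-- The action of `∏ SL(n i + 1)` on the function field of `∏ ℙ^{n i}`. -/
def action : SLProd n →* (functionField n ≃ₐ[ℂ] functionField n) :=
  (AlgEquiv.algHomUnitsEquiv ℂ (functionField n)).toMonoidHom.comp (MonoidHom.toHomUnits
    { toFun := fun g =>
        { toFun := fun f => ⟨bigFieldAction n g f, bigFieldAction_mem n g f f.2⟩
          map_one' := by ext; simp
          map_mul' := fun a b => by ext; simp
          map_zero' := by ext; simp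
          map_add' := fun a b => by ext; simp
          commutes' := fun c => by
            ext
            exact (bigFieldAction n g).commutes c }
      map_one' := by ext; simp
      map_mul' := fun g h => by ext; simp })

lemma coe_action (g : SLProd n) (f : functionField n) :
    (action n g f : BigField n) = bigFieldAction n g f := rfl

variable {n}

/-- A `∏ SL(n i + 1)`-linearization of a line bundle `M` on `Z = ∏ ℙ^{n i}`: a lift
`f ↦ factor g * g f` of the action on `K` which, for all charts `j`, `k`, maps the
sections of `M` over the chart `j` to sections over the translate of this chart by `g`, compared
with the sections of `M` over the chart `k` on the overlap of the two; and which is algebraic, in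
the sense that the matrix coefficients of the induced representation on `H⁰(Z, M)` are polynomial
functions of the matrix entries of `g`. -/
structure Linearization (M : (multiProj n).LineBundle) where
  factor : SLProd n → (functionField n)ˣ
  factor_mul : ∀ g h,
    (factor (g * h) : functionField n) = factor g * action n g (factor h)
  overlap : ∀ (g : SLProd n) (j k : (multiProj n).ι),
    Submodule.span (((multiProj n).chart j).map (action n g).toAlgHom
        ⊔ (multiProj n).chart k : Subalgebra ℂ (functionField n))
      ((fun f => factor g * action n g f) '' (M.sectionsOn j : Set (functionField n))) =
    Submodule.span (((multiProj n).chart j).map (action n g).toAlgHom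
        ⊔ (multiProj n).chart k : Subalgebra ℂ (functionField n))
      (M.sectionsOn k : Set (functionField n))
  map_H0 : ∀ (g : SLProd n), ∀ s ∈ M.H0, factor g * action n g s ∈ M.H0
  algebraic : ∀ s ∈ M.H0, ∀ ℓ : Module.Dual ℂ (functionField n),
    ∃ F : MvPolynomial (Σ i : Fin t, Fin (n i + 1) × Fin (n i + 1)) ℂ,
      ∀ g : SLProd n, ℓ (factor g * action n g s) =
        MvPolynomial.eval (fun q => (g q.1).1 q.2.1 q.2.2) F

lemma Linearization.factor_one {M : (multiProj n).LineBundle} (φ : Linearization M) :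
    φ.factor 1 = 1 := by
  have h := φ.factor_mul 1 1
  rw [mul_one, map_one, AlgEquiv.one_apply] at h
  exact Units.ext ((mul_eq_left₀ (φ.factor 1).ne_zero).1 h.symm)

/-- The representation of `∏ SL(n i + 1)` on `H⁰(Z, M)` given by a linearization. -/
def Linearization.rep {M : (multiProj n).LineBundle} (φ : Linearization M) :
    Representation ℂ (SLProd n) M.H0 where
  toFun g := (LinearMap.mulLeft ℂ (φ.factor g : functionField n) ∘ₗ
    (action n g).toLinearMap).restrict (φ.map_H0 g)
  map_one' := LinearMap.ext fun s => Subtype.ext <| by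
    change (φ.factor 1 : functionField n) * action n 1 (s : functionField n) = s
    rw [φ.factor_one, map_one, AlgEquiv.one_apply, Units.val_one, one_mul]
  map_mul' g h := LinearMap.ext fun s => Subtype.ext <| by
    change (φ.factor (g * h) : functionField n) * action n (g * h) (s : functionField n) =
      φ.factor g * action n g (φ.factor h * action n h (s : functionField n))
    rw [φ.factor_mul, map_mul, map_mul, AlgEquiv.mul_apply, mul_assoc]

end MultiProj

end

open scoped BigOperators

noncomputable section

/-! ### Extension of derivations -/

/-! Everything rests on one condition on multihomogeneous forms Q_1, …, Q_m: `IsTransversal`, the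
Jacobian criterion tested at points over all extension fields of ℂ. Generic forms satisfy it by
Bertini's theorem (`exists_polynomial_isTransversal`). Suppose ∑ λ_j ∇Q_j = 0 and λ_j Q_j = 0 at a
point, with algebraically independent coefficients. Differentiating by the coefficient of one
monomial of Q_j cancels the gradient terms and leaves λ_j times that monomial, which must vanish;
the monomials have no common zero, so λ = 0. Testing transversality over the residue fields of
points of Z gives the simple normal crossing divisor (`IsTransversal.isSNC`).

For stability put Q = ∏ Q_j. It suffices that the orbit map from ∏ SL(n_i + 1) to the coefficients
of the transforms of Q is a finite morphism (`IsTransversal.isFiniteMorphism`), since finite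
morphisms have closed image and finite fibres. By the valuative criterion this means: if matrices h
of determinant one over a valued field carry Q to a form with coefficients in the valuation ring O,
then h has entries in O (`mem_of_coeff_linSub_mem`). Write h = k a k' with k, k' invertible over O
and a diagonal. The factor k' can be dropped, and k preserves transversality over the residue field.
In the i-th factor let W_i be the value of the largest diagonal entry, at position J i, and let ρ ≤
1 be the values relative to it. At the coordinate point J, transversality and Hall's theorem give
each Q_j a unit coefficient at a monomial in the x_{i, J i}, or at such a monomial times one more
coordinate f(j), with distinct f(j) for distinct j. By Gauss's lemma, integrality of the product
forces ∏ W_i^{e_i} ∏ ρ(f(j)) ≤ 1, where e is the multidegree of Q. The determinants give W_i^{n_i+1}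
∏_k ρ(i,k) = 1, and e_i ≥ n_i + 2 then forces W_i = 1 (`weights_le_one`). The degree bound comes
from the two relations in Pic: if L has multidegree l, then n_i + 1 = (d-1) l_i and e_i = d l_i, so
e_i = n_i + 1 + l_i with l_i > 0.

Linearizations are unique because ∏ SL(n_i + 1) has no nontrivial characters (`monoidHom_eq_one`),
so each of them acts on sections by substitution in polynomials.

The geometry of Z is combinatorics of Laurent monomials in the homogeneous coordinates. Rings of
charts and overlaps are spanned by the monomials satisfying conditions on exponents (`chart_eq`,
`chart_sup_chart_eq`), and their units are monomials, which classifies line bundles by multidegrees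
(`exists_hasForm`). Logarithmic derivatives have integer coefficients, which yields the canonical
bundle. Rigidity comes from splitting a cocycle into torus weights, each of which is a coboundary
for an explicit reason (`subsingleton_tangentH1`). Factors with n_i = 0 are points; their
multidegree carries no information and is normalized to 0. -/

/-- Phrased with bare ring homomorphisms so that the `A`-structure on `T` can be prescribed by `i`;
on dual numbers the structure needed below is twisted by a derivation. -/
lemma Algebra.FormallySmooth.exists_ringHom_lift {A L T : Type} [CommRing A] [CommRing L]
    [CommRing T] [Algebra A L] [Algebra.FormallySmooth A L] (i : A →+* T) (g : T →+* L)
    (hg : Function.Surjective g) (hn : IsNilpotent (RingHom.ker g))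
    (hi : g.comp i = algebraMap A L) :
    ∃ s : L →+* T, s.comp (algebraMap A L) = i ∧ g.comp s = RingHom.id L := by
  let _ : Algebra A T := i.toAlgebra
  let g' : T →ₐ[A] L := { g with commutes' := fun a => RingHom.congr_fun hi a }
  let s := Algebra.FormallySmooth.liftOfSurjective (R := A) (AlgHom.id A L) g' hg hn
  refine ⟨s.toRingHom, ?_, ?_⟩
  · ext a
    exact s.commutes a
  · ext a
    exact Algebra.FormallySmooth.liftOfSurjective_apply (R := A) (AlgHom.id A L) g' hg hn a

/-- Derivations extend along formally smooth algebras. -/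
lemma Derivation.exists_extension {A L : Type} [CommRing A] [CommRing L] [Algebra ℂ A]
    [Algebra ℂ L] [Algebra A L] [IsScalarTower ℂ A L] [Algebra.FormallySmooth A L]
    (d : Derivation ℂ A L) :
    ∃ δ : Derivation ℂ L L, ∀ a, δ (algebraMap A L a) = d a := by
  -- A derivation `d` is the ring homomorphism a ↦ a + ε d(a) into the dual numbers. Lifting the
  -- identity of `L` through the square-zero ideal extends it, and the ε-part of the lift is `δ`.
  let i : A →+* TrivSqZeroExt L L :=
    { toFun := fun a => TrivSqZeroExt.inl (algebraMap A L a) + TrivSqZeroExt.inr (d a)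
      map_one' := by simp
      map_mul' := fun a b => TrivSqZeroExt.ext (by simp)
        (by
          simp only [map_mul, Derivation.leibniz, TrivSqZeroExt.snd_add, TrivSqZeroExt.snd_mul,
            TrivSqZeroExt.snd_inl, TrivSqZeroExt.snd_inr, TrivSqZeroExt.fst_add,
            TrivSqZeroExt.fst_inl, TrivSqZeroExt.fst_inr, Algebra.smul_def, Algebra.algebraMap_self,
            RingHom.id_apply, MulOpposite.smul_eq_mul_unop, MulOpposite.unop_op]
          ring)
      map_zero' := by simp
      map_add' := fun a b => TrivSqZeroExt.ext (by simp) (by simp) }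
  obtain ⟨s, hs, hs'⟩ := Algebra.FormallySmooth.exists_ringHom_lift (L := L) i
    (TrivSqZeroExt.fstHom L L L).toRingHom TrivSqZeroExt.fst_surjective
    ⟨2, TrivSqZeroExt.kerIdeal_sq L L⟩ (by ext a; simp [i])
  have hfst : ∀ b, (s b).fst = b := fun b => RingHom.congr_fun hs' b
  have hsa : ∀ a, s (algebraMap A L a) = i a := fun a => RingHom.congr_fun hs a
  refine ⟨Derivation.mk' 
    { toFun := fun b => (s b).snd
      map_add' := fun a b => by simp
      map_smul' := fun c b => ?_ } fun a b => ?_, fun a => ?_⟩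
  · have h : s (algebraMap ℂ L c) = TrivSqZeroExt.inl (algebraMap ℂ L c) := by
      rw [IsScalarTower.algebraMap_apply ℂ A L, hsa]
      simp [i]
    rw [Algebra.smul_def, map_mul, h]
    simp [Algebra.smul_def]
  · simp [TrivSqZeroExt.snd_mul, hfst, mul_comm]
  · change (s (algebraMap A L a)).snd = d a
    rw [hsa]
    simp [i]

/-- In characteristic zero, a field is formally smooth over each of its subrings. -/
lemma Algebra.FormallySmooth.of_injective_field {A L : Type} [CommRing A] [IsDomain A] [Field L]
    [Algebra A L] [CharZero A] (h : Function.Injective (algebraMap A L)) :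
    Algebra.FormallySmooth A L := by
  have : FaithfulSMul A L := (faithfulSMul_iff_algebraMap_injective A L).2 h
  let _ := FractionRing.liftAlgebra A L
  let E := FractionRing A
  have : CharZero E := charZero_of_injective_algebraMap (IsFractionRing.injective A E)
  have : CharZero L := charZero_of_injective_algebraMap h
  -- The tower is a localization, then a purely transcendental extension, then an algebraic one,
  -- which is separable in characteristic zero.
  obtain ⟨s, hs⟩ := exists_isTranscendenceBasis E L
  have : Algebra.IsAlgebraic (IntermediateField.adjoin E (Set.range ((↑) : s → L))) L :=
    hs.isAlgebraic_field
  have : Algebra.FormallySmooth E L :=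
    Algebra.FormallySmooth.of_algebraicIndependent_of_isSeparable hs.1
  have : Algebra.FormallySmooth A E := .of_isLocalization (nonZeroDivisors A)
  exact .comp A E L

lemma Derivation.apply_aeval {σ L : Type} [Fintype σ] [CommRing L] [Algebra ℂ L]
    (δ : Derivation ℂ L L) (p : σ → L) (Q : MvPolynomial σ ℂ) :
    δ (MvPolynomial.aeval p Q) =
      ∑ q, MvPolynomial.aeval p (MvPolynomial.pderiv q Q) * δ (p q) := by
  classical
  induction Q using MvPolynomial.induction_on with
  | C a => simp
  | add f g hf hg => simp [hf, hg, add_mul, Finset.sum_add_distrib]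
  | mul_X f i hf =>
    simp only [map_mul, Derivation.leibniz, MvPolynomial.aeval_X, hf, smul_eq_mul, map_add,
      MvPolynomial.pderiv_X, add_mul, Finset.sum_add_distrib, Finset.mul_sum, Pi.single_apply]
    congr 1
    · rw [Finset.sum_eq_single i]
      · simp
      · intro q _ hq
        simp [hq.symm]
      · simp
    · exact Finset.sum_congr rfl fun q _ => by ring

/-! ### Transversal families of hypersurfaces -/

/-- The hypersurfaces `F j = 0` in a product of projective spaces meet transversally, over every
field extension of `ℂ`: there is no point at which the gradients of some of those `F j` that
vanish there are linearly dependent. -/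
def IsTransversal {t : ℕ} {n : Fin t → ℕ} {m : ℕ}
    (F : Fin m → MvPolynomial (MultiProj.Idx n) ℂ) : Prop :=
  ∀ (κ : Type) [Field κ] [Algebra ℂ κ] (p : MultiProj.Idx n → κ) (lam : Fin m → κ),
    (∀ i, ∃ k, p ⟨i, k⟩ ≠ 0) → (∀ j, lam j * MvPolynomial.aeval p (F j) = 0) →
    (∀ q, ∑ j, lam j * MvPolynomial.aeval p (MvPolynomial.pderiv q (F j)) = 0) → lam = 0

/-! ### Bertini's theorem by indeterminate coefficients -/

section Bertini

open MvPolynomial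

variable {ι β : Type} [Fintype β] {m : ℕ}

/-- The polynomial `∑ c_b P_b` (sum over `σ b = j`) with indeterminate coefficients `c_b`, in a ring
which has as further variables the multipliers `λ_j`. -/
def genericForm (σ : β → Fin m) (P : β → MvPolynomial ι ℂ) (j : Fin m) :
    MvPolynomial (β ⊕ (ι ⊕ Fin m)) ℂ :=
  ∑ b, if σ b = j then X (Sum.inl b) * rename (Sum.inr ∘ Sum.inl) (P b) else 0

/-- The member with coefficients `c` of the family `genericForm`. -/
def specialForm (σ : β → Fin m) (P : β → MvPolynomial ι ℂ) (c : β → ℂ) (j : Fin m) :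
    MvPolynomial ι ℂ :=
  ∑ b, if σ b = j then C (c b) * P b else 0

/-- The equations for the points where the gradients of the forms are linearly dependent. -/
def dependencyIdeal (σ : β → Fin m) (P : β → MvPolynomial ι ℂ) :
    Ideal (MvPolynomial (β ⊕ (ι ⊕ Fin m)) ℂ) :=
  Ideal.span ((Set.range fun j => X (Sum.inr (Sum.inr j)) * genericForm σ P j) ∪
    Set.range fun q => ∑ j, X (Sum.inr (Sum.inr j)) * genericForm σ (fun b => pderiv q (P b)) j)

lemma aeval_genericForm {L : Type} [CommRing L] [Algebra ℂ L] (σ : β → Fin m)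
    (P : β → MvPolynomial ι ℂ) (j : Fin m) (v : β ⊕ (ι ⊕ Fin m) → L) :
    aeval v (genericForm σ P j) =
      ∑ b, if σ b = j then v (Sum.inl b) * aeval (v ∘ Sum.inr ∘ Sum.inl) (P b) else 0 := by
  simp only [genericForm, map_sum, apply_ite (aeval v), map_mul, aeval_X, map_zero, aeval_rename]

lemma aeval_specialForm {L : Type} [CommRing L] [Algebra ℂ L] (σ : β → Fin m)
    (P : β → MvPolynomial ι ℂ) (j : Fin m) (c : β → ℂ) (p : ι → L) :
    aeval p (specialForm σ P c j) =
      ∑ b, if σ b = j then algebraMap ℂ L (c b) * aeval p (P b) else 0 := by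
  simp only [specialForm, map_sum, apply_ite (aeval p), map_mul, aeval_C, map_zero]

lemma pderiv_specialForm (σ : β → Fin m) (P : β → MvPolynomial ι ℂ) (j : Fin m) (c : β → ℂ)
    (q : ι) : pderiv q (specialForm σ P c j) = specialForm σ (fun b => pderiv q (P b)) c j := by
  simp only [specialForm, map_sum, apply_ite (pderiv q), map_zero, pderiv_C_mul]

/-- Differentiating the equations of a dependent point with respect to the coefficient `c_b` shows
that `P_b` vanishes at this point, if the coefficients are algebraically independent. -/
lemma lam_mul_aeval_eq_zero [Fintype ι] {L : Type} [Field L] [Algebra ℂ L] (σ : β → Fin m)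
    (P : β → MvPolynomial ι ℂ) (v : β ⊕ (ι ⊕ Fin m) → L)
    (hinj : Function.Injective (aeval (R := ℂ) (v ∘ Sum.inl)))
    (hv : ∀ a ∈ dependencyIdeal σ P, aeval v a = 0) (b₀ : β) :
    v (Sum.inr (Sum.inr (σ b₀))) * aeval (v ∘ Sum.inr ∘ Sum.inl) (P b₀) = 0 := by
  classical
  let p : ι → L := v ∘ Sum.inr ∘ Sum.inl
  let lam : Fin m → L := v ∘ Sum.inr ∘ Sum.inr
  let _ : Algebra (MvPolynomial β ℂ) L := (aeval (v ∘ Sum.inl)).toAlgebra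
  have _ : IsScalarTower ℂ (MvPolynomial β ℂ) L :=
    IsScalarTower.of_algebraMap_eq' (aeval (v ∘ Sum.inl)).comp_algebraMap.symm
  have hinj' : Function.Injective (algebraMap (MvPolynomial β ℂ) L) := hinj
  have := Algebra.FormallySmooth.of_injective_field hinj'
  -- `δ` extends ∂/∂c_{b₀} from the polynomial ring in the coefficients, embedded in `L` by `hinj`.
  -- Its values on the coordinates of the point are unknown, and they will cancel.
  obtain ⟨δ, hδ⟩ := Derivation.exists_extension (L := L)
    (mkDerivation ℂ (fun b : β => if b = b₀ then (1 : L) else 0))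
  have hδc : ∀ b, δ (v (Sum.inl b)) = if b = b₀ then 1 else 0 := fun b => by
    have := hδ (X b)
    rw [mkDerivation_X] at this
    rw [← this]
    congr 1
    exact ((aeval_X (v ∘ Sum.inl) b)).symm
  have hF : ∀ j, lam j * aeval v (genericForm σ P j) = 0 := fun j => by
    have := hv _ (Ideal.subset_span (Or.inl ⟨j, rfl⟩))
    rwa [map_mul, aeval_X] at this
  have hG : ∀ q, ∑ j, lam j * aeval v (genericForm σ (fun b => pderiv q (P b)) j) = 0 := fun q => by
    have := hv _ (Ideal.subset_span (Or.inr ⟨q, rfl⟩))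
    simp only [map_sum, map_mul, aeval_X] at this
    exact this
  have hδF : ∀ j, δ (aeval v (genericForm σ P j)) =
      (if σ b₀ = j then aeval p (P b₀) else 0) +
        ∑ q, aeval v (genericForm σ (fun b => pderiv q (P b)) j) * δ (p q) := fun j => by
    simp only [aeval_genericForm, map_sum, Finset.sum_mul]
    rw [Finset.sum_comm, ← Finset.sum_ite_eq' Finset.univ b₀
      (fun b => if σ b = j then aeval p (P b) else 0) |>.trans (if_pos (Finset.mem_univ _)),
      ← Finset.sum_add_distrib]
    refine Finset.sum_congr rfl fun b _ => ?_
    by_cases hb : σ b = j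
    · simp only [hb, if_true, Derivation.leibniz, hδc, Derivation.apply_aeval, smul_eq_mul,
        Finset.mul_sum, mul_ite, mul_one, mul_zero, mul_assoc]
      rw [add_comm]
    · simp [hb]
  -- One of the two factors in `hF` vanishes, so the multipliers themselves never have to be
  -- differentiated.
  have hzero : ∀ j, lam j * δ (aeval v (genericForm σ P j)) = 0 := fun j => by
    rcases mul_eq_zero.1 (hF j) with h | h
    · rw [h, zero_mul]
    · rw [h, map_zero, mul_zero]
  have hsum : ∑ j, lam j * δ (aeval v (genericForm σ P j)) = 0 :=
    Finset.sum_eq_zero fun j _ => hzero j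
  -- In the sum over `j` the gradient terms cancel by `hG`; the direct derivative by c_{b₀} remains.
  simp only [hδF, mul_add, Finset.sum_add_distrib, Finset.mul_sum] at hsum
  rw [Finset.sum_comm (s := Finset.univ (α := Fin m))] at hsum
  have h2 : ∀ q, ∑ j, lam j * (aeval v (genericForm σ (fun b => pderiv q (P b)) j) * δ (p q)) = 0 :=
    fun q => by
      simp only [← mul_assoc]
      rw [← Finset.sum_mul, hG, zero_mul]
  simp only [h2, Finset.sum_const_zero, add_zero, mul_ite, mul_zero, Finset.sum_ite_eq,
    Finset.mem_univ, if_true] at hsum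
  exact hsum

/-- A generic member of a base point free family has no dependency. -/
lemma exists_mul_mem_dependencyIdeal [Fintype ι] (σ : β → Fin m) (P : β → MvPolynomial ι ℂ)
    (j₀ : Fin m) (μ : MvPolynomial ι ℂ)
    (hP : ∀ (κ : Type) [Field κ] [Algebra ℂ κ] (p : ι → κ), aeval p μ ≠ 0 →
      ∃ b, σ b = j₀ ∧ aeval p (P b) ≠ 0) :
    ∃ (D : MvPolynomial β ℂ) (N : ℕ), D ≠ 0 ∧
      rename Sum.inl D * (X (Sum.inr (Sum.inr j₀)) * rename (Sum.inr ∘ Sum.inl) μ) ^ N ∈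
        dependencyIdeal σ P := by
  let A := MvPolynomial (β ⊕ (ι ⊕ Fin m)) ℂ
  let y : A := X (Sum.inr (Sum.inr j₀)) * rename (Sum.inr ∘ Sum.inl) μ
  by_contra! hcon
  -- If the ideal missed `S`, a prime above it missing `S` would give a dependent point over a
  -- field, with algebraically independent coefficients and with `λ_{j₀} μ ≠ 0`.
  let S : Submonoid A :=
    (nonZeroDivisors (MvPolynomial β ℂ)).map (rename (Sum.inl : β → β ⊕ (ι ⊕ Fin m)) : _ →ₐ[ℂ] A)
      ⊔ Submonoid.powers y
  have hdisj : Disjoint (dependencyIdeal σ P : Set A) S := by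
    rw [Set.disjoint_left]
    rintro a ha hS
    obtain ⟨_, ⟨D, hD, rfl⟩, _, ⟨N, rfl⟩, rfl⟩ := Submonoid.mem_sup.1 hS
    exact hcon D N (nonZeroDivisors.ne_zero hD) ha
  obtain ⟨Q, hQ, hle, hQd⟩ := Ideal.exists_le_prime_disjoint _ S hdisj
  let L := FractionRing (A ⧸ Q)
  let ψ : A →ₐ[ℂ] L := (IsScalarTower.toAlgHom ℂ (A ⧸ Q) L).comp (Ideal.Quotient.mkₐ ℂ Q)
  have hQL : ∀ a : A, ψ a = 0 ↔ a ∈ Q := fun a =>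
    (IsFractionRing.to_map_eq_zero_iff (K := L) (x := Ideal.Quotient.mk Q a)).trans
      Ideal.Quotient.eq_zero_iff_mem
  let v : β ⊕ (ι ⊕ Fin m) → L := fun i => ψ (X i)
  have hv : ψ = aeval v := MvPolynomial.algHom_ext fun i => (aeval_X v i).symm
  have hne : ∀ a ∈ S, aeval v a ≠ 0 := fun a ha h0 =>
    Set.disjoint_left.1 hQd ((hQL a).1 (hv ▸ h0)) ha
  have hy : aeval v y ≠ 0 := hne y (Submonoid.mem_sup_right (Submonoid.mem_powers y))
  rw [map_mul, aeval_X, aeval_rename] at hy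
  obtain ⟨b₀, hb₀, hPb⟩ := hP L (v ∘ Sum.inr ∘ Sum.inl) (right_ne_zero_of_mul hy)
  refine mul_ne_zero (left_ne_zero_of_mul hy) hPb (hb₀ ▸ lam_mul_aeval_eq_zero σ P v ?_ ?_ b₀)
  · rw [injective_iff_map_eq_zero]
    intro D hD
    by_contra hD0
    refine hne (rename Sum.inl D) (Submonoid.mem_sup_left
      ⟨D, mem_nonZeroDivisors_of_ne_zero hD0, rfl⟩) ?_
    rw [aeval_rename]
    exact hD
  · intro a ha
    rw [← hv]
    exact (hQL a).2 (hle ha)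

end Bertini

open MvPolynomial in
/-- Bertini's theorem for base point free families on a product of projective spaces. -/
theorem exists_polynomial_isTransversal {t : ℕ} {n : Fin t → ℕ} {β : Type} [Fintype β] {m : ℕ}
    (σ : β → Fin m) (P : β → MvPolynomial (MultiProj.Idx n) ℂ)
    (hP : ∀ (κ : Type) [Field κ] [Algebra ℂ κ] (p : MultiProj.Idx n → κ),
      (∀ i, ∃ k, p ⟨i, k⟩ ≠ 0) → ∀ j, ∃ b, σ b = j ∧ aeval p (P b) ≠ 0) :
    ∃ D : MvPolynomial β ℂ, D ≠ 0 ∧ ∀ c : β → ℂ, eval c D ≠ 0 →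
      IsTransversal (specialForm σ P c) := by
  classical
  -- `μ J` is nonzero exactly on the chart `J`. The product of the discriminants `D` over the
  -- finitely many charts and forms then serves for all points.
  let μ : (∀ i, Fin (n i + 1)) → MvPolynomial (MultiProj.Idx n) ℂ := fun J => ∏ i, X ⟨i, J i⟩
  have h : ∀ (J : ∀ i, Fin (n i + 1)) (j : Fin m), ∃ (D : MvPolynomial β ℂ) (N : ℕ), D ≠ 0 ∧
      rename Sum.inl D * (X (Sum.inr (Sum.inr j)) * rename (Sum.inr ∘ Sum.inl) (μ J)) ^ N ∈
        dependencyIdeal σ P := fun J j =>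
    exists_mul_mem_dependencyIdeal σ P j (μ J) fun κ _ _ p hp => by
      refine hP κ p (fun i => ⟨J i, fun h0 => hp ?_⟩) j
      simp only [μ, map_prod, aeval_X]
      exact Finset.prod_eq_zero (Finset.mem_univ i) h0
  choose D N hD hmem using h
  refine ⟨∏ J, ∏ j, D J j, Finset.prod_ne_zero_iff.2 fun J _ =>
    Finset.prod_ne_zero_iff.2 fun j _ => hD J j, fun c hc κ _ _ p lam hp h1 h2 => ?_⟩
  choose J hJ using hp
  funext j
  let v : β ⊕ (MultiProj.Idx n ⊕ Fin m) → κ :=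
    Sum.elim (fun b => algebraMap ℂ κ (c b)) (Sum.elim p lam)
  have hle : dependencyIdeal σ P ≤ RingHom.ker (aeval v) := by
    rw [dependencyIdeal, Ideal.span_le]
    rintro _ (⟨j, rfl⟩ | ⟨q, rfl⟩)
    · rw [SetLike.mem_coe, RingHom.mem_ker, map_mul, aeval_X, aeval_genericForm]
      refine Eq.trans ?_ (h1 j)
      rw [aeval_specialForm]
      rfl
    · rw [SetLike.mem_coe, RingHom.mem_ker, map_sum]
      simp only [map_mul, aeval_X, aeval_genericForm]
      refine Eq.trans ?_ (h2 q)
      simp only [pderiv_specialForm, aeval_specialForm]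
      rfl
  have := hle (hmem J j)
  rw [RingHom.mem_ker, map_mul, map_pow, map_mul, aeval_X, aeval_rename, aeval_rename] at this
  rcases mul_eq_zero.1 this with h | h
  · exfalso
    rw [map_prod] at hc
    have h3 := Finset.prod_ne_zero_iff.1 hc J (Finset.mem_univ _)
    rw [map_prod] at h3
    have h4 := Finset.prod_ne_zero_iff.1 h3 j (Finset.mem_univ _)
    apply h4
    have h5 : aeval (v ∘ Sum.inl) (D J j) = algebraMap ℂ κ (eval c (D J j)) := by
      rw [← coe_aeval_eq_eval]
      exact aeval_algebraMap_apply κ c (D J j)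
    rw [h5] at h
    exact (map_eq_zero _).1 h
  · rcases mul_eq_zero.1 (IsReduced.eq_zero _ ⟨_, h⟩) with h | h
    · exact h
    · exfalso
      simp only [μ, map_prod, aeval_X] at h
      obtain ⟨i, _, hi⟩ := Finset.prod_eq_zero_iff.1 h
      exact hJ i hi

/-! ### The Cartan decomposition over a valuation ring -/

section Cartan

open Matrix

variable {F : Type} [Field F] (O : ValuationSubring F)

/-- `M` is a product `k a k'` with `k`, `k'` invertible over `O` and `a` diagonal. -/
def HasCartanDecomposition {ι : Type} [Fintype ι] [DecidableEq ι] (M : Matrix ι ι F) : Prop :=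
  ∃ (k k' : Matrix ι ι O) (a : ι → F), IsUnit k ∧ IsUnit k' ∧
    M = k.map O.subtype * diagonal a * k'.map O.subtype

variable {O}

/-- Permutation matrices are invertible over `O`, so a pivot may be moved to the corner. -/
lemma HasCartanDecomposition.of_submatrix {ι ι' : Type} [Fintype ι] [DecidableEq ι] [Fintype ι']
    [DecidableEq ι'] {M : Matrix ι ι F} (e f : ι' ≃ ι)
    (h : HasCartanDecomposition O (M.submatrix e f)) : HasCartanDecomposition O M := by
  obtain ⟨k, k', a, hk, hk', hM⟩ := h
  refine ⟨k.submatrix e.symm e.symm, k'.submatrix e.symm f.symm, a ∘ e.symm,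
    (isUnit_submatrix_equiv (A := k) e.symm e.symm).2 hk,
    (isUnit_submatrix_equiv (A := k') e.symm f.symm).2 hk', ?_⟩
  have : M = (M.submatrix e f).submatrix e.symm f.symm := by
    ext
    simp
  rw [this, hM, ← submatrix_mul_equiv _ _ _ e.symm, ← submatrix_mul_equiv _ _ _ e.symm,
    submatrix_map, submatrix_map, submatrix_diagonal_equiv]

/-- One elimination step: integral unipotent factors combine with a decomposition of the Schur
complement `D`. -/
lemma HasCartanDecomposition.fromBlocks_one {ι : Type} [Fintype ι] [DecidableEq ι]
    (A : Matrix Unit Unit F) (D : Matrix ι ι F) (c : Matrix ι Unit O) (r : Matrix Unit ι O)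
    (hD : HasCartanDecomposition O D) :
    HasCartanDecomposition O (fromBlocks 1 0 (c.map O.subtype) 1 * fromBlocks A 0 0 D *
      fromBlocks 1 (r.map O.subtype) 0 1) := by
  obtain ⟨k, k', a, hk, hk', rfl⟩ := hD
  refine ⟨fromBlocks 1 0 c k, fromBlocks 1 r 0 k', Sum.elim (fun _ => A () ()) a, ?_, ?_, ?_⟩
  · rw [isUnit_iff_isUnit_det, det_fromBlocks_zero₁₂, det_one, one_mul, ← isUnit_iff_isUnit_det]
    exact hk
  · rw [isUnit_iff_isUnit_det, det_fromBlocks_zero₂₁, det_one, one_mul, ← isUnit_iff_isUnit_det]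
    exact hk'
  · have h1 : ((1 : Matrix Unit Unit O).map O.subtype) = 1 := Matrix.map_one _ (map_zero _) (map_one _)
    have h0 : ((0 : Matrix Unit ι O).map O.subtype) = 0 := Matrix.map_zero _ (map_zero _)
    have h0' : ((0 : Matrix ι Unit O).map O.subtype) = 0 := Matrix.map_zero _ (map_zero _)
    have hA : A = diagonal fun _ => A () () := by
      ext
      simp
    rw [fromBlocks_map, fromBlocks_map, h1, h0, h0', ← fromBlocks_diagonal, ← hA]
    simp only [fromBlocks_multiply, Matrix.mul_zero, Matrix.zero_mul, Matrix.one_mul,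
      Matrix.mul_one, add_zero, zero_add, Matrix.mul_assoc]

/-- Gaussian elimination with an entry of largest value as pivot: it divides all other entries over
`O`, so the multipliers of the elimination are integral. -/
theorem hasCartanDecomposition (O : ValuationSubring F) (N : ℕ) (M : Matrix (Fin N) (Fin N) F) :
    HasCartanDecomposition O M := by
  induction N with
  | zero => exact ⟨1, 1, 0, isUnit_one, isUnit_one, Subsingleton.elim _ _⟩
  | succ N ih =>
    obtain ⟨⟨p, q⟩, -, hpq⟩ := Finset.exists_max_image Finset.univ
      (fun x : Fin (N + 1) × Fin (N + 1) => O.valuation (M x.1 x.2)) Finset.univ_nonempty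
    by_cases hM : M p q = 0
    · have : M = 0 := by
        ext i j
        have := hpq (i, j) (Finset.mem_univ _)
        simp only [hM, map_zero, le_zero_iff] at this
        exact (map_eq_zero _).1 this
      refine ⟨1, 1, 0, isUnit_one, isUnit_one, ?_⟩
      simp [this]
    have hex : ∀ p : Fin (N + 1), ∃ e : Unit ⊕ Fin N ≃ Fin (N + 1), e (Sum.inl ()) = p := fun p => by
      let e : Unit ⊕ Fin N ≃ Fin (N + 1) := Fintype.equivOfCardEq (by simp [add_comm])
      exact ⟨e.trans (Equiv.swap (e (Sum.inl ())) p), by simp⟩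
    obtain ⟨e, he⟩ := hex p
    obtain ⟨f, hf⟩ := hex q
    apply HasCartanDecomposition.of_submatrix e f
    let M' := M.submatrix e f
    have hA : M'.toBlocks₁₁.det ≠ 0 := by
      rw [det_unique]
      change M (e (Sum.inl ())) (f (Sum.inl ())) ≠ 0
      rwa [he, hf]
    let _ : Invertible M'.toBlocks₁₁ := invertibleOfIsUnitDet _ hA.isUnit
    have hinv : ⅟ M'.toBlocks₁₁ = diagonal fun _ => (M p q)⁻¹ := by
      rw [invOf_eq_right_inv]
      ext
      simp [mul_diagonal, M', toBlocks₁₁, he, hf, hM]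
    have hmem : ∀ i j, (M p q)⁻¹ * M i j ∈ O := fun i j => by
      rw [← O.valuation_le_one_iff, map_mul, map_inv₀]
      exact inv_mul_le_one_of_le₀ (hpq (i, j) (Finset.mem_univ _)) zero_le
    change HasCartanDecomposition O M'
    rw [← fromBlocks_toBlocks M', fromBlocks_eq_of_invertible₁₁]
    have hc : M'.toBlocks₂₁ * ⅟ M'.toBlocks₁₁ = Matrix.map (Matrix.of fun i j =>
        (⟨_, hmem (e (Sum.inr i)) (f (Sum.inl j))⟩ : O)) O.subtype := by
      ext i j
      rw [hinv]
      simp [mul_diagonal, M', toBlocks₂₁, mul_comm]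
    have hr : ⅟ M'.toBlocks₁₁ * M'.toBlocks₁₂ = Matrix.map (Matrix.of fun i j =>
        (⟨_, hmem (e (Sum.inl i)) (f (Sum.inr j))⟩ : O)) O.subtype := by
      ext i j
      rw [hinv]
      simp [diagonal_mul, M', toBlocks₁₂]
    rw [hc, hr]
    exact HasCartanDecomposition.fromBlocks_one _ _ _ _ (ih _)

end Cartan

/-! ### The valuative criterion for integral elements -/

/-- The values at `x` of monic polynomials form a multiplicative set, which misses 0 if `x` is not
integral. Modulo a prime missing this set, `x` is still not integral, now inside a field, where the
integral closure of a subring is the intersection of the valuation rings containing it. -/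
lemma exists_valuationSubring_of_not_isIntegral {R A : Type} [CommRing R] [CommRing A]
    [Algebra R A] {x : A} (hx : ¬ IsIntegral R x) :
    ∃ (F : Type) (_ : Field F) (φ : A →+* F) (O : ValuationSubring F),
      (∀ r, φ (algebraMap R A r) ∈ O) ∧ φ x ∉ O := by
  let S : Submonoid A :=
    { carrier := {a | ∃ f : Polynomial R, f.Monic ∧ Polynomial.aeval x f = a}
      mul_mem' := by
        rintro _ _ ⟨f, hf, rfl⟩ ⟨g, hg, rfl⟩
        exact ⟨f * g, hf.mul hg, map_mul _ _ _⟩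
      one_mem' := ⟨1, Polynomial.monic_one, map_one _⟩ }
  have hdisj : Disjoint ((⊥ : Ideal A) : Set A) S := by
    rw [Set.disjoint_left]
    rintro a ha ⟨f, hf, hfa⟩
    exact hx ⟨f, hf, hfa.trans ha⟩
  obtain ⟨Q, hQ, -, hQS⟩ := Ideal.exists_le_prime_disjoint _ S hdisj
  let F := FractionRing (A ⧸ Q)
  let φ : A →+* F := (algebraMap (A ⧸ Q) F).comp (Ideal.Quotient.mk Q)
  have hφ : ∀ a, φ a = 0 → a ∈ Q := fun a ha => Ideal.Quotient.eq_zero_iff_mem.1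
    ((IsFractionRing.to_map_eq_zero_iff (K := F) (x := Ideal.Quotient.mk Q a)).1 ha)
  let T : Subring F := (φ.comp (algebraMap R A)).range
  have hT : Subring.closure (T : Set F) = T := Subring.closure_eq T
  have hnot : φ x ∉ (integralClosure (Subring.closure (T : Set F)) F).toSubring := by
    rw [hT]
    intro h
    obtain ⟨f, hf, hfx⟩ : IsIntegral T (φ x) := h
    -- A monic equation over the image of `R` lifts to a monic polynomial over `R`, whose value at
    -- `x` would lie in `Q`.
    obtain ⟨g₀, hg₀⟩ := Polynomial.map_surjective _
      (φ.comp (algebraMap R A)).rangeRestrict_surjective f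
    obtain ⟨g, hg, -, hgm⟩ := Polynomial.lifts_and_natDegree_eq_and_monic
      (⟨g₀, hg₀⟩ : f ∈ Polynomial.lifts (φ.comp (algebraMap R A)).rangeRestrict) hf
    refine Set.disjoint_left.1 hQS (hφ (Polynomial.aeval x g) ?_) ⟨g, hgm, rfl⟩
    rw [Polynomial.aeval_def, Polynomial.hom_eval₂]
    rw [← hg, Polynomial.eval₂_map] at hfx
    exact hfx
  rw [← iInf_valuationSubring_superset] at hnot
  simp only [Subring.mem_iInf, not_forall] at hnot
  obtain ⟨⟨O, hO⟩, hxO⟩ := hnot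
  exact ⟨F, inferInstance, φ, O, fun r => hO ⟨r, rfl⟩, hxO⟩

/-! ### Finite morphisms of affine varieties -/

section Finite

open MvPolynomial

variable {E B : Type} (I : Ideal (MvPolynomial E ℂ)) (Φ : B → MvPolynomial E ℂ)

/-- The morphism from the zero set of `I` to affine space with components `Φ` is finite. -/
def IsFiniteMorphism : Prop :=
  ∀ q, (aeval (R := ℂ) (fun b => Ideal.Quotient.mk I (Φ b))).toRingHom.IsIntegralElem
    (Ideal.Quotient.mk I (X q))

variable {I Φ}

lemma IsFiniteMorphism.isIntegral (h : IsFiniteMorphism I Φ) :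
    (aeval (R := ℂ) (fun b => Ideal.Quotient.mk I (Φ b))).toRingHom.IsIntegral := by
  intro a
  obtain ⟨f, rfl⟩ := Ideal.Quotient.mk_surjective a
  induction f using MvPolynomial.induction_on with
  | C c =>
    have : Ideal.Quotient.mk I (C c) =
        (aeval (R := ℂ) (fun b => Ideal.Quotient.mk I (Φ b))).toRingHom (C c) :=
      ((aeval (R := ℂ) (fun b => Ideal.Quotient.mk I (Φ b))).commutes c).symm
    rw [this]
    exact RingHom.isIntegralElem_map _
  | add f g hf hg =>
    rw [map_add]
    exact hf.add _ hg
  | mul_X f q hf =>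
    rw [map_mul]
    exact hf.mul _ (h q)

/-- On the fibre over `y`, each coordinate is a root of its integral equation specialized at `y`,
which is monic and has finitely many roots. -/
lemma IsFiniteMorphism.finite_fiber [Finite E] (h : IsFiniteMorphism I Φ) (y : B → ℂ) :
    {x : E → ℂ | (∀ f ∈ I, eval x f = 0) ∧ ∀ b, eval x (Φ b) = y b}.Finite := by
  choose f hf hfx using h
  refine Set.Finite.subset (Set.Finite.pi (t := fun q => {z : ℂ | ((f q).map (eval y)).IsRoot z})
    fun q => Polynomial.finite_setOfPred_isRoot ((hf q).map _).ne_zero) ?_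
  rintro x ⟨hx, hxy⟩ q -
  let ψ : MvPolynomial E ℂ ⧸ I →+* ℂ := Ideal.Quotient.lift I (eval x) hx
  have h1 := congrArg ψ (hfx q)
  rw [map_zero, Polynomial.hom_eval₂] at h1
  have h2 : ψ.comp (aeval (R := ℂ) (fun b => Ideal.Quotient.mk I (Φ b))).toRingHom = eval y := by
    apply MvPolynomial.ringHom_ext
    · intro c
      have : (aeval (R := ℂ) (fun b => Ideal.Quotient.mk I (Φ b))) (C c) =
        Ideal.Quotient.mk I (C c) :=
        (aeval (R := ℂ) (fun b => Ideal.Quotient.mk I (Φ b))).commutes c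
      change ψ ((aeval (R := ℂ) (fun b => Ideal.Quotient.mk I (Φ b))) (C c)) = _
      rw [this]
      simp [ψ]
    · intro b
      change ψ ((aeval (R := ℂ) (fun b => Ideal.Quotient.mk I (Φ b))) (X b)) = _
      rw [aeval_X]
      simp [ψ, hxy]
  rw [h2] at h1
  have h3 : ψ (Ideal.Quotient.mk I (X q)) = x q := by simp [ψ]
  rw [h3] at h1
  change Polynomial.eval _ _ = _
  rw [Polynomial.eval_map]
  exact h1

/-- Finite morphisms are closed, by lying over: `hy` puts `y` in the closure of the image, so its
maximal ideal contains the kernel and lies under a maximal ideal, whose residue field is integral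
over ℂ and hence equal to ℂ. -/
lemma IsFiniteMorphism.exists_preimage (h : IsFiniteMorphism I Φ) (y : B → ℂ)
    (hy : ∀ P : MvPolynomial B ℂ, aeval Φ P ∈ I → eval y P = 0) :
    ∃ x : E → ℂ, (∀ f ∈ I, eval x f = 0) ∧ ∀ b, eval x (Φ b) = y b := by
  let A := MvPolynomial E ℂ ⧸ I
  let θ : MvPolynomial B ℂ →ₐ[ℂ] A := aeval (R := ℂ) (fun b => Ideal.Quotient.mk I (Φ b))
  have hθ : ∀ P, θ P = Ideal.Quotient.mk I (aeval Φ P) := fun P => by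
    have : θ = (Ideal.Quotient.mkₐ ℂ I).comp (aeval Φ) := by
      ext
      simp [θ]
    rw [this]
    rfl
  let _ : Algebra (MvPolynomial B ℂ) A := θ.toRingHom.toAlgebra
  have _ : IsScalarTower ℂ (MvPolynomial B ℂ) A :=
    IsScalarTower.of_algebraMap_eq' θ.comp_algebraMap.symm
  have _ : Algebra.IsIntegral (MvPolynomial B ℂ) A := ⟨h.isIntegral⟩
  let 𝔫 : Ideal (MvPolynomial B ℂ) := RingHom.ker (eval y)
  have h𝔫 : 𝔫.IsMaximal := RingHom.ker_isMaximal_of_surjective (eval y) fun c => ⟨C c, by simp⟩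
  obtain ⟨𝔪, h𝔪, hover⟩ := Ideal.exists_ideal_over_maximal_of_isIntegral (S := A) 𝔫 fun P hP => by
    apply hy
    rw [← Ideal.Quotient.eq_zero_iff_mem, ← hθ]
    exact hP
  -- Modulo `𝔪` the coefficients of an integral equation become their values at `y`.
  have hint : Algebra.IsIntegral ℂ (A ⧸ 𝔪) := ⟨fun z => by
    obtain ⟨a, rfl⟩ := Ideal.Quotient.mk_surjective z
    obtain ⟨f, hf, hfa⟩ := h.isIntegral a
    refine ⟨f.map (eval y), hf.map _, ?_⟩
    have h2 : (algebraMap ℂ (A ⧸ 𝔪)).comp (eval y) = (Ideal.Quotient.mk 𝔪).comp θ.toRingHom := by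
      ext P
      · simp only [RingHom.comp_apply, eval_C]
        exact ((Ideal.Quotient.mkₐ ℂ 𝔪).comp θ).commutes P |>.symm
      · have : X P - C (y P) ∈ 𝔪.comap (algebraMap (MvPolynomial B ℂ) A) := by
          rw [hover]
          simp [𝔫]
        have : Ideal.Quotient.mk 𝔪 (θ (X P - C (y P))) = 0 := Ideal.Quotient.eq_zero_iff_mem.2 this
        rw [map_sub, map_sub, sub_eq_zero] at this
        rw [RingHom.comp_apply, RingHom.comp_apply, eval_X]
        exact (this.trans (((Ideal.Quotient.mkₐ ℂ 𝔪).comp θ).commutes (y P))).symm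
    rw [Polynomial.eval₂_map, h2, ← Polynomial.hom_eval₂]
    have := congrArg (Ideal.Quotient.mk 𝔪) hfa
    rw [map_zero] at this
    exact this⟩
  let _ : Field (A ⧸ 𝔪) := Ideal.Quotient.field 𝔪
  have hbij : Function.Bijective (algebraMap ℂ (A ⧸ 𝔪)) :=
    IsAlgClosed.algebraMap_bijective_of_isIntegral
  let ε : (A ⧸ 𝔪) ≃ₐ[ℂ] ℂ := (AlgEquiv.ofBijective (Algebra.ofId ℂ (A ⧸ 𝔪)) hbij).symm
  let ψ : MvPolynomial E ℂ →ₐ[ℂ] ℂ :=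
    (ε.toAlgHom.comp (Ideal.Quotient.mkₐ ℂ 𝔪)).comp (Ideal.Quotient.mkₐ ℂ I)
  have hψ : ∀ f, ψ f = eval (fun q => ψ (X q)) f := fun f => by
    have : ψ = aeval fun q => ψ (X q) := MvPolynomial.algHom_ext fun q => (aeval_X (fun q => ψ (X q)) q).symm
    conv_lhs => rw [this]
    rw [← coe_aeval_eq_eval]
    rfl
  refine ⟨fun q => ψ (X q), fun f hf => ?_, fun b => ?_⟩
  · rw [← hψ]
    change ε (Ideal.Quotient.mk 𝔪 (Ideal.Quotient.mk I f)) = 0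
    rw [Ideal.Quotient.eq_zero_iff_mem.2 hf, map_zero, map_zero]
  · rw [← hψ]
    have : X b - C (y b) ∈ 𝔪.comap (algebraMap (MvPolynomial B ℂ) A) := by
      rw [hover]
      simp [𝔫]
    have : Ideal.Quotient.mk 𝔪 (θ (X b - C (y b))) = 0 := Ideal.Quotient.eq_zero_iff_mem.2 this
    rw [hθ] at this
    have h3 : ψ (aeval Φ (X b - C (y b))) = 0 := by
      change ε (Ideal.Quotient.mk 𝔪 (Ideal.Quotient.mk I _)) = 0
      rw [this, map_zero]
    rw [map_sub, map_sub, aeval_X, aeval_C, sub_eq_zero] at h3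
    rw [h3]
    exact ψ.commutes (y b)

end Finite

namespace MultiProj

open MvPolynomial

variable {t : ℕ} {n : Fin t → ℕ}

/-! ### Multidegrees and linear substitutions -/

variable (n) in
/-- The multidegree of the homogeneous coordinates. -/
def mdeg (p : Idx n) : Fin t → ℕ := Pi.single p.1 1

lemma weight_mdeg_apply (b : Idx n →₀ ℕ) (i : Fin t) :
    Finsupp.weight (mdeg n) b i = ∑ k, b ⟨i, k⟩ := by
  rw [Finsupp.weight_apply, Finsupp.sum_fintype _ _ (by simp), Finset.sum_apply,
    Fintype.sum_sigma, Finset.sum_eq_single i]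
  · simp [mdeg]
  · intro j _ hj
    simp [mdeg, hj]
  · simp

/-- The algebra endomorphism `f ↦ f ∘ h` of the polynomial ring for a tuple of matrices `h`. -/
def linSub {S : Type} [CommRing S] (h : ∀ i, Matrix (Fin (n i + 1)) (Fin (n i + 1)) S) :
    MvPolynomial (Idx n) S →ₐ[S] MvPolynomial (Idx n) S :=
  aeval fun p => ∑ l, C (h p.1 p.2 l) * X ⟨p.1, l⟩

section linSub

variable {S : Type} [CommRing S] (h : ∀ i, Matrix (Fin (n i + 1)) (Fin (n i + 1)) S)

@[simp] lemma linSub_X (p : Idx n) : linSub h (X p) = ∑ l, C (h p.1 p.2 l) * X ⟨p.1, l⟩ :=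
  aeval_X _ _

lemma linSub_linSub (h' : ∀ i, Matrix (Fin (n i + 1)) (Fin (n i + 1)) S)
    (P : MvPolynomial (Idx n) S) :
    linSub h' (linSub h P) = linSub (fun i => h i * h' i) P := by
  rw [← AlgHom.comp_apply]
  congr 1
  apply algHom_ext
  intro p
  simp only [AlgHom.comp_apply, linSub_X, map_sum, map_mul, algHom_C, algebraMap_eq,
    Matrix.mul_apply, Finset.mul_sum, Finset.sum_mul]
  rw [Finset.sum_comm]
  simp only [mul_assoc]

lemma map_linSub {S' : Type} [CommRing S'] (f : S →+* S') (P : MvPolynomial (Idx n) S) :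
    map f (linSub h P) = linSub (fun i => (h i).map f) (map f P) := by
  induction P using MvPolynomial.induction_on with
  | C c => simp [algHom_C]
  | add P Q hP hQ => simp [hP, hQ]
  | mul_X P p hP => simp [hP, map_sum]

lemma eval_linSub (v : Idx n → S) (P : MvPolynomial (Idx n) S) :
    eval v (linSub h P) = eval (fun p => ∑ l, h p.1 p.2 l * v ⟨p.1, l⟩) P := by
  induction P using MvPolynomial.induction_on with
  | C c => simp [algHom_C]
  | add P Q hP hQ => simp [hP, hQ]
  | mul_X P p hP => simp [hP, map_sum]

lemma pderiv_linSub (q : Idx n) (P : MvPolynomial (Idx n) S) :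
    pderiv q (linSub h P) = ∑ l, C (h q.1 l q.2) * linSub h (pderiv ⟨q.1, l⟩ P) := by
  classical
  induction P using MvPolynomial.induction_on with
  | C c => simp [algHom_C]
  | add P Q hP hQ => simp only [map_add, hP, hQ, mul_add, Finset.sum_add_distrib]
  | mul_X P p hP =>
    obtain ⟨i, k⟩ := p
    obtain ⟨i', k'⟩ := q
    simp only [map_mul, Derivation.leibniz, hP, linSub_X, map_add, mul_add, smul_eq_mul, map_sum,
      pderiv_X, pderiv_C, Finset.sum_add_distrib, mul_zero, add_zero, Finset.mul_sum,
      Pi.single_apply]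
    congr 1
    · by_cases hi : i = i'
      · subst hi
        rw [Finset.sum_eq_single k', Finset.sum_eq_single k]
        · simp [mul_comm]
        · intro l _ hl
          simp [hl.symm]
        · simp
        · intro l _ hl
          simp [hl]
        · simp
      · rw [Finset.sum_eq_zero, Finset.sum_eq_zero]
        · intro l _
          rw [if_neg]
          · simp
          · rintro ⟨⟩
            exact hi rfl
        · intro l _
          rw [if_neg]
          · simp
          · rintro ⟨⟩
            exact hi rfl
    · simp only [Finset.sum_mul]
      rw [Finset.sum_comm]
      refine Finset.sum_congr rfl fun l _ => ?_
      rw [Finset.mul_sum]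
      exact Finset.sum_congr rfl fun l' _ => by ring

lemma linSub_monomial (b : Idx n →₀ ℕ) (c : S) :
    linSub h (monomial b c) = C c * ∏ p, (∑ l, C (h p.1 p.2 l) * X ⟨p.1, l⟩) ^ b p := by
  rw [monomial_eq, map_mul, algHom_C, Finsupp.prod_fintype _ _ (by simp), map_prod]
  simp only [map_pow, linSub_X]
  rfl

lemma isWeightedHomogeneous_linSub {a : Fin t → ℕ} {P : MvPolynomial (Idx n) S}
    (hP : IsWeightedHomogeneous (mdeg n) P a) : IsWeightedHomogeneous (mdeg n) (linSub h P) a := by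
  rw [P.as_sum, map_sum]
  refine IsWeightedHomogeneous.sum _ _ _ fun b hb => ?_
  rw [linSub_monomial]
  refine IsWeightedHomogeneous.C_mul ?_ _
  have hb' : a = ∑ p, b p • mdeg n p := by
    rw [← hP (mem_support_iff.1 hb), Finsupp.weight_apply, Finsupp.sum_fintype _ _ (by simp)]
  rw [hb']
  refine IsWeightedHomogeneous.prod _ _ _ fun p _ => IsWeightedHomogeneous.pow ?_ _
  refine IsWeightedHomogeneous.sum _ _ _ fun l _ => IsWeightedHomogeneous.C_mul ?_ _
  exact isWeightedHomogeneous_X S (mdeg n) (⟨p.1, l⟩ : Idx n)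

lemma linSub_diagonal (d : ∀ i, Fin (n i + 1) → S) (P : MvPolynomial (Idx n) S)
    (b : Idx n →₀ ℕ) :
    coeff b (linSub (fun i => Matrix.diagonal (d i)) P) = coeff b P * ∏ p, d p.1 p.2 ^ b p := by
  classical
  induction P using MvPolynomial.induction_on' with
  | monomial b' c =>
    have h1 : ∀ p : Idx n, ∑ l, C (Matrix.diagonal (d p.1) p.2 l) * X ⟨p.1, l⟩ =
        C (d p.1 p.2) * (X p : MvPolynomial (Idx n) S) := fun p => by
      rw [Finset.sum_eq_single p.2]
      · simp
      · intro l _ hl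
        simp [Matrix.diagonal_apply_ne _ hl.symm]
      · simp
    have h2 : linSub (fun i => Matrix.diagonal (d i)) (monomial b' c) =
        monomial b' (c * ∏ p, d p.1 p.2 ^ b' p) := by
      rw [linSub_monomial]
      simp only [h1, mul_pow, Finset.prod_mul_distrib]
      rw [← mul_assoc, monomial_eq, Finsupp.prod_fintype _ _ (by simp)]
      simp only [map_mul, map_prod, map_pow]
    rw [h2, coeff_monomial, coeff_monomial]
    split_ifs with hb
    · rw [hb]
    · simp
  | add P Q hP hQ => simp [hP, hQ, add_mul]

end linSub

/-! ### Monomials with nonzero coefficients -/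

section Coordinates

variable {κ : Type} [Field κ] (J : ∀ i, Fin (n i + 1))

/-- The point with coordinates `1` at the positions `⟨i, J i⟩` and `0` elsewhere. -/
def coordPoint (κ : Type) [Field κ] (J : ∀ i, Fin (n i + 1)) (p : Idx n) : κ :=
  if p.2 = J p.1 then 1 else 0

variable {J}

/-- Only monomials in the coordinates ⟨i, J i⟩ survive evaluation at the coordinate point. -/
lemma exists_support_of_eval_coordPoint_ne_zero {Q : MvPolynomial (Idx n) κ}
    (h : eval (coordPoint κ J) Q ≠ 0) : ∃ b, coeff b Q ≠ 0 ∧ ∀ p, p.2 ≠ J p.1 → b p = 0 := by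
  rw [eval_eq] at h
  obtain ⟨b, hb, hb'⟩ := Finset.exists_ne_zero_of_sum_ne_zero h
  refine ⟨b, mem_support_iff.1 hb, fun p hp => ?_⟩
  by_contra hbp
  apply right_ne_zero_of_mul hb'
  exact Finset.prod_eq_zero (Finsupp.mem_support_iff.2 hbp) (by simp [coordPoint, hp, hbp])

lemma exists_support_of_eval_pderiv_ne_zero {Q : MvPolynomial (Idx n) κ} {q : Idx n}
    (h : eval (coordPoint κ J) (pderiv q Q) ≠ 0) :
    ∃ b : Idx n →₀ ℕ, coeff (b + Finsupp.single q 1) Q ≠ 0 ∧ ∀ p, p.2 ≠ J p.1 → b p = 0 := by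
  obtain ⟨b, hb, hb'⟩ := exists_support_of_eval_coordPoint_ne_zero h
  rw [coeff_pderiv] at hb
  exact ⟨b, left_ne_zero_of_mul hb, hb'⟩

end Coordinates

/-- Rows of linearly independent vectors can be matched injectively with positions of nonzero
entries. -/
lemma exists_injective_ne_zero {κ ι α : Type} [Field κ] [Finite ι] [Fintype α]
    {v : ι → α → κ} (hv : LinearIndependent κ v) :
    ∃ f : ι → α, Function.Injective f ∧ ∀ j, v j (f j) ≠ 0 := by
  classical
  let T : ι → Finset α := fun j => Finset.univ.filter fun q => v j q ≠ 0
  -- Hall's marriage theorem. A set of rows vanishes outside the union of its supports, so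
  -- restricting to this union keeps the rows independent, which bounds their number by its size.
  obtain ⟨f, hf, hfT⟩ := (Finset.all_card_le_biUnion_card_iff_exists_injective T).1 fun s => by
    let r : (α → κ) →ₗ[κ] (s.biUnion T → κ) := LinearMap.funLeft κ κ Subtype.val
    have hs : LinearIndependent κ fun j : s => r (v j) := by
      rw [Fintype.linearIndependent_iff]
      intro g hg j
      refine (Fintype.linearIndependent_iff.1 (hv.comp (Subtype.val : s → ι)
        Subtype.val_injective)) g ?_ j
      funext q
      by_cases hq : q ∈ s.biUnion T
      · have := congrFun hg ⟨q, hq⟩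
        simpa [r, LinearMap.funLeft_apply, Finset.sum_apply] using this
      · simp only [Finset.sum_apply, Pi.smul_apply, Pi.zero_apply, smul_eq_mul]
        refine Finset.sum_eq_zero fun j _ => ?_
        have : v j q = 0 := by
          by_contra h
          exact hq (Finset.mem_biUnion.2 ⟨j, j.2, by simp [T, h]⟩)
        simp [this]
    simpa only [Module.finrank_fintype_fun_eq_card, Fintype.card_coe] using
      hs.fintype_card_le_finrank
  exact ⟨f, hf, fun j => by simpa [T] using hfT j⟩

/-- Transversality at a coordinate point, after a linear change of coordinates. -/
lemma _root_.IsTransversal.exists_matching {m : ℕ} {Q : Fin m → MvPolynomial (Idx n) ℂ}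
    (hQ : IsTransversal Q) {κ : Type} [Field κ] [Algebra ℂ κ]
    (h : ∀ i, Matrix (Fin (n i + 1)) (Fin (n i + 1)) κ) (hu : ∀ i, IsUnit (h i))
    (J : ∀ i, Fin (n i + 1)) :
    ∃ f : {j // eval (coordPoint κ J) (linSub h (map (algebraMap ℂ κ) (Q j))) = 0} → Idx n,
      Function.Injective f ∧ ∀ j, eval (coordPoint κ J)
        (pderiv (f j) (linSub h (map (algebraMap ℂ κ) (Q j)))) ≠ 0 := by
  classical
  let v : Fin m → Idx n → κ := fun j q =>
    eval (coordPoint κ J) (pderiv q (linSub h (map (algebraMap ℂ κ) (Q j))))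
  refine exists_injective_ne_zero (κ := κ)
    (v := fun j : {j // eval (coordPoint κ J) (linSub h (map (algebraMap ℂ κ) (Q j))) = 0} =>
      v j) ?_
  rw [Fintype.linearIndependent_iff]
  intro g hg
  -- A relation among the gradients of the vanishing forms, extended by 0, becomes a vector of
  -- multipliers as in `IsTransversal`.
  let lam : Fin m → κ := fun j =>
    if hj : eval (coordPoint κ J) (linSub h (map (algebraMap ℂ κ) (Q j))) = 0 then g ⟨j, hj⟩ else 0
  -- The image of the coordinate point under `h`: in factor `i` it is the column `J i`, nonzero
  -- because `h i` is invertible.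
  let pt : Idx n → κ := fun p => h p.1 p.2 (J p.1)
  have hpt : ∀ P : MvPolynomial (Idx n) ℂ,
      eval (coordPoint κ J) (linSub h (map (algebraMap ℂ κ) P)) = aeval pt P := fun P => by
    rw [eval_linSub, aeval_def, eval₂_eq_eval_map]
    congr 1
    congr 1
    funext p
    simp [pt, coordPoint]
  have hlam : lam = 0 := by
    refine hQ κ pt lam ?_ ?_ ?_
    · intro i
      by_contra! hcon
      have h1 := (hu i).map (Matrix.detMonoidHom)
      rw [Matrix.coe_detMonoidHom, Matrix.det_eq_zero_of_column_eq_zero (J i) hcon] at h1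
      exact not_isUnit_zero h1
    · intro j
      by_cases hj : eval (coordPoint κ J) (linSub h (map (algebraMap ℂ κ) (Q j))) = 0
      · rw [← hpt, hj, mul_zero]
      · simp [lam, hj]
    · have hsum : ∀ q : Idx n, ∑ j, lam j * v j q = 0 := fun q => by
        have := congrFun hg q
        simp only [Finset.sum_apply, Pi.smul_apply, smul_eq_mul, Pi.zero_apply] at this
        rw [← this, ← Fintype.sum_subtype_add_sum_subtype
          (fun j => eval (coordPoint κ J) (linSub h (map (algebraMap ℂ κ) (Q j))) = 0),
          Finset.sum_eq_zero (s := (Finset.univ : Finset {j // ¬ _})) (fun j _ => by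
            simp [lam, j.2]), add_zero]
        exact Finset.sum_congr rfl fun j _ => by simp [lam, j.2]
      rintro ⟨i, l⟩
      let w : Fin (n i + 1) → κ := fun l => ∑ j, lam j * aeval pt (pderiv ⟨i, l⟩ (Q j))
      -- By the chain rule, the relation in the new coordinates is the relation at `pt` multiplied
      -- by `h i`, which can be cancelled.
      have hw : Matrix.vecMul w (h i) = 0 := by
        funext k
        refine Eq.trans ?_ (hsum ⟨i, k⟩)
        simp only [v, pderiv_linSub, map_sum, map_mul, eval_C, pderiv_map, hpt, Matrix.vecMul,
          dotProduct, w, Finset.sum_mul, Finset.mul_sum]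
        rw [Finset.sum_comm]
        exact Finset.sum_congr rfl fun j _ => Finset.sum_congr rfl fun l _ => by ring
      have : w = 0 := Matrix.vecMul_injective_iff_isUnit.2 (hu i) (hw.trans (Matrix.zero_vecMul _).symm)
      exact congrFun this l
  intro j
  have := congrFun hlam j
  simpa [lam, j.2] using this

/-- Each of the forms has a nonzero coefficient at a monomial in the coordinates `⟨i, J i⟩`, or at
such a monomial times one further coordinate, where different forms use different coordinates. -/
lemma _root_.IsTransversal.exists_coeff_ne_zero {m : ℕ} {Q : Fin m → MvPolynomial (Idx n) ℂ}
    (hQ : IsTransversal Q) {κ : Type} [Field κ] [Algebra ℂ κ]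
    (h : ∀ i, Matrix (Fin (n i + 1)) (Fin (n i + 1)) κ) (hu : ∀ i, IsUnit (h i))
    (J : ∀ i, Fin (n i + 1)) :
    ∃ (p : Fin m → Prop) (f : {j // p j} → Idx n), Function.Injective f ∧
      ∀ j, ∃ b : Idx n →₀ ℕ, (∀ q, q.2 ≠ J q.1 → b q = 0) ∧
        (∀ hj : p j, coeff (b + Finsupp.single (f ⟨j, hj⟩) 1)
          (linSub h (map (algebraMap ℂ κ) (Q j))) ≠ 0) ∧
        (¬ p j → coeff b (linSub h (map (algebraMap ℂ κ) (Q j))) ≠ 0) := by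
  obtain ⟨f, hf, hne⟩ := hQ.exists_matching h hu J
  refine ⟨_, f, hf, fun j => ?_⟩
  by_cases hj : eval (coordPoint κ J) (linSub h (map (algebraMap ℂ κ) (Q j))) = 0
  · obtain ⟨b, hb, hbJ⟩ := exists_support_of_eval_pderiv_ne_zero (hne ⟨j, hj⟩)
    exact ⟨b, hbJ, fun _ => hb, fun h => absurd hj h⟩
  · obtain ⟨b, hb, hbJ⟩ := exists_support_of_eval_coordPoint_ne_zero hj
    exact ⟨b, hbJ, fun h => absurd h hj, fun _ => hb⟩

end MultiProj

/-! ### Primitive polynomials over a valuation ring -/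

namespace ValuationSubring

open MvPolynomial

variable {F : Type} [Field F] (O : ValuationSubring F) {σ : Type}

lemma exists_map_subtype_eq {P : MvPolynomial σ F} (h : ∀ b, coeff b P ∈ O) :
    ∃ P' : MvPolynomial σ O, map O.subtype P' = P := by
  refine mem_range_map_iff_coeffs_subset.2 fun c hc => ?_
  obtain ⟨b, -, rfl⟩ := mem_coeffs_iff.1 hc
  exact ⟨⟨_, h b⟩, rfl⟩

/-- A nonzero polynomial is a scalar times a polynomial over `O` which is nonzero modulo the
maximal ideal. -/
lemma exists_eq_C_mul_primitive {P : MvPolynomial σ F} (hP : P ≠ 0) :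
    ∃ (c : F) (P' : MvPolynomial σ O), P = C c * map O.subtype P' ∧
      map (IsLocalRing.residue O) P' ≠ 0 := by
  obtain ⟨b₀, hb₀, hmax⟩ := Finset.exists_max_image P.support (fun b => O.valuation (coeff b P))
    (support_nonempty.2 hP)
  have hc : coeff b₀ P ≠ 0 := mem_support_iff.1 hb₀
  obtain ⟨P', hP'⟩ := O.exists_map_subtype_eq (P := C (coeff b₀ P)⁻¹ * P) fun b => by
    rw [coeff_C_mul, ← O.valuation_le_one_iff, map_mul, map_inv₀]
    by_cases hb : b ∈ P.support
    · exact inv_mul_le_one_of_le₀ (hmax b hb) zero_le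
    · rw [notMem_support_iff.1 hb]
      simp
  refine ⟨coeff b₀ P, P', ?_, fun h => ?_⟩
  · rw [hP', ← mul_assoc, ← C_mul, mul_inv_cancel₀ hc, C_1, one_mul]
  · have h1 := congrArg (coeff b₀) hP'
    rw [coeff_map, coeff_C_mul, inv_mul_cancel₀ hc] at h1
    have h2 : coeff b₀ P' = 1 := Subtype.ext h1
    have h3 := congrArg (coeff b₀) h
    rw [coeff_map, h2, map_one, coeff_zero] at h3
    exact one_ne_zero h3

/-- Some coefficient of `P` is a unit. This is applied to a product of primitive polynomials, which
is primitive because polynomials over the residue field form a domain (Gauss's lemma). -/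
lemma mem_of_coeff_C_mul_mem {c : F} {P : MvPolynomial σ O}
    (hP : map (IsLocalRing.residue O) P ≠ 0) (h : ∀ b, coeff b (C c * map O.subtype P) ∈ O) :
    c ∈ O := by
  obtain ⟨b, hb⟩ := ne_zero_iff.1 hP
  rw [coeff_map, IsLocalRing.residue_ne_zero_iff_isUnit] at hb
  obtain ⟨u, hu⟩ := hb
  have h1 := h b
  rw [coeff_C_mul, coeff_map, ← hu] at h1
  have h2 := O.mul_mem _ _ h1 (↑u⁻¹ : O).2
  have h3 : O.subtype u * ((↑u⁻¹ : O) : F) = 1 := congrArg Subtype.val u.mul_inv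
  rwa [mul_assoc, h3, mul_one] at h2

end ValuationSubring

/-- The inequality between weights which destabilizing one-parameter subgroups would violate. -/
lemma weights_le_one {Γ : Type} [LinearOrderedCommGroupWithZero Γ] {t : ℕ} {n : Fin t → ℕ}
    (W : Fin t → Γ) (ρ : MultiProj.Idx n → Γ) (J : ∀ i, Fin (n i + 1)) (hρ : ∀ p, ρ p ≤ 1)
    (hρJ : ∀ i, ρ ⟨i, J i⟩ = 1) (hprod : ∀ i, ∏ k, (W i * ρ ⟨i, k⟩) = 1) {s : Type} [Fintype s]
    (f : s → MultiProj.Idx n) (hf : Function.Injective f) (e : Fin t → ℕ)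
    (he : ∀ i, n i ≠ 0 → n i + 2 ≤ e i) (hle : (∏ i, W i ^ e i) * ∏ j, ρ (f j) ≤ 1)
    (p : MultiProj.Idx n) : W p.1 * ρ p ≤ 1 := by
  classical
  have hprod' : ∀ i, W i ^ (n i + 1) * ∏ k, ρ ⟨i, k⟩ = 1 := fun i => by
    rw [← hprod i, Finset.prod_mul_distrib]
    simp
  have hW : ∀ i, 1 ≤ W i := fun i => by
    have h1 : 1 ≤ W i ^ (n i + 1) := by
      rw [← hprod' i]
      exact mul_le_of_le_one_right' (Finset.prod_le_one' fun k _ => hρ _)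
    by_contra! h
    exact absurd h1 (not_le.2 (pow_lt_one₀ zero_le h (Nat.succ_ne_zero _)))
  -- Injectivity of `f` is essential: omitting factors that are at most 1 can only enlarge a
  -- product.
  have h1 : ∏ p, ρ p ≤ ∏ j, ρ (f j) := by
    rw [← Finset.prod_image (s := Finset.univ) (g := f) (f := ρ) (fun a _ b _ h => hf h)]
    exact Finset.prod_le_prod_of_subset_of_le_one' (Finset.subset_univ _) fun q _ _ => hρ q
  have h2 : ∏ i, (W i ^ e i * ∏ k, ρ ⟨i, k⟩) ≤ 1 := by
    rw [Finset.prod_mul_distrib, ← Fintype.prod_sigma]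
    exact (mul_le_mul_right h1 _).trans hle
  -- The determinant relation `hprod'` has only the exponent `n i + 1`, and `1 ≤ W i`. Together with
  -- `h2` all these factors must equal 1.
  have h3 : ∀ i ∈ Finset.univ, 1 ≤ W i ^ e i * ∏ k, ρ ⟨i, k⟩ := fun i _ => by
    by_cases hn : n i = 0
    · have : ∀ k : Fin (n i + 1), k = J i := fun k => by
        apply Fin.ext
        omega
      have h4 : ∏ k, ρ ⟨i, k⟩ = 1 := Finset.prod_eq_one fun k _ => by rw [this k, hρJ]
      rw [h4, mul_one]
      exact one_le_pow₀ (hW i)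
    · rw [← hprod' i]
      exact mul_le_mul_left (pow_le_pow_right₀ (hW i) (by have := he i hn; omega)) _
  have h4 := (Finset.prod_eq_one_iff_of_one_le' h3).1
    (le_antisymm h2 (Finset.one_le_prod' h3)) p.1 (Finset.mem_univ _)
  have h5 : W p.1 ≤ 1 := by
    by_cases hn : n p.1 = 0
    · have : ∀ k : Fin (n p.1 + 1), k = J p.1 := fun k => by
        apply Fin.ext
        omega
      have h6 : ∏ k, ρ ⟨p.1, k⟩ = 1 := Finset.prod_eq_one fun k _ => by rw [this k, hρJ]
      have h7 := hprod' p.1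
      rw [h6, mul_one, hn, zero_add, pow_one] at h7
      exact h7.le
    · have h6 : W p.1 * (W p.1 ^ (n p.1 + 1) * ∏ k, ρ ⟨p.1, k⟩) ≤ W p.1 ^ e p.1 * ∏ k, ρ ⟨p.1, k⟩ := by
        rw [← mul_assoc, ← pow_succ']
        exact mul_le_mul_left (pow_le_pow_right₀ (hW _) (he _ hn)) _
      rwa [hprod', mul_one, h4] at h6
  exact mul_le_one' h5 (hρ p)

/-! ### Integrality of matrices that transform a transversal product integrally -/

namespace MultiProj

open MvPolynomial

variable {t : ℕ} {n : Fin t → ℕ}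

lemma prod_pow_mul_eq {Γ : Type} [CommMonoid Γ] (W : Fin t → Γ) (ρ : Idx n → Γ)
    {a : Fin t → ℕ} {b : Idx n →₀ ℕ} (hb : Finsupp.weight (mdeg n) b = a) :
    ∏ p, (W p.1 * ρ p) ^ b p = (∏ i, W i ^ a i) * ∏ p, ρ p ^ b p := by
  simp only [mul_pow, Finset.prod_mul_distrib]
  congr 1
  rw [Fintype.prod_sigma]
  refine Finset.prod_congr rfl fun i _ => ?_
  rw [← hb, weight_mdeg_apply, ← Finset.prod_pow_eq_pow_sum]

/-- Substitution by a matrix over `O` preserves polynomials over `O`. This removes the right factor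
of a Cartan decomposition. -/
lemma coeff_linSub_mul_mem {F : Type} [Field F] {O : ValuationSubring F}
    {h : ∀ i, Matrix (Fin (n i + 1)) (Fin (n i + 1)) F} {P : MvPolynomial (Idx n) F}
    (hP : ∀ b, coeff b (linSub h P) ∈ O) (h' : ∀ i, Matrix (Fin (n i + 1)) (Fin (n i + 1)) O)
    (b : Idx n →₀ ℕ) : coeff b (linSub (fun i => h i * (h' i).map O.subtype) P) ∈ O := by
  obtain ⟨P', hP'⟩ := O.exists_map_subtype_eq hP
  rw [← linSub_linSub, ← hP', ← map_linSub, coeff_map]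
  exact (coeff b (linSub h' P')).2

set_option maxHeartbeats 1000000 in
/-- A product of transversal hypersurfaces of large degree has no destabilizing one-parameter
subgroup over a valued field: if its transform by `h` is integral then so is `h`. -/
theorem mem_of_coeff_linSub_mem {m : ℕ} {Q : Fin m → MvPolynomial (Idx n) ℂ}
    (hQ : IsTransversal Q) {a : Fin m → Fin t → ℕ}
    (ha : ∀ j, IsWeightedHomogeneous (mdeg n) (Q j) (a j))
    (hdeg : ∀ i, n i ≠ 0 → n i + 2 ≤ ∑ j, a j i)
    {F : Type} [Field F] [Algebra ℂ F] (O : ValuationSubring F)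
    (hO : ∀ c : ℂ, algebraMap ℂ F c ∈ O)
    (h : ∀ i, Matrix (Fin (n i + 1)) (Fin (n i + 1)) F) (hdet : ∀ i, (h i).det = 1)
    (hmem : ∀ b, coeff b (linSub h (map (algebraMap ℂ F) (∏ j, Q j))) ∈ O)
    (i : Fin t) (k l : Fin (n i + 1)) : h i k l ∈ O := by
  classical
  let ι : ℂ →+* O := (algebraMap ℂ F).codRestrict O.toSubring hO
  let _ : Algebra ℂ O := ι.toAlgebra
  let π : O →+* IsLocalRing.ResidueField O := IsLocalRing.residue O
  let _ : Algebra ℂ (IsLocalRing.ResidueField O) := (π.comp ι).toAlgebra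
  have _ : CharZero (IsLocalRing.ResidueField O) :=
    charZero_of_injective_algebraMap (algebraMap ℂ (IsLocalRing.ResidueField O)).injective
  choose κ κ' d hκ hκ' hdec using fun i => hasCartanDecomposition O (n i + 1) (h i)
  let v := O.valuation
  have hvdet : ∀ {N : ℕ} (M : Matrix (Fin N) (Fin N) O), IsUnit M →
      v (M.map O.subtype).det = 1 := fun M hM => by
    rw [← RingHom.mapMatrix_apply, ← RingHom.map_det]
    exact (O.valuation_eq_one_iff _).1 ((Matrix.isUnit_iff_isUnit_det _).1 hM)
  have hvd : ∀ i, ∏ k, v (d i k) = 1 := fun i => by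
    have h1 := congrArg (fun M => v (Matrix.det M)) (hdec i)
    simp only [hdet, Matrix.det_mul, map_mul, hvdet _ (hκ i), hvdet _ (hκ' i), Matrix.det_diagonal,
      map_one, one_mul, mul_one, map_prod] at h1
    exact h1.symm
  have hvd0 : ∀ i k, v (d i k) ≠ 0 := fun i k h0 => by
    have := hvd i
    rw [Finset.prod_eq_zero (Finset.mem_univ k) h0] at this
    exact zero_ne_one this
  -- `J i` marks the largest diagonal entry in factor `i`. `W` is its value and `ρ` the values
  -- relative to it, so `ρ ≤ 1` with equality at `J`.
  choose J hJ using fun i => Finset.exists_max_image Finset.univ (fun k => v (d i k))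
    Finset.univ_nonempty
  replace hJ : ∀ i k, v (d i k) ≤ v (d i (J i)) := fun i k => (hJ i).2 k (Finset.mem_univ k)
  let W : Fin t → O.ValueGroup := fun i => v (d i (J i))
  let ρ : Idx n → O.ValueGroup := fun p => v (d p.1 p.2) / W p.1
  have hWρ : ∀ p : Idx n, W p.1 * ρ p = v (d p.1 p.2) := fun p => mul_div_cancel₀ _ (hvd0 _ _)
  -- the forms in the coordinates adapted to `h`
  let H : Fin m → MvPolynomial (Idx n) O := fun j => linSub κ (map ι (Q j))
  let G : Fin m → MvPolynomial (Idx n) F := fun j =>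
    linSub (fun i => Matrix.diagonal (d i)) (map O.subtype (H j))
  have hHbar : ∀ j, map π (H j) = linSub (fun i => (κ i).map π)
      (map (algebraMap ℂ (IsLocalRing.ResidueField O)) (Q j)) := fun j => by
    rw [map_linSub, map_map]
    rfl
  have hHhom : ∀ j, IsWeightedHomogeneous (mdeg n) (H j) (a j) := fun j =>
    isWeightedHomogeneous_linSub _ fun b hb => ha j fun h0 => hb (by rw [coeff_map, h0, map_zero])
  have hGcoeff : ∀ j b, v (coeff b (G j)) = v (coeff b (H j) : O) * ∏ p, v (d p.1 p.2) ^ b p :=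
    fun j b => by
      simp only [G, linSub_diagonal, map_mul, map_prod, map_pow, coeff_map]
      rfl
  have hGeq : ∀ j, G j = linSub (fun i => (κ i).map O.subtype * Matrix.diagonal (d i))
      (map (algebraMap ℂ F) (Q j)) := fun j => by
    have : O.subtype.comp ι = algebraMap ℂ F := rfl
    rw [← this, ← map_map, ← linSub_linSub, ← map_linSub]
  have hGprod : ∀ b, coeff b (∏ j, G j) ∈ O := by
    have hfun : (fun i => h i * ((κ' i)⁻¹).map O.subtype) =
        fun i => (κ i).map O.subtype * Matrix.diagonal (d i) := by
      funext i
      have hinv : κ' i * (κ' i)⁻¹ = 1 :=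
        Matrix.mul_nonsing_inv _ ((Matrix.isUnit_iff_isUnit_det _).1 (hκ' i))
      rw [hdec i, Matrix.mul_assoc, ← Matrix.map_mul, hinv,
        Matrix.map_one _ (map_zero _) (map_one _), Matrix.mul_one]
    have : ∏ j, G j = linSub (fun i => h i * ((κ' i)⁻¹).map O.subtype)
        (map (algebraMap ℂ F) (∏ j, Q j)) := by
      rw [hfun, map_prod, map_prod]
      exact Finset.prod_congr rfl fun j _ => hGeq j
    rw [this]
    exact coeff_linSub_mul_mem hmem _
  -- coefficients that are units
  obtain ⟨pr, f, hf, hcoeff⟩ := hQ.exists_coeff_ne_zero (fun i => (κ i).map π)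
    (fun i => (hκ i).map (RingHom.mapMatrix π)) J
  let r : Fin m → O.ValueGroup := fun j => if hj : pr j then ρ (f ⟨j, hj⟩) else 1
  have hρJ : ∀ p : Idx n, p.2 = J p.1 → ρ p = 1 := fun p hp => by
    simp only [ρ, W, hp]
    exact div_self (hvd0 _ _)
  have hρJ' : ∀ b : Idx n →₀ ℕ, (∀ q, q.2 ≠ J q.1 → b q = 0) → ∏ p, ρ p ^ b p = 1 := fun b hb =>
    Finset.prod_eq_one fun p _ => by
      by_cases hp : p.2 = J p.1
      · rw [hρJ p hp, one_pow]
      · rw [hb p hp, pow_zero]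
  have hunit : ∀ j, ∃ b, IsUnit (coeff b (H j)) ∧ ∏ p, ρ p ^ b p = r j := fun j => by
    obtain ⟨b, hbJ, hb1, hb2⟩ := hcoeff j
    by_cases hj : pr j
    · refine ⟨b + Finsupp.single (f ⟨j, hj⟩) 1, ?_, ?_⟩
      · rw [← IsLocalRing.residue_ne_zero_iff_isUnit, ← coeff_map, hHbar]
        exact hb1 hj
      · simp only [Finsupp.add_apply, pow_add, Finset.prod_mul_distrib]
        rw [hρJ' b hbJ, one_mul, Finset.prod_eq_single (f ⟨j, hj⟩)]
        · simp only [r, dif_pos hj, Finsupp.single_eq_same, pow_one]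
        · intro q _ hq
          rw [Finsupp.single_eq_of_ne hq, pow_zero]
        · intro h
          exact absurd (Finset.mem_univ _) h
    · refine ⟨b, ?_, ?_⟩
      · rw [← IsLocalRing.residue_ne_zero_iff_isUnit, ← coeff_map, hHbar]
        exact hb2 hj
      · simp only [r, dif_neg hj]
        exact hρJ' b hbJ
  choose b hb hbr using hunit
  -- The diagonal matrix scales a unit coefficient by the entries of its monomial; multihomogeneity
  -- collects the powers of `W`.
  have hbound : ∀ j, v (coeff (b j) (G j)) = (∏ i, W i ^ a j i) * r j := fun j => by
    have hne : coeff (b j) (H j) ≠ 0 := (hb j).ne_zero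
    rw [hGcoeff, (O.valuation_eq_one_iff _).1 (hb j), one_mul, ← hbr,
      ← prod_pow_mul_eq W ρ (hHhom j hne)]
    simp only [hWρ]
  have hr0 : ∀ j, (∏ i, W i ^ a j i) * r j ≠ 0 := fun j => by
    refine mul_ne_zero (Finset.prod_ne_zero_iff.2 fun i _ => pow_ne_zero _ (hvd0 _ _)) ?_
    simp only [r]
    split_ifs
    · exact div_ne_zero (hvd0 _ _) (hvd0 _ _)
    · exact one_ne_zero
  have hG0 : ∀ j, G j ≠ 0 := fun j h0 => hr0 j (by rw [← hbound, h0, coeff_zero, map_zero])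
  -- `v (c j)` is the Gauss norm of `G j`. Single factors `G j` need not be integral, but the norm
  -- is multiplicative, so integrality of the product bounds the product of the norms.
  choose c G' hGc hG' using fun j => O.exists_eq_C_mul_primitive (hG0 j)
  have hc : ∏ j, c j ∈ O := by
    refine O.mem_of_coeff_C_mul_mem (P := ∏ j, G' j) ?_ ?_
    · rw [map_prod]
      exact Finset.prod_ne_zero_iff.2 fun j _ => hG' j
    · rw [map_prod, map_prod, ← Finset.prod_mul_distrib]
      simp only [← hGc]
      exact hGprod
  have hvc : ∀ j, (∏ i, W i ^ a j i) * r j ≤ v (c j) := fun j => by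
    rw [← hbound, hGc j, coeff_C_mul, map_mul, coeff_map]
    exact mul_le_of_le_one_right' (O.valuation_le_one _)
  have hfinal : (∏ i, W i ^ (∑ j, a j i)) * ∏ j, ρ (f j) ≤ 1 := by
    have h1 : ∏ j, ((∏ i, W i ^ a j i) * r j) ≤ 1 :=
      (Finset.prod_le_prod' fun j _ => hvc j).trans
        (by rw [← map_prod]; exact (O.valuation_le_one_iff _).2 hc)
    rw [Finset.prod_mul_distrib, Finset.prod_comm] at h1
    simp only [Finset.prod_pow_eq_pow_sum] at h1
    rw [← Fintype.prod_subtype_mul_prod_subtype pr r,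
      Finset.prod_eq_one (s := (Finset.univ : Finset {j // ¬ pr j})) (fun j _ => dif_neg j.2),
      mul_one] at h1
    rwa [Finset.prod_congr (g := fun j => ρ (f j)) rfl fun j : {j // pr j} => fun _ =>
      (dif_pos j.2 : r j = _)] at h1
  have hle := weights_le_one W ρ J
    (fun p => div_le_one_of_le₀ (hJ p.1 p.2) zero_le) (fun i => hρJ _ rfl)
    (fun i => by simp only [hWρ ⟨i, _⟩]; exact hvd i) f hf _ hdeg hfinal
  have hdO : ∀ i k, d i k ∈ O := fun i k => (O.valuation_le_one_iff _).1 (hWρ ⟨i, k⟩ ▸ hle ⟨i, k⟩)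
  rw [hdec]
  simp only [Matrix.mul_apply, Matrix.map_apply]
  refine sum_mem fun q _ => mul_mem (sum_mem fun q' _ => mul_mem (Subtype.mem _) ?_) (Subtype.mem _)
  by_cases hq : q' = q
  · subst hq
    rw [Matrix.diagonal_apply_eq]
    exact hdO _ _
  · rw [Matrix.diagonal_apply_ne _ hq]
    exact zero_mem _

end MultiProj

namespace MultiProj

variable {t : ℕ} (n : Fin t → ℕ)

/-! ### Laurent monomials -/

/-- The Laurent monomial with exponents `a` in the homogeneous coordinates. -/
def lm (a : Idx n → ℤ) : BigField n := ∏ p, x n p ^ a p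

lemma lm_zero : lm n 0 = 1 := by simp [lm]

lemma lm_add (a b : Idx n → ℤ) : lm n (a + b) = lm n a * lm n b := by
  simp only [lm, Pi.add_apply, zpow_add₀ (x_ne_zero n _), Finset.prod_mul_distrib]

lemma lm_neg (a : Idx n → ℤ) : lm n (-a) = (lm n a)⁻¹ := by
  simp only [lm, Pi.neg_apply, zpow_neg, Finset.prod_inv_distrib]

lemma lm_sub (a b : Idx n → ℤ) : lm n (a - b) = lm n a / lm n b := by
  rw [sub_eq_add_neg, lm_add, lm_neg, div_eq_mul_inv]

lemma lm_ne_zero (a : Idx n → ℤ) : lm n a ≠ 0 :=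
  Finset.prod_ne_zero_iff.2 fun p _ => zpow_ne_zero _ (x_ne_zero n p)

lemma lm_single (p : Idx n) (c : ℤ) : lm n (Pi.single p c) = x n p ^ c := by
  classical
  rw [lm, Finset.prod_eq_single p]
  · simp
  · intro q _ hq
    simp [Pi.single_eq_of_ne hq]
  · simp

lemma lm_sum {ι : Type} (s : Finset ι) (a : ι → Idx n → ℤ) :
    lm n (∑ i ∈ s, a i) = ∏ i ∈ s, lm n (a i) := by
  classical
  induction s using Finset.induction_on with
  | empty => simp [lm_zero]
  | insert i s hi ih => rw [Finset.sum_insert hi, Finset.prod_insert hi, lm_add, ih]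

lemma lm_natCast (b : Idx n →₀ ℕ) : lm n (fun p => (b p : ℤ)) =
    algebraMap (MvPolynomial (Idx n) ℂ) (BigField n) (MvPolynomial.monomial b 1) := by
  rw [MvPolynomial.monomial_eq, MvPolynomial.C_1, one_mul, Finsupp.prod_fintype _ _ (by simp),
    map_prod]
  simp only [lm, zpow_natCast, map_pow]
  rfl

lemma linearIndependent_lm : LinearIndependent ℂ (lm n) := by
  classical
  rw [linearIndependent_iff']
  intro s g hg a ha
  -- Multiplication by the monomial with exponents `N` clears all denominators and leaves distinct
  -- ordinary monomials.
  let N : Idx n → ℕ := fun p => ∑ b ∈ s, (b p).natAbs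
  have hN : ∀ b ∈ s, ∀ p, 0 ≤ b p + N p := fun b hb p => by
    have : (b p).natAbs ≤ N p := Finset.single_le_sum (f := fun b : Idx n → ℤ => (b p).natAbs)
      (fun _ _ => Nat.zero_le _) hb
    omega
  let e : (Idx n → ℤ) → (Idx n →₀ ℕ) := fun b => Finsupp.equivFunOnFinite.symm
    fun p => (b p + N p).toNat
  have he : ∀ b ∈ s, lm n b * lm n (fun p => (N p : ℤ)) =
      algebraMap (MvPolynomial (Idx n) ℂ) (BigField n) (MvPolynomial.monomial (e b) 1) :=
    fun b hb => by
      rw [← lm_natCast, ← lm_add]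
      congr 1
      funext p
      simp only [e, Finsupp.coe_equivFunOnFinite_symm, Pi.add_apply]
      exact (Int.toNat_of_nonneg (hN b hb p)).symm
  have h1 : ∑ b ∈ s, g b • (MvPolynomial.monomial (e b) (1 : ℂ)) = 0 := by
    apply IsFractionRing.injective (MvPolynomial (Idx n) ℂ) (BigField n)
    rw [map_zero, map_sum, ← zero_mul (lm n (fun p => (N p : ℤ))), ← hg, Finset.sum_mul]
    refine Finset.sum_congr rfl fun b hb => ?_
    rw [smul_mul_assoc, he b hb]
    exact map_smul (IsScalarTower.toAlgHom ℂ (MvPolynomial (Idx n) ℂ) (BigField n)) _ _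
  have h2 := congrArg (MvPolynomial.coeff (e a)) h1
  rw [MvPolynomial.coeff_sum, Finset.sum_eq_single a] at h2
  · simpa using h2
  · intro b hb hne
    rw [MvPolynomial.coeff_smul, MvPolynomial.coeff_monomial, if_neg, smul_zero]
    intro h
    apply hne
    funext p
    have h3 := DFunLike.congr_fun h p
    simp only [e, Finsupp.coe_equivFunOnFinite_symm] at h3
    have := hN b hb p
    have := hN a ha p
    omega
  · exact fun h => absurd ha h

/-- Laurent polynomials with exponents in `S`. -/
def laurent (S : Set (Idx n → ℤ)) : Submodule ℂ (BigField n) := Submodule.span ℂ (lm n '' S)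

variable {n} in
lemma lm_mem_laurent {S : Set (Idx n → ℤ)} {a : Idx n → ℤ} (h : a ∈ S) : lm n a ∈ laurent n S :=
  Submodule.subset_span ⟨a, h, rfl⟩

/-- The coefficients of a Laurent polynomial, extended to a linear map on `BigField n`. -/
def lcoeff : BigField n →ₗ[ℂ] ((Idx n → ℤ) →₀ ℂ) :=
  (LinearMap.exists_leftInverse_of_injective (Finsupp.linearCombination ℂ (lm n))
    (LinearMap.ker_eq_bot.2 (linearIndependent_lm n))).choose

lemma lcoeff_linearCombination (c : (Idx n → ℤ) →₀ ℂ) :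
    lcoeff n (Finsupp.linearCombination ℂ (lm n) c) = c :=
  LinearMap.congr_fun (LinearMap.exists_leftInverse_of_injective
    (Finsupp.linearCombination ℂ (lm n))
    (LinearMap.ker_eq_bot.2 (linearIndependent_lm n))).choose_spec c

lemma lcoeff_lm (a : Idx n → ℤ) : lcoeff n (lm n a) = Finsupp.single a 1 := by
  rw [← lcoeff_linearCombination n (Finsupp.single a 1), Finsupp.linearCombination_single, one_smul]

variable {n}

/-- `lcoeff` has no meaning outside the span of the monomials; the first condition says that `f`
lies in that span. -/
lemma mem_laurent_iff {S : Set (Idx n → ℤ)} {f : BigField n} : f ∈ laurent n S ↔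
    Finsupp.linearCombination ℂ (lm n) (lcoeff n f) = f ∧ ∀ a, lcoeff n f a ≠ 0 → a ∈ S := by
  rw [laurent, Finsupp.mem_span_image_iff_linearCombination]
  constructor
  · rintro ⟨c, hc, rfl⟩
    rw [lcoeff_linearCombination]
    exact ⟨rfl, fun a ha => hc (Finsupp.mem_support_iff.2 ha)⟩
  · rintro ⟨h1, h2⟩
    exact ⟨_, fun a ha => h2 a (Finsupp.mem_support_iff.1 ha), h1⟩

lemma laurent_mono {S T : Set (Idx n → ℤ)} (h : S ⊆ T) : laurent n S ≤ laurent n T :=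
  Submodule.span_mono (Set.image_mono h)

lemma lm_mem_laurent_iff {S : Set (Idx n → ℤ)} {a : Idx n → ℤ} : lm n a ∈ laurent n S ↔ a ∈ S :=
  ⟨fun h => (mem_laurent_iff.1 h).2 a (by rw [lcoeff_lm]; simp), lm_mem_laurent⟩

lemma mul_mem_laurent {S T U : Set (Idx n → ℤ)} (h : ∀ a ∈ S, ∀ b ∈ T, a + b ∈ U)
    {f g : BigField n} (hf : f ∈ laurent n S) (hg : g ∈ laurent n T) : f * g ∈ laurent n U := by
  have h1 : f * g ∈ laurent n S * laurent n T := Submodule.mul_mem_mul hf hg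
  rw [laurent, laurent, Submodule.span_mul_span] at h1
  refine Submodule.span_mono ?_ h1
  rintro _ ⟨_, ⟨a, ha, rfl⟩, _, ⟨b, hb, rfl⟩, rfl⟩
  exact ⟨a + b, h a ha b hb, lm_add n a b⟩

/-- By independence of the monomials, exponents are well defined, and spans of sets of monomials
intersect in the span of the common monomials. -/
lemma mem_laurent_iInter {ι : Type} {S : ι → Set (Idx n → ℤ)} [Nonempty ι] {f : BigField n}
    (h : ∀ i, f ∈ laurent n (S i)) : f ∈ laurent n (⋂ i, S i) :=
  mem_laurent_iff.2 ⟨(mem_laurent_iff.1 (h (Classical.arbitrary ι))).1,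
    fun a ha => Set.mem_iInter.2 fun i => (mem_laurent_iff.1 (h i)).2 a ha⟩

/-! ### The coordinate rings of the charts -/

/-- The exponents of multidegree zero that are nonnegative outside `T`. -/
def expSet (T : Set (Idx n)) : Set (Idx n → ℤ) :=
  {a | (∀ i, ∑ k, a ⟨i, k⟩ = 0) ∧ ∀ p, p ∉ T → 0 ≤ a p}

/-- The homogeneous coordinates that are invertible on the chart `J`. -/
def pos (J : ∀ i, Fin (n i + 1)) : Set (Idx n) := {p | p.2 = J p.1}

lemma add_mem_expSet {T : Set (Idx n)} {a b : Idx n → ℤ} (ha : a ∈ expSet T) (hb : b ∈ expSet T) :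
    a + b ∈ expSet T :=
  ⟨fun i => by simp only [Pi.add_apply, Finset.sum_add_distrib, ha.1 i, hb.1 i, add_zero],
    fun p hp => add_nonneg (ha.2 p hp) (hb.2 p hp)⟩

lemma zero_mem_expSet (T : Set (Idx n)) : (0 : Idx n → ℤ) ∈ expSet T :=
  ⟨fun i => by simp, fun p _ => le_rfl⟩

/-- The rational functions that are Laurent polynomials with exponents in `expSet T`. -/
def laurentSubalgebra (T : Set (Idx n)) : Subalgebra ℂ (functionField n) :=
  ((laurent n (expSet T)).comap (functionField n).val.toLinearMap).toSubalgebra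
    (by
      rw [Submodule.mem_comap, AlgHom.toLinearMap_apply, map_one, ← lm_zero]
      exact lm_mem_laurent (zero_mem_expSet T))
    (fun f g hf hg => by
      rw [Submodule.mem_comap, AlgHom.toLinearMap_apply, map_mul]
      exact mul_mem_laurent (fun _ ha _ hb => add_mem_expSet ha hb) hf hg)

lemma mem_laurentSubalgebra {T : Set (Idx n)} {f : functionField n} :
    f ∈ laurentSubalgebra T ↔ (f : BigField n) ∈ laurent n (expSet T) :=
  Submodule.mem_toSubalgebra.trans Submodule.mem_comap

/-- The affine coordinate `x_{i,k} / x_{i, J i}`. -/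
def coord (J : ∀ i, Fin (n i + 1)) (p : Idx n) : functionField n :=
  ⟨x n p / x n ⟨p.1, J p.1⟩, IntermediateField.subset_adjoin _ _ ⟨p.1, p.2, J p.1, rfl⟩⟩

lemma coe_coord (J : ∀ i, Fin (n i + 1)) (p : Idx n) :
    (coord J p : BigField n) = x n p / x n ⟨p.1, J p.1⟩ := rfl

lemma coord_ne_zero (J : ∀ i, Fin (n i + 1)) (p : Idx n) : coord J p ≠ 0 := fun h =>
  div_ne_zero (x_ne_zero n p) (x_ne_zero n ⟨p.1, J p.1⟩) (congrArg Subtype.val h)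

lemma coord_self (J : ∀ i, Fin (n i + 1)) (i : Fin t) : coord J ⟨i, J i⟩ = 1 :=
  Subtype.ext (div_self (x_ne_zero n _))

lemma coord_mem_chart (J : ∀ i, Fin (n i + 1)) (p : Idx n) : coord J p ∈ (multiProj n).chart J :=
  Algebra.subset_adjoin ⟨p.1, p.2, rfl⟩

lemma coord_inv (J J' : ∀ i, Fin (n i + 1)) (i : Fin t) :
    (coord J ⟨i, J' i⟩)⁻¹ = coord J' ⟨i, J i⟩ :=
  Subtype.ext (inv_div _ _)

lemma coord_mul_coord (J J' : ∀ i, Fin (n i + 1)) (p : Idx n) :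
    coord J p = coord J' p * coord J ⟨p.1, J' p.1⟩ :=
  Subtype.ext (div_mul_div_cancel₀ (x_ne_zero n _)).symm

/-- The denominators x_{i, J i} cancel because the degree in each factor is zero. -/
lemma lm_eq_prod_coord (J : ∀ i, Fin (n i + 1)) {a : Idx n → ℤ} (ha : ∀ i, ∑ k, a ⟨i, k⟩ = 0) :
    lm n a = ((∏ p, coord J p ^ a p : functionField n) : BigField n) := by
  have h1 : ((∏ p, coord J p ^ a p : functionField n) : BigField n) =
      ∏ p, (x n p / x n ⟨p.1, J p.1⟩) ^ a p := by
    rw [← IntermediateField.algebraMap_apply, map_prod]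
    simp only [map_zpow₀]
    rfl
  rw [h1]
  simp only [div_zpow, Finset.prod_div_distrib]
  rw [Fintype.prod_sigma (fun p : Idx n => x n ⟨p.1, J p.1⟩ ^ a p)]
  rw [Finset.prod_eq_one (f := fun i => ∏ k, x n ⟨i, J i⟩ ^ a ⟨i, k⟩), div_one, lm]
  intro i _
  have : ∀ s : Finset (Fin (n i + 1)), ∏ k ∈ s, x n ⟨i, J i⟩ ^ a ⟨i, k⟩ =
      x n ⟨i, J i⟩ ^ ∑ k ∈ s, a ⟨i, k⟩ := fun s => by
    classical
    induction s using Finset.induction_on with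
    | empty => simp
    | insert k s hk ih =>
      rw [Finset.prod_insert hk, Finset.sum_insert hk, zpow_add₀ (x_ne_zero n _), ih]
  rw [this, ha, zpow_zero]

lemma laurentSubalgebra_le (J : ∀ i, Fin (n i + 1)) {T : Set (Idx n)}
    {A : Subalgebra ℂ (functionField n)} (h : ∀ p, coord J p ∈ A)
    (h' : ∀ p ∈ T, (coord J p)⁻¹ ∈ A) : laurentSubalgebra T ≤ A := by
  intro f hf
  have h1 : laurent n (expSet T) ≤ A.toSubmodule.map (functionField n).val.toLinearMap := by
    rw [laurent, Submodule.span_le]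
    rintro _ ⟨a, ha, rfl⟩
    refine ⟨∏ p, coord J p ^ a p, Subalgebra.prod_mem A fun p _ => ?_,
      (lm_eq_prod_coord J ha.1).symm⟩
    by_cases hp : p ∈ T
    · rcases Int.eq_nat_or_neg (a p) with ⟨N, hN | hN⟩
      · rw [hN, zpow_natCast]
        exact pow_mem (h p) _
      · rw [hN, zpow_neg, zpow_natCast, ← inv_pow]
        exact pow_mem (h' p hp) _
    · obtain ⟨N, hN⟩ := Int.eq_ofNat_of_zero_le (ha.2 p hp)
      rw [hN, zpow_natCast]
      exact pow_mem (h p) _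
  obtain ⟨g, hg, hgf⟩ := h1 (mem_laurentSubalgebra.1 hf)
  rwa [← Subtype.ext (a2 := f) hgf]

lemma coe_coord_eq_lm (J : ∀ i, Fin (n i + 1)) (p : Idx n) :
    (coord J p : BigField n) = lm n (Pi.single p 1 - Pi.single ⟨p.1, J p.1⟩ 1) := by
  rw [lm_sub, lm_single, lm_single, zpow_one, zpow_one, coe_coord]

lemma sum_single_apply (p : Idx n) (c : ℤ) (i : Fin t) :
    ∑ k, (Pi.single p c : Idx n → ℤ) ⟨i, k⟩ = if i = p.1 then c else 0 := by
  classical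
  obtain ⟨j, l⟩ := p
  split_ifs with h
  · subst h
    rw [Finset.sum_eq_single l]
    · simp
    · intro k _ hk
      rw [Pi.single_eq_of_ne]
      simpa using hk
    · simp
  · refine Finset.sum_eq_zero fun k _ => ?_
    rw [Pi.single_eq_of_ne]
    rintro ⟨⟩
    exact h rfl

lemma single_sub_single_mem_expSet {T : Set (Idx n)} {p q : Idx n} (hq : q ∈ T) (h : p.1 = q.1) :
    (Pi.single p 1 - Pi.single q 1 : Idx n → ℤ) ∈ expSet T := by
  classical
  refine ⟨fun i => ?_, fun r hr => ?_⟩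
  · simp only [Pi.sub_apply, Finset.sum_sub_distrib, sum_single_apply, h, sub_self]
  · have hrq : r ≠ q := by
      rintro rfl
      exact hr hq
    rw [Pi.sub_apply, Pi.single_eq_of_ne hrq, sub_zero, Pi.single_apply]
    split_ifs <;> simp

lemma chart_le_laurentSubalgebra (J : ∀ i, Fin (n i + 1)) {T : Set (Idx n)} (h : pos J ⊆ T) :
    (multiProj n).chart J ≤ laurentSubalgebra T := by
  refine Algebra.adjoin_le ?_
  rintro f ⟨i, k, hf⟩
  have : f = coord J ⟨i, k⟩ := Subtype.ext hf
  rw [SetLike.mem_coe, this, mem_laurentSubalgebra, coe_coord_eq_lm]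
  exact lm_mem_laurent (single_sub_single_mem_expSet (h rfl) rfl)

/-- Membership in a coordinate ring becomes a condition on exponents; regularity on charts is tested
through this description and its analogue for overlaps. -/
lemma chart_eq (J : ∀ i, Fin (n i + 1)) :
    (multiProj n).chart J = laurentSubalgebra (pos J) := by
  refine le_antisymm (chart_le_laurentSubalgebra J subset_rfl)
    (laurentSubalgebra_le J (coord_mem_chart J) ?_)
  rintro ⟨i, k⟩ (rfl : k = J i)
  rw [coord_self, inv_one]
  exact one_mem _

lemma chart_sup_chart_eq (J J' : ∀ i, Fin (n i + 1)) :
    (multiProj n).chart J ⊔ (multiProj n).chart J' = laurentSubalgebra (pos J ∪ pos J') := by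
  refine le_antisymm (sup_le (chart_le_laurentSubalgebra J Set.subset_union_left)
    (chart_le_laurentSubalgebra J' Set.subset_union_right)) (laurentSubalgebra_le J
    (fun p => (le_sup_left : (multiProj n).chart J ≤ _) (coord_mem_chart J p)) ?_)
  rintro ⟨i, k⟩ ((rfl : k = J i) | (rfl : k = J' i))
  · rw [coord_self, inv_one]
    exact one_mem _
  · rw [coord_inv]
    exact (le_sup_right : (multiProj n).chart J' ≤ _) (coord_mem_chart J' _)

lemma mem_chart_iff {J : ∀ i, Fin (n i + 1)} {f : functionField n} :
    f ∈ (multiProj n).chart J ↔ (f : BigField n) ∈ laurent n (expSet (pos J)) := by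
  rw [chart_eq, mem_laurentSubalgebra]

lemma mem_chart_sup_chart_iff {J J' : ∀ i, Fin (n i + 1)} {f : functionField n} :
    f ∈ (multiProj n).chart J ⊔ (multiProj n).chart J' ↔
      (f : BigField n) ∈ laurent n (expSet (pos J ∪ pos J')) := by
  rw [chart_sup_chart_eq, mem_laurentSubalgebra]

/-! ### The charts are affine spaces -/

/-- The indices of the affine coordinates on the chart `J`. -/
abbrev Off (J : ∀ i, Fin (n i + 1)) : Type := {p : Idx n // p.2 ≠ J p.1}

/-- The exponents of a monomial in the affine coordinates of the chart `J`. -/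
def offExp (J : ∀ i, Fin (n i + 1)) (b : Off J →₀ ℕ) : Idx n → ℤ :=
  ∑ q : Off J, (b q : ℤ) • (Pi.single q.1 1 - Pi.single ⟨q.1.1, J q.1.1⟩ 1)

lemma offExp_apply (J : ∀ i, Fin (n i + 1)) (b : Off J →₀ ℕ) (q : Off J) :
    offExp J b q.1 = b q := by
  classical
  rw [offExp, Finset.sum_apply, Finset.sum_eq_single q]
  · have : (⟨q.1.1, J q.1.1⟩ : Idx n) ≠ q.1 := fun h => q.2 (by rw [← h])
    simp [Pi.single_eq_of_ne this.symm]
  · intro r _ hr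
    have h1 : q.1 ≠ r.1 := fun h => hr (Subtype.ext h.symm)
    have h2 : q.1 ≠ ⟨r.1.1, J r.1.1⟩ := fun h => q.2 (by rw [h])
    simp [Pi.single_eq_of_ne h1, Pi.single_eq_of_ne h2]
  · simp

lemma aeval_coord_monomial (J : ∀ i, Fin (n i + 1)) (b : Off J →₀ ℕ) (c : ℂ) :
    ((MvPolynomial.aeval (fun q : Off J => coord J q.1) (MvPolynomial.monomial b c) :
      functionField n) : BigField n) = c • lm n (offExp J b) := by
  rw [MvPolynomial.aeval_monomial, ← Algebra.smul_def, Finsupp.prod_fintype _ _ (by simp)]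
  rw [IntermediateField.coe_smul, offExp, lm_sum]
  congr 1
  rw [← IntermediateField.algebraMap_apply, map_prod]
  refine Finset.prod_congr rfl fun q _ => ?_
  rw [map_pow, IntermediateField.algebraMap_apply, coe_coord_eq_lm]
  induction b q with
  | zero => simp [lm_zero]
  | succ N ih => rw [pow_succ, ih, Nat.cast_succ, add_smul, one_smul, lm_add]

/-- The entries of `offExp J b` off `J` recover `b`, so distinct monomials in the affine coordinates
are distinct Laurent monomials. -/
lemma lcoeff_aeval_coord (J : ∀ i, Fin (n i + 1)) (P : MvPolynomial (Off J) ℂ) (b : Off J →₀ ℕ) :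
    lcoeff n ((MvPolynomial.aeval (fun q : Off J => coord J q.1) P : functionField n) :
      BigField n) (offExp J b) = MvPolynomial.coeff b P := by
  classical
  induction P using MvPolynomial.induction_on' with
  | monomial b' c =>
    rw [aeval_coord_monomial, map_smul, lcoeff_lm, MvPolynomial.coeff_monomial, Finsupp.smul_apply,
      Finsupp.single_apply]
    have : offExp J b' = offExp J b ↔ b' = b := ⟨fun h => by
      ext q
      have := congrFun h q.1
      rw [offExp_apply, offExp_apply] at this
      exact_mod_cast this, fun h => by rw [h]⟩
    simp only [this]
    split_ifs <;> simp
  | add P Q hP hQ =>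
    rw [map_add, IntermediateField.coe_add, map_add, Finsupp.add_apply, hP, hQ,
      MvPolynomial.coeff_add]

lemma algebraicIndependent_coord (J : ∀ i, Fin (n i + 1)) :
    AlgebraicIndependent ℂ fun q : Off J => coord J q.1 := by
  rw [algebraicIndependent_iff]
  intro P hP
  ext b
  rw [← lcoeff_aeval_coord J, hP]
  simp

lemma adjoin_coord_eq_chart (J : ∀ i, Fin (n i + 1)) :
    Algebra.adjoin ℂ (Set.range fun q : Off J => coord J q.1) = (multiProj n).chart J := by
  apply le_antisymm
  · refine Algebra.adjoin_le ?_
    rintro _ ⟨q, rfl⟩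
    exact coord_mem_chart J _
  · refine Algebra.adjoin_le ?_
    rintro f ⟨i, k, hf⟩
    have : f = coord J ⟨i, k⟩ := Subtype.ext hf
    rw [this]
    by_cases hk : k = J i
    · rw [hk, coord_self]
      exact one_mem _
    · exact Algebra.subset_adjoin ⟨⟨⟨i, k⟩, hk⟩, rfl⟩

/-- The chart `J` is an affine space. -/
def chartEquiv (J : ∀ i, Fin (n i + 1)) : MvPolynomial (Off J) ℂ ≃ₐ[ℂ] (multiProj n).chart J :=
  (algebraicIndependent_coord J).aevalEquiv.trans
    (Subalgebra.equivOfEq _ _ (adjoin_coord_eq_chart J))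

lemma coe_chartEquiv (J : ∀ i, Fin (n i + 1)) (P : MvPolynomial (Off J) ℂ) :
    (chartEquiv J P : functionField n) = MvPolynomial.aeval (fun q : Off J => coord J q.1) P :=
  rfl

/-- Unique factorization makes line bundles trivial on each chart. -/
instance (J : ∀ i, Fin (n i + 1)) : UniqueFactorizationMonoid ((multiProj n).chart J) :=
  (chartEquiv J).toMulEquiv.uniqueFactorizationMonoid inferInstance

lemma exists_eq_div_of_mem_functionField (J : ∀ i, Fin (n i + 1)) (z : BigField n)
    (hz : z ∈ functionField n) : ∃ a ∈ (multiProj n).chart J, ∃ b ∈ (multiProj n).chart J,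
      (b : BigField n) ≠ 0 ∧ z = (a : BigField n) / (b : BigField n) := by
  unfold functionField at hz
  induction hz using IntermediateField.adjoin_induction with
  | mem f hf =>
    obtain ⟨i, k, l, rfl⟩ := hf
    exact ⟨coord J ⟨i, k⟩, coord_mem_chart _ _, coord J ⟨i, l⟩, coord_mem_chart _ _,
      fun h => coord_ne_zero J ⟨i, l⟩ (Subtype.ext h),
      (div_div_div_cancel_right₀ (x_ne_zero n _) _ _).symm⟩
  | algebraMap c =>
    exact ⟨algebraMap ℂ _ c, Subalgebra.algebraMap_mem _ c, 1, one_mem _, one_ne_zero,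
      (div_one _).symm⟩
  | add f g _ _ ihf ihg =>
    obtain ⟨a, ha, b, hb, hb0, rfl⟩ := ihf
    obtain ⟨c, hc, d, hd, hd0, rfl⟩ := ihg
    exact ⟨a * d + b * c, add_mem (mul_mem ha hd) (mul_mem hb hc), b * d, mul_mem hb hd,
      mul_ne_zero hb0 hd0, div_add_div _ _ hb0 hd0⟩
  | inv f _ ihf =>
    obtain ⟨a, ha, b, hb, hb0, rfl⟩ := ihf
    by_cases ha0 : (a : BigField n) = 0
    · refine ⟨0, zero_mem _, 1, one_mem _, one_ne_zero, ?_⟩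
      rw [ha0, zero_div, inv_zero]
      exact (zero_div _).symm
    · exact ⟨b, hb, a, ha, ha0, inv_div _ _⟩
  | mul f g _ _ ihf ihg =>
    obtain ⟨a, ha, b, hb, hb0, rfl⟩ := ihf
    obtain ⟨c, hc, d, hd, hd0, rfl⟩ := ihg
    exact ⟨a * c, mul_mem ha hc, b * d, mul_mem hb hd, mul_ne_zero hb0 hd0,
      div_mul_div_comm _ _ _ _⟩

instance isFractionRing_chart (J : ∀ i, Fin (n i + 1)) :
    IsFractionRing ((multiProj n).chart J) (functionField n) := by
  refine IsFractionRing.of_field _ _ fun z => ?_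
  obtain ⟨a, ha, b, hb, _, h⟩ := exists_eq_div_of_mem_functionField J z z.2
  exact ⟨⟨a, ha⟩, ⟨b, hb⟩, Subtype.ext h⟩

end MultiProj

/-- Allows the charts to be re-indexed, as the Segre embedding requires. -/
lemma Variety.points_eq_of_range_chart_eq {K : Type} [Field K] [Algebra ℂ K] {Z Z' : Variety K}
    (h : Set.range Z.chart = Set.range Z'.chart) : Z.points = Z'.points := by
  have key : ∀ Z : Variety K, Z.points = {O | ∃ A ∈ Set.range Z.chart, ∃ (P : Ideal A)
      (_ : P.IsMaximal), O = Variety.localRing A P} := fun Z => by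
    ext O
    constructor
    · rintro ⟨j, P, hP, rfl⟩
      exact ⟨_, ⟨j, rfl⟩, P, hP, rfl⟩
    · rintro ⟨_, ⟨j, rfl⟩, P, hP, rfl⟩
      exact ⟨j, P, hP, rfl⟩
  rw [key, key, h]

namespace MultiProj

variable {t : ℕ} {n : Fin t → ℕ}

/-! ### Smoothness and projectivity -/

/-- The function `∏ x_{i, J i} / x_{i, 0}`. -/
def segre (J : ∀ i, Fin (n i + 1)) : functionField n := ∏ i, coord (fun _ => 0) ⟨i, J i⟩

lemma segre_ne_zero (J : ∀ i, Fin (n i + 1)) : segre J ≠ 0 :=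
  Finset.prod_ne_zero_iff.2 fun _ _ => coord_ne_zero _ _

lemma segre_div_segre (J J' : ∀ i, Fin (n i + 1)) :
    segre J' / segre J = ∏ i, coord J ⟨i, J' i⟩ := by
  rw [segre, segre, ← Finset.prod_div_distrib]
  refine Finset.prod_congr rfl fun i _ => ?_
  rw [div_eq_iff (coord_ne_zero _ _), coord_mul_coord (fun _ => 0) J ⟨i, J' i⟩]

/-- Changing one index isolates one affine coordinate, so the Segre ratios generate the whole
coordinate ring of the chart. -/
lemma segre_update_div_segre (J : ∀ i, Fin (n i + 1)) (p : Idx n) :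
    segre (Function.update J p.1 p.2) / segre J = coord J p := by
  rw [segre_div_segre, Finset.prod_eq_single p.1]
  · rw [Function.update_self]
  · intro i _ hi
    rw [Function.update_of_ne hi, coord_self]
  · simp

lemma isSmoothProjective : (multiProj n).IsSmoothProjective where
  finiteType J := by
    rw [← adjoin_coord_eq_chart J]
    exact ⟨Finset.univ.image fun q : Off J => coord J q.1, by simp⟩
  isFractionRing J := isFractionRing_chart J
  smooth J := have : Algebra.Smooth ℂ (MvPolynomial (Off J) ℂ) := ⟨inferInstance, inferInstance⟩
    Algebra.Smooth.of_equiv (chartEquiv J)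
  projective := by
    obtain ⟨N, hN⟩ : ∃ N, Fintype.card (∀ i, Fin (n i + 1)) = N + 1 :=
      Nat.exists_eq_succ_of_ne_zero Fintype.card_ne_zero
    let e : Fin (N + 1) ≃ ∀ i, Fin (n i + 1) := (Fintype.equivFinOfCardEq hN).symm
    refine ⟨N, fun k => Units.mk0 _ (segre_ne_zero (e k)),
      Variety.points_eq_of_range_chart_eq ?_⟩
    have key : ∀ k, (Variety.ofProjectiveEmbedding
        fun k => Units.mk0 _ (segre_ne_zero (e k))).chart k = (multiProj n).chart (e k) := by
      intro k
      apply le_antisymm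
      · refine Algebra.adjoin_le ?_
        rintro _ ⟨l, rfl⟩
        simp only [Units.val_mk0]
        rw [segre_div_segre]
        exact Subalgebra.prod_mem _ fun i _ => coord_mem_chart _ _
      · refine Algebra.adjoin_le ?_
        rintro f ⟨i, l, hf⟩
        have : f = coord (e k) ⟨i, l⟩ := Subtype.ext hf
        rw [this, ← segre_update_div_segre]
        refine Algebra.subset_adjoin ⟨e.symm (Function.update (e k) i l), ?_⟩
        simp
    ext A
    constructor
    · rintro ⟨J, rfl⟩
      exact ⟨e.symm J, (key _).trans (congrArg _ (e.apply_symm_apply J))⟩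
    · rintro ⟨k, rfl⟩
      exact ⟨e k, (key k).symm⟩

lemma isTranscendenceBasis_coord (J : ∀ i, Fin (n i + 1)) :
    IsTranscendenceBasis ℂ fun q : Off J => coord J q.1 := by
  rw [(algebraicIndependent_coord J).isTranscendenceBasis_iff_isAlgebraic, adjoin_coord_eq_chart]
  exact IsLocalization.isAlgebraic _ (nonZeroDivisors ((multiProj n).chart J))

lemma dim_eq (J : ∀ i, Fin (n i + 1)) : (multiProj n).dim = Fintype.card (Off J) := by
  rw [Variety.dim, ← (isTranscendenceBasis_coord J).cardinalMk_eq_trdeg]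
  simp

/-! ### Derivations and differentials -/

open KaehlerDifferential in
-- The function field is a localization of a polynomial ring, hence formally étale over it, so the
-- differentials of the variables remain a basis after base change.
lemma exists_basis_kaehlerDifferential (J : ∀ i, Fin (n i + 1)) :
    ∃ b : Module.Basis (Off J) (functionField n) (Ω[functionField n⁄ℂ]),
      ∀ q, b q = D ℂ (functionField n) (coord J q.1) := by
  let _ : Algebra (MvPolynomial (Off J) ℂ) (functionField n) :=
    (MvPolynomial.aeval fun q : Off J => coord J q.1).toAlgebra
  have hmap : ∀ P, algebraMap (MvPolynomial (Off J) ℂ) (functionField n) P =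
    MvPolynomial.aeval (fun q : Off J => coord J q.1) P := fun _ => rfl
  have : IsScalarTower ℂ (MvPolynomial (Off J) ℂ) (functionField n) :=
    .of_algebraMap_eq fun c => by rw [hmap, MvPolynomial.algebraMap_eq, MvPolynomial.aeval_C]
  have : IsFractionRing (MvPolynomial (Off J) ℂ) (functionField n) :=
    IsFractionRing.of_ringEquiv_left (chartEquiv J).toRingEquiv fun a => by
      rw [hmap, ← coe_chartEquiv]
      rfl
  have : Algebra.FormallyEtale (MvPolynomial (Off J) ℂ) (functionField n) :=
    .of_isLocalization (nonZeroDivisors _)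
  refine ⟨((mvPolynomialBasis ℂ (Off J)).baseChange (functionField n)).map
    (tensorKaehlerEquivOfFormallyEtale ℂ (MvPolynomial (Off J) ℂ) (functionField n)), fun q => ?_⟩
  rw [Module.Basis.map_apply, Module.Basis.baseChange_apply, mvPolynomialBasis_apply,
    ← tensorKaehlerEquivOfFormallyEtale_symm_D_algebraMap, LinearEquiv.apply_symm_apply, hmap,
    MvPolynomial.aeval_X]

/-- The differentials of the affine coordinates of a chart. -/
def kaehlerBasis (J : ∀ i, Fin (n i + 1)) :
    Module.Basis (Off J) (functionField n) (Ω[functionField n⁄ℂ]) :=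
  (exists_basis_kaehlerDifferential J).choose

lemma kaehlerBasis_apply (J : ∀ i, Fin (n i + 1)) (q : Off J) :
    kaehlerBasis J q = KaehlerDifferential.D ℂ (functionField n) (coord J q.1) :=
  (exists_basis_kaehlerDifferential J).choose_spec q

/-- The partial derivatives with respect to the affine coordinates of a chart. -/
def coordDer (J : ∀ i, Fin (n i + 1)) (q : Off J) :
    Derivation ℂ (functionField n) (functionField n) :=
  ((kaehlerBasis J).coord q).compDer (KaehlerDifferential.D ℂ (functionField n))

lemma coordDer_apply (J : ∀ i, Fin (n i + 1)) (q : Off J) (f : functionField n) :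
    coordDer J q f = (kaehlerBasis J).coord q (KaehlerDifferential.D ℂ (functionField n) f) := rfl

lemma coordDer_coord (J : ∀ i, Fin (n i + 1)) (q : Off J) (p : Idx n) :
    coordDer J q (coord J p) = if p = q.1 then 1 else 0 := by
  classical
  by_cases hp : p.2 = J p.1
  · have h1 : coord J p = 1 := by
      obtain ⟨i, k⟩ := p
      simp only at hp
      rw [hp, coord_self]
    rw [h1, Derivation.map_one_eq_zero, if_neg]
    rintro rfl
    exact q.2 hp
  · rw [coordDer_apply, ← kaehlerBasis_apply J ⟨p, hp⟩, Module.Basis.coord_apply,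
      Module.Basis.repr_self, Finsupp.single_apply]
    exact if_congr Subtype.ext_iff rfl rfl

lemma derivation_ext (J : ∀ i, Fin (n i + 1))
    {D D' : Derivation ℂ (functionField n) (functionField n)}
    (h : ∀ q : Off J, D (coord J q.1) = D' (coord J q.1)) : D = D' := by
  have h1 : D.liftKaehlerDifferential = D'.liftKaehlerDifferential :=
    (kaehlerBasis J).ext fun q => by
      rw [kaehlerBasis_apply, Derivation.liftKaehlerDifferential_comp_D,
        Derivation.liftKaehlerDifferential_comp_D, h]
  ext f
  rw [← D.liftKaehlerDifferential_comp_D f, h1, D'.liftKaehlerDifferential_comp_D]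

lemma mem_vectorFields_chart (J : ∀ i, Fin (n i + 1))
    {D : Derivation ℂ (functionField n) (functionField n)}
    (h : ∀ p, D (coord J p) ∈ (multiProj n).chart J) :
    D ∈ Variety.vectorFields ((multiProj n).chart J) := by
  intro a ha
  rw [← adjoin_coord_eq_chart J] at ha
  induction ha using Algebra.adjoin_induction with
  | mem f hf =>
    obtain ⟨q, rfl⟩ := hf
    exact h _
  | algebraMap c => rw [Derivation.map_algebraMap]; exact zero_mem _
  | add f g _ _ hf hg => rw [map_add]; exact add_mem hf hg
  | mul f g hf' hg' hf hg =>
    rw [adjoin_coord_eq_chart] at hf' hg'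
    rw [Derivation.leibniz, smul_eq_mul, smul_eq_mul]
    exact add_mem (mul_mem hf' hg) (mul_mem hg' hf)

lemma coordDer_mem_vectorFields (J : ∀ i, Fin (n i + 1)) (q : Off J) :
    coordDer J q ∈ Variety.vectorFields ((multiProj n).chart J) :=
  mem_vectorFields_chart J fun p => by
    rw [coordDer_coord]
    split_ifs
    exacts [one_mem _, zero_mem _]

/-- The logarithmic derivative of a Laurent monomial. -/
lemma derivation_of_coe_eq_lm (J : ∀ i, Fin (n i + 1))
    (D : Derivation ℂ (functionField n) (functionField n)) {a : Idx n → ℤ}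
    (ha : ∀ i, ∑ k, a ⟨i, k⟩ = 0) {f : functionField n} (hf : (f : BigField n) = lm n a) :
    D f = f * ∑ p, (a p : functionField n) * ((coord J p)⁻¹ * D (coord J p)) := by
  have h1 : f = ∏ p, coord J p ^ a p := Subtype.ext (hf.trans (lm_eq_prod_coord J ha))
  have h2 : ∀ s : Finset (Idx n), D (∏ p ∈ s, coord J p ^ a p) =
      (∏ p ∈ s, coord J p ^ a p) *
        ∑ p ∈ s, (a p : functionField n) * ((coord J p)⁻¹ * D (coord J p)) := fun s => by
    classical
    induction s using Finset.induction_on with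
    | empty => simp
    | insert p s hp ih =>
      rw [Finset.prod_insert hp, Finset.sum_insert hp, Derivation.leibniz, ih,
        Derivation.leibniz_zpow, zpow_sub_one₀ (coord_ne_zero J p)]
      simp only [smul_eq_mul, zsmul_eq_mul]
      ring
  rw [h1, h2]

/-- The Euler field of a coordinate acts on Laurent monomials diagonally, with the exponent as
eigenvalue. -/
lemma coord_mul_coordDer (J : ∀ i, Fin (n i + 1)) (q : Off J) {a : Idx n → ℤ}
    (ha : ∀ i, ∑ k, a ⟨i, k⟩ = 0) {f : functionField n} (hf : (f : BigField n) = lm n a) :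
    coord J q.1 * coordDer J q f = (a q.1 : functionField n) * f := by
  classical
  rw [derivation_of_coe_eq_lm J _ ha hf, Finset.sum_eq_single q.1]
  · rw [coordDer_coord, if_pos rfl]
    field_simp [coord_ne_zero J q.1]
  · intro p _ hp
    rw [coordDer_coord, if_neg hp, mul_zero, mul_zero]
  · simp

end MultiProj

/-! ### Global forms through their coefficients in a basis -/

open Set in
-- The coefficients of da₁ ∧ ⋯ ∧ daᵣ are minors of the matrix of derivatives; the weights `w` make
-- its entries regular.
lemma Variety.prod_mul_ιMultiDual_mem {K : Type} [Field K] [Algebra ℂ K] {I : Type} [LinearOrder I]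
    (b : Module.Basis I K (Ω[K⁄ℂ])) (A : Subalgebra ℂ K) (w : I → K)
    (hw : ∀ q, ∀ f ∈ A, w q * b.coord q (KaehlerDifferential.D ℂ K f) ∈ A) {r : ℕ}
    (s : powersetCard I r) {ω : ⋀[K]^r (Ω[K⁄ℂ])} (hω : ω ∈ Variety.regularForms A r) :
    (∏ k, w (powersetCard.ofFinEmbEquiv.symm s k)) * exteriorPower.ιMultiDual K r b s ω ∈ A := by
  induction hω using Submodule.span_induction with
  | mem ω hω =>
    obtain ⟨a, rfl⟩ := hω
    rw [exteriorPower.ιMultiDual_apply_ιMulti, ← Matrix.det_mul_row, Matrix.det_apply]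
    refine sum_mem fun σ _ => zsmul_mem (prod_mem fun k _ => hw _ _ (a _).2) _
  | zero => rw [map_zero, mul_zero]; exact zero_mem _
  | add ω ω' _ _ h h' => rw [map_add, mul_add]; exact add_mem h h'
  | smul a ω _ h =>
    rw [← algebraMap_smul K a ω, map_smul, smul_eq_mul, mul_left_comm]
    exact mul_mem a.2 h

open Set in
lemma exteriorPower.eq_zero_of_ιMultiDual {K M : Type} [Field K] [AddCommGroup M] [Module K M]
    {I : Type} [LinearOrder I] (b : Module.Basis I K M) {r : ℕ} {ω : ⋀[K]^r M}
    (h : ∀ s : powersetCard I r, exteriorPower.ιMultiDual K r b s ω = 0) : ω = 0 := by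
  rw [← (b.exteriorPower r).repr.map_eq_zero_iff]
  ext s
  rw [exteriorPower.basis_repr_apply, Finsupp.zero_apply, h]

/-- If both the fields dual to `b` and their multiples by `w` are globally regular, then a
coefficient of a global form and its product with the `w` are global functions, hence both constant.
By `hw` the coefficient is 0. -/
lemma Variety.globalForms_eq_bot_of {K : Type} [Field K] [Algebra ℂ K] {I : Type} [LinearOrder I]
    (b : Module.Basis I K (Ω[K⁄ℂ])) (Z : Variety K) (w : I → K)
    (hconst : ∀ f, (∀ j, f ∈ Z.chart j) → ∃ c : ℂ, f = algebraMap ℂ K c)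
    (h1 : ∀ j q, ∀ f ∈ Z.chart j, b.coord q (KaehlerDifferential.D ℂ K f) ∈ Z.chart j)
    (h2 : ∀ j q, ∀ f ∈ Z.chart j, w q * b.coord q (KaehlerDifferential.D ℂ K f) ∈ Z.chart j)
    {r : ℕ} (hw : ∀ (q : Fin r → I) (c c' : ℂ),
      (∏ k, w (q k)) * algebraMap ℂ K c = algebraMap ℂ K c' → c = 0) :
    Z.globalForms r = ⊥ := by
  rw [eq_bot_iff]
  intro ω hω
  rw [Variety.globalForms, Submodule.mem_iInf] at hω
  refine exteriorPower.eq_zero_of_ιMultiDual b fun s => ?_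
  obtain ⟨c, hc⟩ := hconst (exteriorPower.ιMultiDual K r b s ω) fun j => by
    have := Variety.prod_mul_ιMultiDual_mem b (Z.chart j) (fun _ => 1)
      (fun q f hf => by rw [one_mul]; exact h1 j q f hf) s (hω j)
    rwa [Finset.prod_const_one, one_mul] at this
  obtain ⟨c', hc'⟩ := hconst _ fun j =>
    Variety.prod_mul_ιMultiDual_mem b (Z.chart j) w (h2 j) s (hω j)
  rw [hc] at hc'
  rw [hc, hw _ c c' hc', map_zero]

namespace MultiProj

variable {t : ℕ} {n : Fin t → ℕ}

/-! ### Global functions and forms -/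

/-- The exponents of multidegree `a` of the monomials that are regular on all charts. -/
def globalExp (n : Fin t → ℕ) (a : Fin t → ℤ) : Set (Idx n → ℤ) :=
  {b | (∀ i, ∑ k, b ⟨i, k⟩ = a i) ∧ ∀ p : Idx n, n p.1 ≠ 0 → 0 ≤ b p}

lemma exists_notMem_pos {p : Idx n} (h : n p.1 ≠ 0) : ∃ J, p ∉ pos J := by
  obtain ⟨i, k⟩ := p
  have : Nontrivial (Fin (n i + 1)) := Fin.nontrivial_iff_two_le.2 (by simp only at h; omega)
  obtain ⟨l, hl⟩ := exists_ne k
  exact ⟨Function.update (fun _ => 0) i l, fun h' => hl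
    ((Function.update_self (β := fun i => Fin (n i + 1)) i l _).symm.trans (Eq.symm h'))⟩

lemma iInter_expSet_pos_subset : ⋂ J, expSet (pos J) ⊆ globalExp n 0 := by
  intro b hb
  rw [Set.mem_iInter] at hb
  refine ⟨(hb fun _ => 0).1, fun p hp => ?_⟩
  obtain ⟨J, hJ⟩ := exists_notMem_pos hp
  exact (hb J).2 p hJ

lemma eq_zero_of_mem_globalExp_zero {b : Idx n → ℤ} (hb : b ∈ globalExp n 0) : b = 0 := by
  funext ⟨i, k⟩
  by_cases hi : n i = 0
  · have h1 := hb.1 i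
    have : Subsingleton (Fin (n i + 1)) := by rw [hi]; exact Fin.subsingleton_one
    rwa [Fintype.sum_subsingleton _ k] at h1
  · exact (Finset.sum_eq_zero_iff_of_nonneg fun k _ => hb.2 ⟨i, k⟩ hi).1 (hb.1 i) k
      (Finset.mem_univ _)

lemma exists_eq_algebraMap_of_forall_mem_chart {f : functionField n}
    (h : ∀ J, f ∈ (multiProj n).chart J) : ∃ c : ℂ, f = algebraMap ℂ _ c := by
  have h1 := laurent_mono iInter_expSet_pos_subset
    (mem_laurent_iInter fun J => mem_chart_iff.1 (h J))
  have h2 : laurent n (globalExp n 0) ≤ Submodule.span ℂ {1} := by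
    rw [laurent]
    refine Submodule.span_mono ?_
    rintro _ ⟨b, hb, rfl⟩
    rw [eq_zero_of_mem_globalExp_zero hb, lm_zero]
    rfl
  obtain ⟨c, hc⟩ := Submodule.mem_span_singleton.1 (h2 h1)
  refine ⟨c, Subtype.ext ?_⟩
  rw [← hc, Algebra.algebraMap_eq_smul_one]
  rfl

lemma intCast_mul_mem (A : Subalgebra ℂ (functionField n)) (m : ℤ) {f : functionField n}
    (h : m ≠ 0 → f ∈ A) : (m : functionField n) * f ∈ A := by
  by_cases hm : m = 0
  · rw [hm, Int.cast_zero, zero_mul]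
    exact zero_mem _
  · exact mul_mem (intCast_mem A m) (h hm)

lemma coord_exp_sum (J : ∀ i, Fin (n i + 1)) (p : Idx n) (i : Fin t) :
    ∑ k, (Pi.single p 1 - Pi.single ⟨p.1, J p.1⟩ 1 : Idx n → ℤ) ⟨i, k⟩ = 0 := by
  simp only [Pi.sub_apply, Finset.sum_sub_distrib, sum_single_apply, sub_self]

lemma coord_mul_coordDer_mem (J J' : ∀ i, Fin (n i + 1)) (q : Off J) (p : Idx n) :
    coord J q.1 * coordDer J q (coord J' p) ∈ (multiProj n).chart J' := by
  rw [coord_mul_coordDer J q (coord_exp_sum J' p) (coe_coord_eq_lm J' p)]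
  exact intCast_mul_mem _ _ fun _ => coord_mem_chart _ _

/-- Translation fields on one chart extend to all of Z. The derivative of a ratio is nonzero only if
the coordinate `q` is its numerator or its denominator, and in either case the result is a
polynomial in the coordinates of `J'`. -/
lemma coordDer_coord_mem (J J' : ∀ i, Fin (n i + 1)) (q : Off J) (p : Idx n) :
    coordDer J q (coord J' p) ∈ (multiProj n).chart J' := by
  classical
  have h1 := coord_mul_coordDer J q (coord_exp_sum J' p) (coe_coord_eq_lm J' p)
  rw [← eq_inv_mul_iff_mul_eq₀ (coord_ne_zero J q.1), mul_left_comm] at h1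
  rw [h1]
  refine intCast_mul_mem _ _ fun hne => ?_
  have h2 : ((coord J q.1)⁻¹ * coord J' p : functionField n) =
      coord J' p * (x n ⟨q.1.1, J q.1.1⟩ / x n q.1) := by
    rw [mul_comm, IntermediateField.coe_mul, IntermediateField.coe_inv, coe_coord J, inv_div]
  by_cases hp : p = q.1
  · have : (coord J q.1)⁻¹ * coord J' p = coord J' ⟨q.1.1, J q.1.1⟩ := by
      apply Subtype.ext
      rw [h2, hp, coe_coord, coe_coord]
      field_simp [x_ne_zero n q.1]
    rw [this]
    exact coord_mem_chart _ _
  · have hq : q.1 = ⟨p.1, J' p.1⟩ := by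
      by_contra hq
      apply hne
      rw [Pi.sub_apply, Pi.single_eq_of_ne (Ne.symm hp), Pi.single_eq_of_ne hq, sub_zero]
    have : (coord J q.1)⁻¹ * coord J' p = coord J' p * coord J' ⟨q.1.1, J q.1.1⟩ := by
      apply Subtype.ext
      rw [h2, IntermediateField.coe_mul, coe_coord J' ⟨q.1.1, J q.1.1⟩]
      congr 2
      rw [hq]
    rw [this]
    exact mul_mem (coord_mem_chart _ _) (coord_mem_chart _ _)

instance (J : ∀ i, Fin (n i + 1)) : LinearOrder (Off J) :=
  @linearOrderOfSTO _ WellOrderingRel _ (Classical.decRel _)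

lemma globalForms_eq_bot {r : ℕ} (hr : 1 ≤ r) : (multiProj n).globalForms r = ⊥ := by
  classical
  let J : ∀ i, Fin (n i + 1) := fun _ => 0
  refine Variety.globalForms_eq_bot_of (kaehlerBasis J) (multiProj n) (fun q => coord J q.1)
    (fun f => exists_eq_algebraMap_of_forall_mem_chart)
    (fun J' q f hf => mem_vectorFields_chart J' (coordDer_coord_mem J J' q) f hf)
    (fun J' q f hf => mem_vectorFields_chart J' (D := coord J q.1 • coordDer J q)
        (coord_mul_coordDer_mem J J' q) f hf) ?_
  intro q c c' h
  -- The exponents of the product of the coordinates; they are not all 0 because `1 ≤ r`, so no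
  -- nonzero multiple of the product is constant.
  let b : Off J →₀ ℕ := ∑ k, Finsupp.single (q k) 1
  have h5 : (∏ k, coord J (q k).1) * algebraMap ℂ (functionField n) c = MvPolynomial.aeval
      (fun q : Off J => coord J q.1) (MvPolynomial.monomial b c) := by
    rw [MvPolynomial.aeval_monomial, mul_comm]
    congr 1
    rw [← Finsupp.prod_finsetSum_index (by simp) (by intros; rw [pow_add])]
    simp
  rw [h5, ← MvPolynomial.aeval_C (fun q : Off J => coord J q.1) c'] at h
  have hb : b ≠ 0 := fun h => by
    have h8 := DFunLike.congr_fun h (q ⟨0, hr⟩)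
    rw [Finsupp.finsetSum_apply, Finsupp.zero_apply, Finset.sum_eq_zero_iff] at h8
    simpa using h8 ⟨0, hr⟩ (Finset.mem_univ _)
  have h9 := congrArg (MvPolynomial.coeff b) (algebraicIndependent_coord J h)
  rwa [MvPolynomial.coeff_C, if_neg hb.symm, MvPolynomial.coeff_monomial, if_pos rfl] at h9

end MultiProj

namespace MultiProj

variable {t : ℕ} {n : Fin t → ℕ}

/-! ### Rigidity -/

/-- The Laurent monomial with exponents `a` of multidegree zero, as an element of the function
field. -/
def lmDiv (a : Idx n → ℤ) : functionField n := ∏ p, coord (fun _ => 0) p ^ a p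

lemma coe_lmDiv {a : Idx n → ℤ} (ha : a ∈ expSet Set.univ) :
    (lmDiv a : BigField n) = lm n a :=
  (lm_eq_prod_coord _ ha.1).symm

open Classical in
/-- The part with exponents in `S` of a Laurent polynomial of multidegree zero. -/
def weightProj (S : Set (Idx n → ℤ)) : functionField n →ₗ[ℂ] functionField n :=
  Finsupp.linearCombination ℂ lmDiv ∘ₗ Submodule.subtype _ ∘ₗ Finsupp.restrictDom ℂ ℂ S ∘ₗ
    lcoeff n ∘ₗ (functionField n).val.toLinearMap

open Classical in
lemma weightProj_apply (S : Set (Idx n → ℤ)) (f : functionField n) :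
    weightProj S f = Finsupp.linearCombination ℂ lmDiv
      ((lcoeff n (f : BigField n)).filter (· ∈ S)) := rfl

lemma coe_linearCombination_lmDiv {c : (Idx n → ℤ) →₀ ℂ} (hc : ∀ a, c a ≠ 0 → a ∈ expSet Set.univ) :
    ((Finsupp.linearCombination ℂ lmDiv c : functionField n) : BigField n) =
      Finsupp.linearCombination ℂ (lm n) c := by
  rw [Finsupp.linearCombination_apply, Finsupp.linearCombination_apply, Finsupp.sum, Finsupp.sum,
    ← IntermediateField.algebraMap_apply, map_sum]
  refine Finset.sum_congr rfl fun a ha => ?_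
  rw [← coe_lmDiv (hc a (Finsupp.mem_support_iff.1 ha))]
  rfl

lemma weightProj_mem {S T : Set (Idx n → ℤ)} (hT : T ⊆ expSet Set.univ) {f : functionField n}
    (hf : (f : BigField n) ∈ laurent n T) : (weightProj S f : BigField n) ∈ laurent n (T ∩ S) := by
  classical
  have h1 : ∀ a, (lcoeff n (f : BigField n)).filter (· ∈ S) a ≠ 0 → a ∈ T ∩ S := fun a ha => by
    rw [Finsupp.filter_apply] at ha
    split_ifs at ha with h
    · exact ⟨(mem_laurent_iff.1 hf).2 a ha, h⟩
    · exact absurd rfl ha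
  rw [weightProj_apply, coe_linearCombination_lmDiv fun a ha => hT (h1 a ha).1, laurent,
    Finsupp.mem_span_image_iff_linearCombination]
  exact ⟨_, fun a ha => h1 a (Finsupp.mem_support_iff.1 ha), rfl⟩

lemma sum_weightProj {ι : Type} [Fintype ι] (σ : (Idx n → ℤ) → ι) {f : functionField n}
    (hf : f ∈ laurentSubalgebra (Set.univ : Set (Idx n))) :
    ∑ j, weightProj {a | σ a = j} f = f := by
  classical
  have h1 := mem_laurent_iff.1 (mem_laurentSubalgebra.1 hf)
  have h2 : ∑ j, (lcoeff n (f : BigField n)).filter (· ∈ {a | σ a = j}) =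
      lcoeff n (f : BigField n) := by
    ext a
    rw [Finsupp.finsetSum_apply, Finset.sum_eq_single (σ a)]
    · exact Finsupp.filter_apply_pos _ _ rfl
    · exact fun j _ hj => Finsupp.filter_apply_neg _ _ fun h => hj (Eq.symm h)
    · simp
  simp only [weightProj_apply]
  rw [← map_sum, h2]
  exact Subtype.ext ((coe_linearCombination_lmDiv h1.2).trans h1.1)

/-- The part with weights in `S` of a derivation. -/
def derProj (S : Set (Idx n → ℤ)) (D : Derivation ℂ (functionField n) (functionField n)) :
    Derivation ℂ (functionField n) (functionField n) :=
  ∑ q : Off fun _ => 0, (coord (fun _ => 0) q.1 *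
    weightProj S ((coord (fun _ => 0) q.1)⁻¹ * D (coord (fun _ => 0) q.1))) •
      coordDer (fun _ => 0) q

lemma derivation_sum_apply {ι : Type} (s : Finset ι)
    (D : ι → Derivation ℂ (functionField n) (functionField n)) (f : functionField n) :
    (∑ i ∈ s, D i) f = ∑ i ∈ s, D i f := by
  classical
  induction s using Finset.induction_on with
  | empty => simp
  | insert i s hi ih => rw [Finset.sum_insert hi, Finset.sum_insert hi, Derivation.add_apply, ih]

lemma derProj_coord (S : Set (Idx n → ℤ)) (D : Derivation ℂ (functionField n) (functionField n))
    (p : Idx n) : derProj S D (coord (fun _ => 0) p) = coord (fun _ => 0) p *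
      weightProj S ((coord (fun _ => 0) p)⁻¹ * D (coord (fun _ => 0) p)) := by
  classical
  rw [derProj, derivation_sum_apply]
  simp only [Derivation.smul_apply, coordDer_coord, smul_eq_mul]
  by_cases hp : p.2 = 0
  · have h1 : coord (fun _ => 0) p = 1 := by
      obtain ⟨i, k⟩ := p
      simp only at hp
      rw [hp]
      exact coord_self (fun _ => 0) i
    rw [h1, Derivation.map_one_eq_zero, mul_zero, map_zero, mul_zero]
    refine Finset.sum_eq_zero fun q _ => ?_
    rw [if_neg, mul_zero]
    rintro rfl
    exact q.2 hp
  · rw [Finset.sum_eq_single ⟨p, hp⟩]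
    · rw [if_pos rfl, mul_one]
    · intro q _ hq
      rw [if_neg (fun h => hq (Subtype.ext h.symm)), mul_zero]
    · simp

/-- The logarithmic derivative is additive in the exponents, so the projection defined through the
chart `0` has the same formula on every Laurent monomial of multidegree zero. -/
lemma derProj_apply (S : Set (Idx n → ℤ)) (D : Derivation ℂ (functionField n) (functionField n))
    {a : Idx n → ℤ} (ha : ∀ i, ∑ k, a ⟨i, k⟩ = 0) {f : functionField n}
    (hf : (f : BigField n) = lm n a) : derProj S D f = f * weightProj S (f⁻¹ * D f) := by
  have hf0 : f ≠ 0 := fun h => lm_ne_zero n a (hf.symm.trans (congrArg Subtype.val h))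
  rw [derivation_of_coe_eq_lm (fun _ => 0) D ha hf, inv_mul_cancel_left₀ hf0,
    derivation_of_coe_eq_lm (fun _ => 0) (derProj S D) ha hf, map_sum]
  congr 1
  refine Finset.sum_congr rfl fun p _ => ?_
  rw [← zsmul_eq_mul, ← zsmul_eq_mul, map_zsmul, derProj_coord,
    inv_mul_cancel_left₀ (coord_ne_zero _ p)]

lemma derProj_add (S : Set (Idx n → ℤ)) (D D' : Derivation ℂ (functionField n) (functionField n)) :
    derProj S (D + D') = derProj S D + derProj S D' :=
  derivation_ext (fun _ => 0) fun q => by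
    rw [Derivation.add_apply, derProj_coord, derProj_coord, derProj_coord, Derivation.add_apply,
      mul_add, map_add, mul_add]

lemma laurentSubalgebra_mono {S T : Set (Idx n)} (h : S ⊆ T) :
    laurentSubalgebra S ≤ laurentSubalgebra T := fun _ hf =>
  mem_laurentSubalgebra.2 (laurent_mono (S := expSet S) (T := expSet T)
    (fun _ ha => ⟨ha.1, fun p hp => ha.2 p fun h' => hp (h h')⟩) (mem_laurentSubalgebra.1 hf))

lemma inv_coord_mem (J : ∀ i, Fin (n i + 1)) (p : Idx n) :
    (coord J p)⁻¹ ∈ laurentSubalgebra (Set.univ : Set (Idx n)) := by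
  rw [mem_laurentSubalgebra, IntermediateField.coe_inv, coe_coord_eq_lm, ← lm_neg, neg_sub]
  exact lm_mem_laurent (single_sub_single_mem_expSet (Set.mem_univ _) rfl)

lemma sum_derProj {ι : Type} [Fintype ι] (σ : (Idx n → ℤ) → ι) {J J' : ∀ i, Fin (n i + 1)}
    {D : Derivation ℂ (functionField n) (functionField n)}
    (hD : D ∈ Variety.vectorFields ((multiProj n).chart J ⊔ (multiProj n).chart J')) :
    ∑ j, derProj {a | σ a = j} D = D :=
  derivation_ext (fun _ => 0) fun q => by
    rw [derivation_sum_apply]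
    simp only [derProj_coord]
    rw [← Finset.mul_sum, sum_weightProj, mul_inv_cancel_left₀ (coord_ne_zero _ _)]
    rw [derivation_of_coe_eq_lm J D (coord_exp_sum _ _) (coe_coord_eq_lm _ q.1),
      inv_mul_cancel_left₀ (coord_ne_zero _ _)]
    refine sum_mem fun p _ => mul_mem (intCast_mem _ _) (mul_mem (inv_coord_mem J p) ?_)
    refine laurentSubalgebra_mono (Set.subset_univ (pos J ∪ pos J')) ?_
    rw [← chart_sup_chart_eq]
    exact hD _ ((le_sup_left : (multiProj n).chart J ≤ _) (coord_mem_chart J p))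

/-- On the overlap, `D` may have poles along the coordinates ⟨i, J' i⟩. Weights in `S` are
nonnegative there, so the projection has no such poles and extends to the chart `J`. -/
lemma derProj_mem_vectorFields {S : Set (Idx n → ℤ)} {J J' : ∀ i, Fin (n i + 1)}
    (hS : ∀ a ∈ S, (∀ i, ∑ k, a ⟨i, k⟩ = 0) → ∀ i, 0 ≤ a ⟨i, J' i⟩)
    {D : Derivation ℂ (functionField n) (functionField n)}
    (hD : D ∈ Variety.vectorFields ((multiProj n).chart J' ⊔ (multiProj n).chart J)) :
    derProj S D ∈ Variety.vectorFields ((multiProj n).chart J) := by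
  classical
  refine mem_vectorFields_chart J fun p => ?_
  set e : Idx n → ℤ := Pi.single p 1 - Pi.single ⟨p.1, J p.1⟩ 1 with he
  have hcoe : (coord J p : BigField n) = lm n e := coe_coord_eq_lm J p
  have hdeg : ∀ i, ∑ k, e ⟨i, k⟩ = 0 := coord_exp_sum J p
  rw [derProj_apply S D hdeg hcoe, mem_chart_iff, IntermediateField.coe_mul]
  have h1 : ((coord J p)⁻¹ * D (coord J p) : functionField n).1 ∈
      laurent n {a | e + a ∈ expSet (pos J' ∪ pos J)} := by
    rw [IntermediateField.coe_mul, IntermediateField.coe_inv, hcoe, ← lm_neg]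
    refine mul_mem_laurent (S := {-e}) ?_ (lm_mem_laurent rfl) (mem_chart_sup_chart_iff.1
      (hD _ ((le_sup_right : (multiProj n).chart J ≤ _) (coord_mem_chart J p))))
    rintro _ rfl b hb
    change e + (-e + b) ∈ expSet (pos J' ∪ pos J)
    rwa [add_neg_cancel_left]
  have hsub : {a | e + a ∈ expSet (pos J' ∪ pos J)} ⊆ expSet (Set.univ : Set (Idx n)) :=
    fun a ha => ⟨fun i => by
      have := (show e + a ∈ expSet (pos J' ∪ pos J) from ha).1 i
      simpa only [Pi.add_apply, Finset.sum_add_distrib, hdeg, zero_add] using this,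
      fun p hp => absurd (Set.mem_univ p) hp⟩
  refine mul_mem_laurent (S := {e}) ?_ (by rw [hcoe]; exact lm_mem_laurent rfl)
    (weightProj_mem (S := S) hsub h1)
  rintro _ rfl a ⟨ha, haS⟩
  have ha' : e + a ∈ expSet (pos J' ∪ pos J) := ha
  refine ⟨ha'.1, fun r hr => ?_⟩
  by_cases hr' : r ∈ pos J'
  · obtain ⟨i, k⟩ := r
    obtain rfl : k = J' i := hr'
    have hne : (⟨i, J' i⟩ : Idx n) ≠ ⟨p.1, J p.1⟩ := fun h => hr (by rw [h]; rfl)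
    refine add_nonneg ?_ (hS a haS (hsub ha).1 i)
    rw [he, Pi.sub_apply, Pi.single_eq_of_ne hne, sub_zero, Pi.single_apply]
    split_ifs <;> simp
  · exact ha'.2 r fun h => h.elim hr' hr

/-- A weight of sum zero has a nonnegative entry in each factor, and `σ` selects a chart `J'` from
such entries. For the weights assigned to `J'`, the corresponding parts of the `D J' J` extend to
the charts `J` and bound the cocycle, since `D J' K - D J' J = D J K`. Summing over `J'` gives the
cochain. -/
lemma subsingleton_tangentH1 : Subsingleton (multiProj n).tangentH1 := by
  classical
  refine Submodule.Quotient.subsingleton_iff.2 (eq_top_iff.2 ?_)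
  rintro ⟨D, hD⟩ -
  have hσ : ∀ a : Idx n → ℤ, ∃ J : ∀ i, Fin (n i + 1), (∀ i, ∑ k, a ⟨i, k⟩ = 0) →
      ∀ i, 0 ≤ a ⟨i, J i⟩ := fun a => by
    by_cases ha : ∀ i, ∑ k, a ⟨i, k⟩ = 0
    · have : ∀ i, ∃ k, 0 ≤ a ⟨i, k⟩ := fun i => by
        by_contra! h
        have := Finset.sum_lt_sum_of_nonempty (Finset.univ_nonempty (α := Fin (n i + 1)))
          fun k _ => h k
        rw [ha i, Finset.sum_const_zero] at this
        exact lt_irrefl _ this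
      choose J hJ using this
      exact ⟨J, fun _ => hJ⟩
    · exact ⟨fun _ => 0, fun h => absurd h ha⟩
  choose σ hσ using hσ
  refine ⟨fun J => ∑ J' : ∀ i, Fin (n i + 1), derProj {a | σ a = J'} (D J' J),
    fun J => Submodule.sum_mem _ fun J' _ => derProj_mem_vectorFields ?_ (hD.1 J' J),
    fun J K => ?_⟩
  · rintro a rfl
    exact hσ a
  · change D J K = ∑ J' : ∀ i, Fin (n i + 1), derProj {a | σ a = J'} (D J' K) -
      ∑ J' : ∀ i, Fin (n i + 1), derProj {a | σ a = J'} (D J' J)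
    rw [eq_sub_iff_add_eq, ← sum_derProj σ (hD.1 J K), ← Finset.sum_add_distrib]
    refine Finset.sum_congr rfl fun J' _ => ?_
    rw [← derProj_add, add_comm]
    exact congrArg _ (hD.2 J' J K)

end MultiProj

/-- Invertible modules are finitely generated, hence fractional ideals, and over a factorial domain
invertible fractional ideals are principal. -/
lemma Submodule.exists_eq_span_singleton_of_isUnit {A K : Type} [CommRing A] [Field K] [Algebra A K]
    [IsFractionRing A K] [IsDomain A] [UniqueFactorizationMonoid A] (M : (Submodule A K)ˣ) :
    ∃ w : K, w ≠ 0 ∧ (M : Submodule A K) = Submodule.span A {w} := by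
  have hfr : ∀ M : (Submodule A K)ˣ, IsFractional (nonZeroDivisors A) (M : Submodule A K) :=
    fun M => FractionalIdeal.isFractional_of_fg (Submodule.fg_unit M)
  let I : FractionalIdeal (nonZeroDivisors A) K := ⟨M, hfr M⟩
  let I' : FractionalIdeal (nonZeroDivisors A) K := ⟨(M⁻¹ : (Submodule A K)ˣ), hfr M⁻¹⟩
  have h1 : I * I' = 1 := by
    rw [← FractionalIdeal.coeToSubmodule_inj, FractionalIdeal.coe_mul, FractionalIdeal.coe_one]
    exact M.mul_inv
  obtain ⟨w, hw⟩ := ClassGroup.isPrincipal_coeSubmodule_of_isUnit I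
    (IsUnit.of_mul_eq_one _ h1)
  refine ⟨w, ?_, hw⟩
  rintro rfl
  have hM : (M : Submodule A K) = ⊥ := by
    change (I : Submodule A K) = ⊥
    rw [hw]
    simp
  have h2 := M.mul_inv
  rw [hM, Submodule.bot_mul] at h2
  exact one_ne_zero (Submodule.mem_bot A |>.1 (h2 ▸ Submodule.one_le.1 le_rfl : (1 : K) ∈ (⊥ : Submodule A K)))

namespace MultiProj

variable {t : ℕ} {n : Fin t → ℕ}

/-! ### Units of Laurent polynomial rings -/

lemma exists_mul_monomial_eq {f : BigField n} (hf : f ∈ laurent n Set.univ) :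
    ∃ (b : Idx n →₀ ℕ) (P : MvPolynomial (Idx n) ℂ),
      f * algebraMap _ _ (MvPolynomial.monomial b (1 : ℂ)) = algebraMap _ _ P := by
  induction hf using Submodule.span_induction with
  | mem f hf =>
    obtain ⟨a, -, rfl⟩ := hf
    refine ⟨Finsupp.equivFunOnFinite.symm fun p => (a p).natAbs,
      MvPolynomial.monomial (Finsupp.equivFunOnFinite.symm fun p => (a p + (a p).natAbs).toNat) 1, ?_⟩
    rw [← lm_natCast, ← lm_natCast, ← lm_add]
    congr 1
    funext p
    simp only [Pi.add_apply, Finsupp.coe_equivFunOnFinite_symm]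
    omega
  | zero => exact ⟨0, 0, by simp⟩
  | add f g _ _ hf hg =>
    obtain ⟨b, P, h⟩ := hf
    obtain ⟨b', P', h'⟩ := hg
    refine ⟨b + b', P * MvPolynomial.monomial b' 1 + P' * MvPolynomial.monomial b 1, ?_⟩
    have h1 : MvPolynomial.monomial (b + b') (1 : ℂ) =
        MvPolynomial.monomial b 1 * MvPolynomial.monomial b' 1 := by
      rw [MvPolynomial.monomial_mul, one_mul]
    rw [h1, map_add, map_mul, map_mul, map_mul, ← h, ← h']
    ring
  | smul c f _ hf =>
    obtain ⟨b, P, h⟩ := hf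
    refine ⟨b, c • P, ?_⟩
    rw [smul_mul_assoc, h]
    exact (map_smul (IsScalarTower.toAlgHom ℂ (MvPolynomial (Idx n) ℂ) (BigField n)) c P).symm

lemma algebraMap_monomial (b : Idx n →₀ ℕ) (c : ℂ) :
    algebraMap (MvPolynomial (Idx n) ℂ) (BigField n) (MvPolynomial.monomial b c) =
      c • lm n (fun p => (b p : ℤ)) := by
  rw [lm_natCast, ← mul_one c, ← smul_eq_mul, ← MvPolynomial.smul_monomial, smul_eq_mul, mul_one]
  exact map_smul (IsScalarTower.toAlgHom ℂ (MvPolynomial (Idx n) ℂ) (BigField n)) _ _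

/-- After clearing denominators, the numerators multiply to a monomial, whose divisors are monomials
up to scalars. -/
lemma exists_eq_smul_lm_of_mul_eq_one {f g : BigField n} (hf : f ∈ laurent n Set.univ)
    (hg : g ∈ laurent n Set.univ) (h : f * g = 1) : ∃ (c : ℂ) (a : Idx n → ℤ), c ≠ 0 ∧
      f = c • lm n a := by
  obtain ⟨b, P, hP⟩ := exists_mul_monomial_eq hf
  obtain ⟨b', P', hP'⟩ := exists_mul_monomial_eq hg
  have h1 : P * P' = MvPolynomial.monomial (b + b') 1 := by
    have h2 : MvPolynomial.monomial (b + b') (1 : ℂ) =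
        MvPolynomial.monomial b 1 * MvPolynomial.monomial b' 1 := by
      rw [MvPolynomial.monomial_mul, one_mul]
    apply IsFractionRing.injective (MvPolynomial (Idx n) ℂ) (BigField n)
    rw [h2, map_mul, map_mul, ← hP, ← hP']
    linear_combination (algebraMap _ (BigField n) (MvPolynomial.monomial b (1 : ℂ)) *
      algebraMap _ (BigField n) (MvPolynomial.monomial b' (1 : ℂ))) * h
  obtain ⟨d, c, -, hc, rfl⟩ := (MvPolynomial.dvd_monomial_iff_exists one_ne_zero).1
    (Dvd.intro _ h1)
  refine ⟨c, (fun p => (d p : ℤ)) - fun p => (b p : ℤ), ne_zero_of_dvd_ne_zero one_ne_zero hc, ?_⟩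
  rw [lm_sub, ← smul_div_assoc, ← algebraMap_monomial, ← hP, ← lm_natCast,
    mul_div_cancel_right₀ _ (lm_ne_zero n _)]

/-! ### Line bundles on a product of projective spaces -/

/-- The exponents of the monomial `∏ x_{i, J i} ^ a i`. -/
def lmOn (J : ∀ i, Fin (n i + 1)) (a : Fin t → ℤ) : Idx n → ℤ :=
  fun p => if p.2 = J p.1 then a p.1 else 0

lemma lmOn_add (J : ∀ i, Fin (n i + 1)) (a b : Fin t → ℤ) :
    lmOn J (a + b) = lmOn J a + lmOn J b := by
  funext p
  simp only [lmOn, Pi.add_apply]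
  split_ifs <;> simp

lemma lmOn_zero (J : ∀ i, Fin (n i + 1)) : lmOn J 0 = 0 := by
  funext p
  simp [lmOn]

lemma sum_lmOn (J : ∀ i, Fin (n i + 1)) (a : Fin t → ℤ) (i : Fin t) :
    ∑ k, lmOn J a ⟨i, k⟩ = a i := by
  simp [lmOn]

/-- The line bundle `M` is the subsheaf `u · 𝒪(a)` of the function field, where the sections of
`𝒪(a)` are the rational functions in the homogeneous coordinates of multidegree `a`. -/
def HasForm (M : (multiProj n).LineBundle) (u : BigField n) (a : Fin t → ℤ) : Prop :=
  ∀ J, ∃ w : functionField n, w ≠ 0 ∧ (w : BigField n) = u * lm n (lmOn J a) ∧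
    M.sectionsOn J = Submodule.span ((multiProj n).chart J) {w}

lemma HasForm.ne_zero {M : (multiProj n).LineBundle} {u : BigField n} {a : Fin t → ℤ}
    (h : HasForm M u a) : u ≠ 0 := by
  obtain ⟨w, hw, hwu, -⟩ := h fun _ => 0
  rintro rfl
  rw [zero_mul] at hwu
  exact hw (Subtype.ext hwu)

lemma HasForm.mul {M M' : (multiProj n).LineBundle} {u u' : BigField n} {a a' : Fin t → ℤ}
    (h : HasForm M u a) (h' : HasForm M' u' a') : HasForm (M * M') (u * u') (a + a') := fun J => by
  obtain ⟨w, hw, hwu, hM⟩ := h J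
  obtain ⟨w', hw', hwu', hM'⟩ := h' J
  refine ⟨w * w', mul_ne_zero hw hw', ?_, ?_⟩
  · rw [IntermediateField.coe_mul, hwu, hwu', lmOn_add, lm_add]
    ring
  · change M.sectionsOn J * M'.sectionsOn J = _
    rw [hM, hM', Submodule.span_mul_span, Set.singleton_mul_singleton]

lemma HasForm.principal (c : (functionField n)ˣ) :
    HasForm ((multiProj n).principal c) (c : functionField n) 0 := fun J =>
  ⟨c, c.ne_zero, by rw [lmOn_zero, lm_zero, mul_one], rfl⟩

lemma HasForm.one : HasForm (1 : (multiProj n).LineBundle) 1 0 := by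
  have := HasForm.principal (1 : (functionField n)ˣ)
  rwa [map_one] at this

lemma HasForm.pow {M : (multiProj n).LineBundle} {u : BigField n} {a : Fin t → ℤ}
    (h : HasForm M u a) (d : ℕ) : HasForm (M ^ d) (u ^ d) (d • a) := by
  induction d with
  | zero => simpa using HasForm.one
  | succ d ih =>
    rw [pow_succ, pow_succ, succ_nsmul]
    exact ih.mul h

lemma HasForm.prod {ι : Type} (s : Finset ι) {M : ι → (multiProj n).LineBundle}
    {u : ι → BigField n} {a : ι → Fin t → ℤ} (h : ∀ j, HasForm (M j) (u j) (a j)) :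
    HasForm (∏ j ∈ s, M j) (∏ j ∈ s, u j) (∑ j ∈ s, a j) := by
  classical
  induction s using Finset.induction_on with
  | empty => simpa using HasForm.one
  | insert j s hj ih =>
    rw [Finset.prod_insert hj, Finset.prod_insert hj, Finset.sum_insert hj]
    exact (h j).mul ih

lemma exists_unit_of_span_eq {A : Subalgebra ℂ (functionField n)} {w w' : functionField n}
    (hw : w ≠ 0) (h : Submodule.span A {w} = Submodule.span A {w'}) :
    ∃ f ∈ A, ∃ g ∈ A, f * g = 1 ∧ w = f * w' := by
  obtain ⟨f, hf⟩ := Submodule.mem_span_singleton.1 (h ▸ Submodule.mem_span_singleton_self w)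
  obtain ⟨g, hg⟩ := Submodule.mem_span_singleton.1 (h ▸ Submodule.mem_span_singleton_self w')
  refine ⟨f, f.2, g, g.2, ?_, hf.symm⟩
  rw [← hf] at hg
  have hw' : w' ≠ 0 := by
    rintro rfl
    rw [smul_zero] at hf
    exact hw hf.symm
  have h1 : (f * g : functionField n) * w' = 1 * w' := by
    rw [one_mul, mul_comm (f : functionField n), mul_assoc]
    exact hg
  exact mul_right_cancel₀ hw' h1

/-- The exponents of a unit and of its inverse are opposite and both nonnegative outside `T`. -/
lemma exists_eq_smul_lm_of_unit {T : Set (Idx n)} {f g : functionField n}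
    (hf : f ∈ laurentSubalgebra T) (hg : g ∈ laurentSubalgebra T) (h : f * g = 1) :
    ∃ (c : ℂ) (a : Idx n → ℤ), c ≠ 0 ∧ (f : BigField n) = c • lm n a ∧
      (∀ i, ∑ k, a ⟨i, k⟩ = 0) ∧ ∀ p ∉ T, a p = 0 := by
  rw [mem_laurentSubalgebra] at hf hg
  have h' : (f : BigField n) * (g : BigField n) = 1 := congrArg Subtype.val h
  obtain ⟨c, a, hc, hfa⟩ := exists_eq_smul_lm_of_mul_eq_one (laurent_mono (Set.subset_univ _) hf)
    (laurent_mono (Set.subset_univ _) hg) h'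
  have ha : a ∈ expSet T := by
    rw [hfa, Submodule.smul_mem_iff _ hc] at hf
    exact lm_mem_laurent_iff.1 hf
  have ha' : -a ∈ expSet T := by
    have hga : (g : BigField n) = c⁻¹ • lm n (-a) := by
      rw [eq_inv_of_mul_eq_one_right h', hfa, lm_neg, Algebra.smul_def, Algebra.smul_def, mul_inv,
        map_inv₀]
    rw [hga, Submodule.smul_mem_iff _ (inv_ne_zero hc)] at hg
    exact lm_mem_laurent_iff.1 hg
  exact ⟨c, a, hc, hfa, ha.1, fun p hp => le_antisymm (neg_nonneg.1 (ha'.2 p hp)) (ha.2 p hp)⟩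

lemma smul_lm_injective {c c' : ℂ} {a a' : Idx n → ℤ} (hc : c ≠ 0)
    (h : c • lm n a = c' • lm n a') : a = a' := by
  have h1 := congrArg (lcoeff n) h
  rw [map_smul, map_smul, lcoeff_lm, lcoeff_lm] at h1
  by_contra hne
  have h2 := DFunLike.congr_fun h1 a
  simp [hne, hc] at h2

/-- Off `J`, the exponents have a value `h` independent of `J`; the remaining entry in each factor
is fixed by the vanishing of the degree. If `n i = 0` there is no index off `J`, and `h` is set to
0. -/
lemma exists_lmOn_of_support (e : (∀ i, Fin (n i + 1)) → Idx n → ℤ)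
    (hdeg : ∀ J i, ∑ k, e J ⟨i, k⟩ = 0)
    (he : ∀ J J' p, p ∉ pos J → p ∉ pos J' → e J p = e J' p) :
    ∃ (a : Fin t → ℤ) (h : Idx n → ℤ), (∀ i, n i = 0 → a i = 0) ∧ ∀ J, e J = lmOn J a + h := by
  classical
  have h1 : ∀ p : Idx n, ∃ z : ℤ, (n p.1 = 0 → z = 0) ∧ ∀ J, p ∉ pos J → e J p = z := fun p => by
    by_cases hp : n p.1 = 0
    · refine ⟨0, fun _ => rfl, fun J hJ => absurd ?_ hJ⟩
      have : Subsingleton (Fin (n p.1 + 1)) := by rw [hp]; exact Fin.subsingleton_one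
      exact Subsingleton.elim _ _
    · obtain ⟨J, hJ⟩ := exists_notMem_pos hp
      exact ⟨e J p, fun h => absurd h hp, fun J' hJ' => he _ _ _ hJ' hJ⟩
  choose h h0 hh using h1
  refine ⟨fun i => -∑ k, h ⟨i, k⟩, h, fun i hi => ?_, fun J => ?_⟩
  · exact neg_eq_zero.2 (Finset.sum_eq_zero fun k _ => h0 ⟨i, k⟩ hi)
  · funext ⟨i, k⟩
    rw [Pi.add_apply, lmOn]
    split_ifs with hk
    · have h2 := hdeg J i
      rw [← Finset.add_sum_erase _ _ (Finset.mem_univ k), Finset.sum_congr rfl fun l hl =>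
        hh ⟨i, l⟩ J fun hl' => Finset.ne_of_mem_erase hl (Eq.trans hl' (Eq.symm hk))] at h2
      have h3 := Finset.add_sum_erase Finset.univ (fun k => h ⟨i, k⟩) (Finset.mem_univ k)
      simp only at h2 h3 ⊢
      linarith
    · rw [zero_add]
      exact hh _ _ hk

/-- The classification of line bundles by multidegrees: generators on the charts differ by units on
the overlaps, that is, by monomials in the coordinates invertible there. -/
lemma exists_hasForm (M : (multiProj n).LineBundle) :
    ∃ (u : BigField n) (a : Fin t → ℤ), (∀ i, n i = 0 → a i = 0) ∧ HasForm M u a := by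
  have h1 : ∀ J : ∀ i, Fin (n i + 1), ∃ w : functionField n, w ≠ 0 ∧
      M.sectionsOn J = Submodule.span ((multiProj n).chart J) {w} := fun J =>
    Submodule.exists_eq_span_singleton_of_isUnit (M.1 J)
  choose w hw hM using h1
  have h2 : ∀ J J' : ∀ i, Fin (n i + 1), ∃ (c : ℂ) (a : Idx n → ℤ), c ≠ 0 ∧
      (w J : BigField n) = c • lm n a * (w J' : BigField n) ∧ (∀ i, ∑ k, a ⟨i, k⟩ = 0) ∧
      ∀ p ∉ pos J ∪ pos J', a p = 0 := fun J J' => by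
    have h3 := M.2 J J'
    change Submodule.span _ (M.sectionsOn J : Set (functionField n)) =
      Submodule.span _ (M.sectionsOn J' : Set (functionField n)) at h3
    rw [hM, hM, Variety.span_span_of_le le_sup_left, Variety.span_span_of_le le_sup_right] at h3
    obtain ⟨f, hf, g, hg, hfg, h4⟩ := exists_unit_of_span_eq (hw J) h3
    rw [chart_sup_chart_eq] at hf hg
    obtain ⟨c, a, hc, hfa, ha⟩ := exists_eq_smul_lm_of_unit hf hg hfg
    exact ⟨c, a, hc, by rw [h4, IntermediateField.coe_mul, hfa], ha⟩
  choose c e hc hwe hdeg hsupp using h2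
  let J₀ : ∀ i, Fin (n i + 1) := fun _ => 0
  have hw₀ : (w J₀ : BigField n) ≠ 0 := fun h => hw J₀ (Subtype.ext h)
  obtain ⟨a, h, ha, he⟩ := exists_lmOn_of_support (fun J => e J J₀) (fun J => hdeg J J₀)
    fun J J' p hp hp' => by
      -- The ratio of generators for `J` and `J₀` is compared with the one through `J'`; the first
      -- step is supported on the coordinates of `J` and `J'`.
      have h3 : (c J J₀) • lm n (e J J₀) = (c J J' * c J' J₀) • lm n (e J J' + e J' J₀) := by
        apply mul_right_cancel₀ hw₀
        rw [← hwe, hwe J J', hwe J' J₀, lm_add, mul_smul]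
        simp only [Algebra.smul_def]
        ring
      have h4 := congrFun (smul_lm_injective (hc _ _) h3) p
      rw [h4, Pi.add_apply, hsupp J J' p fun h => h.elim hp hp', zero_add]
  refine ⟨w J₀ * lm n h, a, ha, fun J => ⟨(c J J₀)⁻¹ • w J, ?_, ?_, ?_⟩⟩
  · rw [Algebra.smul_def]
    exact mul_ne_zero ((map_ne_zero _).2 (inv_ne_zero (hc _ _))) (hw J)
  · rw [IntermediateField.coe_smul, hwe J J₀, he, lm_add, smul_mul_assoc, inv_smul_smul₀ (hc _ _)]
    ring
  · rw [hM J]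
    have : (c J J₀)⁻¹ • w J = algebraMap ℂ ((multiProj n).chart J) (c J J₀)⁻¹ • w J := by
      rw [algebraMap_smul]
    rw [this, Submodule.span_singleton_smul_eq ((inv_ne_zero (hc _ _)).isUnit.map _)]

/-- Two charts differing only in factor `i` detect `a i`. If `n i = 0` there is only one choice
there, and a power of the single coordinate can be absorbed into `u`. -/
lemma HasForm.eq_of_ne_zero {M : (multiProj n).LineBundle} {u u' : BigField n} {a a' : Fin t → ℤ}
    (h : HasForm M u a) (h' : HasForm M u' a') {i : Fin t} (hi : n i ≠ 0) : a i = a' i := by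
  have h1 : ∀ J : ∀ i, Fin (n i + 1), ∃ c : ℂ, c ≠ 0 ∧
      u * lm n (lmOn J a) = c • (u' * lm n (lmOn J a')) := fun J => by
    obtain ⟨w, hw, hwu, hM⟩ := h J
    obtain ⟨w', hw', hwu', hM'⟩ := h' J
    obtain ⟨f, hf, g, hg, hfg, h4⟩ := exists_unit_of_span_eq hw (hM.symm.trans hM')
    rw [chart_eq] at hf hg
    obtain ⟨c, b, hc, hfb, hb, hb'⟩ := exists_eq_smul_lm_of_unit hf hg hfg
    refine ⟨c, hc, ?_⟩
    have hb0 : b = 0 := by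
      funext ⟨i, k⟩
      by_cases hk : k = J i
      · have := hb i
        rwa [Finset.sum_eq_single k (fun l _ hl => hb' _ fun h => hl (Eq.trans h (Eq.symm hk)))
          (by simp)] at this
      · exact hb' _ hk
    rw [← hwu, ← hwu', h4, IntermediateField.coe_mul, hfb, hb0, lm_zero, smul_mul_assoc, one_mul]
  have : Nontrivial (Fin (n i + 1)) := Fin.nontrivial_iff_two_le.2 (by omega)
  obtain ⟨k, hk⟩ := exists_ne (0 : Fin (n i + 1))
  let J : ∀ i, Fin (n i + 1) := fun _ => 0
  let J' : ∀ i, Fin (n i + 1) := Function.update J i k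
  obtain ⟨c, hc, h2⟩ := h1 J
  obtain ⟨c', hc', h3⟩ := h1 J'
  have h4 : c' • lm n (lmOn J' a' + lmOn J a) = c • lm n (lmOn J a' + lmOn J' a) := by
    apply mul_left_cancel₀ (mul_ne_zero h.ne_zero h'.ne_zero)
    rw [lm_add, lm_add]
    simp only [Algebra.smul_def] at h2 h3 ⊢
    linear_combination (algebraMap ℂ (BigField n) c' * u' * lm n (lmOn J' a')) * h2 -
      (algebraMap ℂ (BigField n) c * u' * lm n (lmOn J a')) * h3
  have h5 := congrFun (smul_lm_injective hc' h4) ⟨i, k⟩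
  simp [lmOn, J, J', hk] at h5
  exact h5.symm

lemma HasForm.mem_sectionsOn_iff {M : (multiProj n).LineBundle} {u : BigField n} {a : Fin t → ℤ}
    (h : HasForm M u a) {J : ∀ i, Fin (n i + 1)} {f : functionField n} : f ∈ M.sectionsOn J ↔
      (f : BigField n) / (u * lm n (lmOn J a)) ∈ laurent n (expSet (pos J)) := by
  obtain ⟨w, hw, hwu, hM⟩ := h J
  have hw' : (w : BigField n) ≠ 0 := fun h => hw (Subtype.ext h)
  rw [hM, Submodule.mem_span_singleton, ← hwu]
  have h1 : (f : BigField n) / w = ((f / w : functionField n) : BigField n) := rfl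
  rw [h1, ← mem_chart_iff]
  constructor
  · rintro ⟨g, rfl⟩
    have : (g • w) / w = (g : functionField n) := mul_div_cancel_right₀ _ hw
    rw [this]
    exact g.2
  · intro hf
    exact ⟨⟨_, hf⟩, div_mul_cancel₀ _ hw⟩

end MultiProj

namespace MultiProj

variable {t : ℕ} {n : Fin t → ℕ}

/-! ### Global sections -/

lemma lmOn_of_notMem {J : ∀ i, Fin (n i + 1)} {p : Idx n} (hp : p ∉ pos J) (a : Fin t → ℤ) :
    lmOn J a p = 0 := if_neg hp

/-- Regularity on the chart `J` permits negative exponents only along `J`, and for `n i ≠ 0` each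
coordinate is avoided by some chart. -/
lemma mem_laurent_globalExp_of_div {u : BigField n} {a : Fin t → ℤ} {f : BigField n}
    (h : ∀ J, f / (u * lm n (lmOn J a)) ∈ laurent n (expSet (pos J))) :
    f / u ∈ laurent n (globalExp n a) := by
  have h1 : ∀ J, f / u ∈ laurent n {b | b - lmOn J a ∈ expSet (pos J)} := fun J => by
    have h2 : f / u = lm n (lmOn J a) * (f / (u * lm n (lmOn J a))) := by
      have := lm_ne_zero n (lmOn J a)
      rw [mul_comm u, ← div_div, div_right_comm, mul_div_cancel₀ _ this]
    rw [h2]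
    refine mul_mem_laurent (S := {lmOn J a}) ?_ (lm_mem_laurent rfl) (h J)
    rintro _ rfl b hb
    change lmOn J a + b - lmOn J a ∈ expSet (pos J)
    rwa [add_sub_cancel_left]
  refine laurent_mono ?_ (mem_laurent_iInter h1)
  intro b hb
  have h3 : ∀ J, b - lmOn J a ∈ expSet (pos J) := fun J => Set.mem_iInter.1 hb J
  refine ⟨fun i => ?_, fun p hp => ?_⟩
  · have := (h3 fun _ => 0).1 i
    simp only [Pi.sub_apply, Finset.sum_sub_distrib, sum_lmOn] at this
    linarith
  · obtain ⟨J, hJ⟩ := exists_notMem_pos hp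
    have h4 := (h3 J).2 p hJ
    rw [Pi.sub_apply, lmOn_of_notMem hJ, sub_zero] at h4
    exact h4

lemma laurent_globalExp_le (a : Fin t → ℕ) :
    laurent n (globalExp n fun i => (a i : ℤ)) ≤
      (MvPolynomial.weightedHomogeneousSubmodule ℂ (mdeg n) a).map
        (IsScalarTower.toAlgHom ℂ (MvPolynomial (Idx n) ℂ) (BigField n)).toLinearMap := by
  rw [laurent, Submodule.span_le]
  rintro _ ⟨b, hb, rfl⟩
  have h0 : ∀ p, 0 ≤ b p := fun ⟨i, k⟩ => by
    by_cases hi : n i = 0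
    · have h1 := hb.1 i
      have : Subsingleton (Fin (n i + 1)) := by rw [hi]; exact Fin.subsingleton_one
      rw [Fintype.sum_subsingleton _ k] at h1
      rw [h1]
      exact Int.natCast_nonneg _
    · exact hb.2 ⟨i, k⟩ hi
  let d : Idx n →₀ ℕ := Finsupp.equivFunOnFinite.symm fun p => (b p).toNat
  have hd : ∀ p, (d p : ℤ) = b p := fun p => Int.toNat_of_nonneg (h0 p)
  refine ⟨MvPolynomial.monomial d 1, MvPolynomial.isWeightedHomogeneous_monomial _ _ _ ?_, ?_⟩
  · funext i
    rw [weight_mdeg_apply]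
    zify
    simp only [hd]
    exact hb.1 i
  · change algebraMap (MvPolynomial (Idx n) ℂ) (BigField n) (MvPolynomial.monomial d 1) = _
    rw [algebraMap_monomial, one_smul]
    exact congrArg (lm n) (funext hd)

lemma HasForm.mem_H0_iff {M : (multiProj n).LineBundle} {u : BigField n} {a : Fin t → ℕ}
    (h : HasForm M u fun i => (a i : ℤ)) {f : functionField n} :
    f ∈ M.H0 ↔ ∃ P : MvPolynomial (Idx n) ℂ, MvPolynomial.IsWeightedHomogeneous (mdeg n) P a ∧
      (f : BigField n) = u * algebraMap _ _ P := by
  have hu := h.ne_zero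
  rw [Variety.LineBundle.H0, Submodule.mem_iInf]
  constructor
  · intro hf
    obtain ⟨P, hP, hPf⟩ := laurent_globalExp_le a
      (mem_laurent_globalExp_of_div fun J => h.mem_sectionsOn_iff.1 (hf J))
    refine ⟨P, hP, ?_⟩
    change algebraMap _ _ P = _ at hPf
    rw [hPf, mul_div_cancel₀ _ hu]
  · rintro ⟨P, hP, hf⟩ J
    refine h.mem_sectionsOn_iff.2 ?_
    rw [hf, mul_div_mul_left _ _ hu, P.as_sum, map_sum, Finset.sum_div]
    refine sum_mem fun b hb => ?_
    rw [algebraMap_monomial, smul_div_assoc, ← lm_sub]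
    refine Submodule.smul_mem _ _ (lm_mem_laurent ⟨fun i => ?_, fun p hp => ?_⟩)
    · have h1 := congrFun (hP (MvPolynomial.mem_support_iff.1 hb)) i
      rw [weight_mdeg_apply] at h1
      simp only [Pi.sub_apply, Finset.sum_sub_distrib]
      rw [sub_eq_zero]
      refine Eq.trans ?_ (sum_lmOn (n := n) J (fun i => (a i : ℤ)) i).symm
      rw [← h1]
      push_cast
      rfl
    · rw [Pi.sub_apply, lmOn_of_notMem hp, sub_zero]
      exact Int.natCast_nonneg _

lemma HasForm.nonneg_of_isEffective {M : (multiProj n).LineBundle} {u : BigField n}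
    {a : Fin t → ℤ} (h : HasForm M u a) (ha : ∀ i, n i = 0 → a i = 0) (hM : M.IsEffective)
    (i : Fin t) : 0 ≤ a i := by
  obtain ⟨f, hf, hf0⟩ := (Submodule.ne_bot_iff _).1 hM
  rw [Variety.LineBundle.H0, Submodule.mem_iInf] at hf
  have h1 : (f : BigField n) / u ∈ laurent n (globalExp n a) :=
    mem_laurent_globalExp_of_div fun J => h.mem_sectionsOn_iff.1 (hf J)
  have hne : (globalExp n a).Nonempty := by
    by_contra hne
    rw [Set.not_nonempty_iff_eq_empty] at hne
    rw [hne, laurent, Set.image_empty, Submodule.span_empty, Submodule.mem_bot] at h1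
    exact div_ne_zero (fun h => hf0 (Subtype.ext h)) h.ne_zero h1
  obtain ⟨b, hb⟩ := hne
  by_cases hi : n i = 0
  · exact (ha i hi).ge
  · rw [← hb.1 i]
    exact Finset.sum_nonneg fun k _ => hb.2 ⟨i, k⟩ hi

lemma exists_hasForm_of_isEffective {M : (multiProj n).LineBundle} (hM : M.IsEffective) :
    ∃ (u : BigField n) (a : Fin t → ℕ), (∀ i, n i = 0 → a i = 0) ∧
      HasForm M u fun i => (a i : ℤ) := by
  obtain ⟨u, a, ha, h⟩ := exists_hasForm M
  have h0 := h.nonneg_of_isEffective ha hM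
  refine ⟨u, fun i => (a i).toNat, fun i hi => by simp only [ha i hi, Int.toNat_zero], ?_⟩
  have : (fun i => ((a i).toNat : ℤ)) = a := funext fun i => Int.toNat_of_nonneg (h0 i)
  rwa [this]

/-! ### The canonical bundle -/

end MultiProj

/-! ### Forms of top degree in coordinates -/

section TopForms

variable {K : Type} [Field K] [Algebra ℂ K] {r : ℕ} (b : Module.Basis (Fin r) K (Ω[K⁄ℂ]))

/-- The coefficient of a form of top degree with respect to a basis of the differentials. -/
def topCoeff : ⋀[K]^r (Ω[K⁄ℂ]) →ₗ[K] K := exteriorPower.alternatingMapLinearEquiv b.det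

lemma topCoeff_ιMulti (v : Fin r → Ω[K⁄ℂ]) : topCoeff b (exteriorPower.ιMulti K r v) = b.det v :=
  exteriorPower.alternatingMapLinearEquiv_apply_ιMulti _ _

lemma topCoeff_smul_ιMulti (ω : ⋀[K]^r (Ω[K⁄ℂ])) :
    topCoeff b ω • exteriorPower.ιMulti K r b = ω := by
  have h1 : (topCoeff b).smulRight (exteriorPower.ιMulti K r b) = LinearMap.id := by
    apply exteriorPower.linearMap_ext
    refine Module.Basis.ext_alternating b fun v hv => ?_
    let σ : Equiv.Perm (Fin r) := Equiv.ofBijective v (Finite.injective_iff_bijective.1 hv)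
    change topCoeff b (exteriorPower.ιMulti K r fun i => b (σ i)) • _ =
      exteriorPower.ιMulti K r fun i => b (σ i)
    have h2 := (exteriorPower.ιMulti K r (M := Ω[K⁄ℂ])).map_perm b σ
    have h3 : (fun i => b (σ i)) = b ∘ σ := rfl
    rw [h3, h2, Units.smul_def, map_zsmul, topCoeff_ιMulti, b.det_self, smul_assoc, one_smul]
  exact LinearMap.congr_fun h1 ω

/-- The coordinates `c` and their dual derivations are regular, so dc₁ ∧ ⋯ ∧ dcᵣ generates the
regular top forms over `A`. -/
lemma Variety.mem_regularForms_top_iff {A : Subalgebra ℂ K} {c : Fin r → K} (hc : ∀ i, c i ∈ A)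
    (hb : ∀ i, b i = KaehlerDifferential.D ℂ K (c i))
    (hA : ∀ i, ∀ f ∈ A, b.coord i (KaehlerDifferential.D ℂ K f) ∈ A) {ω : ⋀[K]^r (Ω[K⁄ℂ])} :
    ω ∈ Variety.regularForms A r ↔ topCoeff b ω ∈ A := by
  constructor
  · intro hω
    induction hω using Submodule.span_induction with
    | mem ω hω =>
      obtain ⟨a, rfl⟩ := hω
      rw [topCoeff_ιMulti, Module.Basis.det_apply, Matrix.det_apply]
      exact sum_mem fun σ _ => zsmul_mem (prod_mem fun k _ => hA _ _ (a _).2) _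
    | zero => rw [map_zero]; exact zero_mem _
    | add ω ω' _ _ h h' => rw [map_add]; exact add_mem h h'
    | smul a ω _ h =>
      rw [← algebraMap_smul K a ω, map_smul, smul_eq_mul]
      exact mul_mem a.2 h
  · intro h
    have h1 : exteriorPower.ιMulti K r b ∈ Variety.regularForms A r := by
      rw [show (b : Fin r → Ω[K⁄ℂ]) = fun i => KaehlerDifferential.D ℂ K (c i) from funext hb]
      exact Submodule.subset_span ⟨fun i => ⟨c i, hc i⟩, rfl⟩
    rw [← topCoeff_smul_ιMulti b ω]
    exact Submodule.smul_mem (Variety.regularForms A r) (⟨_, h⟩ : A) h1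

/-- `h` is the coefficient of the chosen rational form in the reference basis `b₀`; the determinant
changes to the basis of a chart. -/
lemma Variety.LineBundle.IsCanonical.exists_mem_iff {Z : Variety K} {M : Z.LineBundle}
    (hM : M.IsCanonical) (b₀ : Module.Basis (Fin Z.dim) K (Ω[K⁄ℂ])) : ∃ h : K, h ≠ 0 ∧
      ∀ (j : Z.ι) (b : Module.Basis (Fin Z.dim) K (Ω[K⁄ℂ])) (c : Fin Z.dim → K),
        (∀ i, c i ∈ Z.chart j) → (∀ i, b i = KaehlerDifferential.D ℂ K (c i)) →
        (∀ i, ∀ f ∈ Z.chart j, b.coord i (KaehlerDifferential.D ℂ K f) ∈ Z.chart j) →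
        ∀ f, f ∈ M.sectionsOn j ↔ f * (h * b.det b₀) ∈ Z.chart j := by
  obtain ⟨ω, hω, hM⟩ := hM
  have hω' := topCoeff_smul_ιMulti b₀ ω
  refine ⟨topCoeff b₀ ω, fun h0 => hω ?_, fun j b c hc hb hA f => ?_⟩
  · rw [← hω', h0, zero_smul]
  · rw [hM, Variety.mem_regularForms_top_iff b hc hb hA, map_smul, smul_eq_mul, ← topCoeff_ιMulti,
      ← smul_eq_mul (topCoeff b₀ ω), ← map_smul, hω']

end TopForms

namespace MultiProj

variable {t : ℕ} {n : Fin t → ℕ}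

/-- An enumeration of the affine coordinates of a chart. -/
def offEquiv (J : ∀ i, Fin (n i + 1)) : Off J ≃ Fin (multiProj n).dim :=
  Fintype.equivFinOfCardEq (dim_eq J).symm

/-- The differentials of the affine coordinates of a chart. -/
def topBasis (J : ∀ i, Fin (n i + 1)) :
    Module.Basis (Fin (multiProj n).dim) (functionField n) (Ω[functionField n⁄ℂ]) :=
  (kaehlerBasis J).reindex (offEquiv J)

/-- The denominators contribute x_{i, J i} to the power n i + 1, which is the source of the
canonical multidegree. -/
lemma prod_off_coord (J : ∀ i, Fin (n i + 1)) :
    ((∏ q : Off J, coord J q.1 : functionField n) : BigField n) =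
      lm n (fun _ => 1) * lm n (lmOn J fun i => -(n i + 1 : ℤ)) := by
  classical
  have h1 : ∏ q : Off J, coord J q.1 = ∏ p, coord J p := by
    rw [← Fintype.prod_subtype_mul_prod_subtype (fun p : Idx n => p.2 ≠ J p.1) (coord J)]
    rw [Finset.prod_eq_one (f := fun q : {p : Idx n // ¬p.2 ≠ J p.1} => coord J q.1), mul_one]
    rintro ⟨⟨i, k⟩, hk⟩ -
    obtain rfl : k = J i := not_not.1 hk
    exact coord_self J i
  have h2 : ((∏ p, coord J p : functionField n) : BigField n) = ∏ p, (coord J p : BigField n) := by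
    rw [← IntermediateField.algebraMap_apply, map_prod]
    rfl
  rw [h1, h2, ← lm_add]
  simp only [coe_coord_eq_lm]
  rw [← lm_sum]
  congr 1
  funext r
  simp only [Finset.sum_sub_distrib, Pi.sub_apply, Finset.sum_apply, Pi.add_apply, Pi.single_apply]
  rw [Finset.sum_ite_eq Finset.univ r, if_pos (Finset.mem_univ r), sub_eq_add_neg,
    Fintype.sum_sigma (fun p : Idx n => if r = ⟨p.1, J p.1⟩ then (1 : ℤ) else 0)]
  congr 1
  obtain ⟨i, k⟩ := r
  rw [Finset.sum_eq_single i]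
  · simp only [lmOn, Sigma.mk.injEq, heq_eq_eq, true_and]
    split_ifs <;> simp
  · intro j _ hj
    refine Finset.sum_eq_zero fun l _ => if_neg ?_
    rintro ⟨⟩
    exact hj rfl
  · simp

/-- By `coord_mul_coordDer`, the logarithmic differentials of two charts are related by an integer
matrix, so its determinant is constant; it is nonzero because both sides are bases. -/
lemma det_topBasis (J J' : ∀ i, Fin (n i + 1)) : ∃ c : ℂ, c ≠ 0 ∧
    (∏ q : Off J, coord J q.1) * (topBasis J).det (topBasis J') =
      algebraMap ℂ _ c * ∏ q : Off J', coord J' q.1 := by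
  classical
  let N : Matrix (Fin (multiProj n).dim) (Fin (multiProj n).dim) ℤ := fun i j =>
    (Pi.single ((offEquiv J').symm j).1 1 - Pi.single ⟨((offEquiv J').symm j).1.1,
      J' ((offEquiv J').symm j).1.1⟩ 1 : Idx n → ℤ) ((offEquiv J).symm i).1
  have h1 : ∀ i j, coord J ((offEquiv J).symm i).1 * (topBasis J).toMatrix (topBasis J') i j =
      (N i j : functionField n) * coord J' ((offEquiv J').symm j).1 := fun i j => by
    rw [← coord_mul_coordDer J _ (coord_exp_sum J' _) (coe_coord_eq_lm J' _), coordDer_apply,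
      Module.Basis.toMatrix_apply, topBasis, topBasis, Module.Basis.reindex_apply,
      Module.Basis.repr_reindex_apply, kaehlerBasis_apply, Module.Basis.coord_apply]
  have h2 := Matrix.det_mul_column (fun i => coord J ((offEquiv J).symm i).1)
    ((topBasis J).toMatrix (topBasis J'))
  have h3 := Matrix.det_mul_row (fun j => coord J' ((offEquiv J').symm j).1)
    (N.map (Int.cast : ℤ → functionField n))
  have h4 : (Matrix.of fun i j => coord J ((offEquiv J).symm i).1 *
      (topBasis J).toMatrix (topBasis J') i j) = Matrix.of fun i j =>
      coord J' ((offEquiv J').symm j).1 * N.map (Int.cast : ℤ → functionField n) i j := by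
    ext i j
    rw [Matrix.of_apply, h1, Matrix.of_apply, Matrix.map_apply, mul_comm]
  rw [h4, h3] at h2
  have h5 : (N.map (Int.cast : ℤ → functionField n)).det = algebraMap ℂ _ (N.det : ℂ) := by
    rw [map_intCast, Int.cast_det]
  rw [Equiv.prod_comp (offEquiv J).symm (fun q : Off J => coord J q.1),
    Equiv.prod_comp (offEquiv J').symm (fun q : Off J' => coord J' q.1), h5] at h2
  refine ⟨N.det, ?_, by rw [Module.Basis.det_apply, ← h2, mul_comm]⟩
  intro h0
  rw [h0, map_zero, mul_zero] at h2
  refine mul_ne_zero (Finset.prod_ne_zero_iff.2 fun q _ => coord_ne_zero J q.1)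
    (IsUnit.ne_zero ((topBasis J).isUnit_det (topBasis J'))) h2.symm

lemma HasForm.of_isCanonical {M : (multiProj n).LineBundle} (hM : M.IsCanonical) :
    ∃ u, HasForm M u fun i => -(n i + 1 : ℤ) := by
  let J₀ : ∀ i, Fin (n i + 1) := fun _ => 0
  obtain ⟨h, hh0, hM⟩ := hM.exists_mem_iff (topBasis J₀)
  let P : functionField n := ∏ q : Off J₀, coord J₀ q.1
  have hP : P ≠ 0 := Finset.prod_ne_zero_iff.2 fun q _ => coord_ne_zero J₀ q.1
  -- The monomial with all exponents 1 is the part of the product of affine coordinates common to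
  -- all charts.
  refine ⟨((h * P)⁻¹ : functionField n) * lm n (fun _ => 1), fun J => ?_⟩
  refine ⟨(h * P)⁻¹ * ∏ q : Off J, coord J q.1, mul_ne_zero (inv_ne_zero (mul_ne_zero hh0 hP))
    (Finset.prod_ne_zero_iff.2 fun q _ => coord_ne_zero J q.1), ?_, ?_⟩
  · rw [IntermediateField.coe_mul, prod_off_coord, mul_assoc]
  · obtain ⟨c, hc, hdet⟩ := det_topBasis J J₀
    set Q : functionField n := ∏ q : Off J, coord J q.1 with hQ
    have hQ0 : Q ≠ 0 := Finset.prod_ne_zero_iff.2 fun q _ => coord_ne_zero J q.1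
    have key : ∀ f : functionField n, f ∈ M.sectionsOn J ↔
        f * (h * P * Q⁻¹) ∈ (multiProj n).chart J := fun f => by
      rw [hM J (topBasis J) (fun i => coord J ((offEquiv J).symm i).1) (fun i => coord_mem_chart _ _)
        (fun i => by rw [topBasis, Module.Basis.reindex_apply, kaehlerBasis_apply])
        (fun i g hg => by
          have := coordDer_mem_vectorFields J ((offEquiv J).symm i) g hg
          rw [topBasis, Module.Basis.coord_apply, Module.Basis.repr_reindex_apply]
          rwa [coordDer_apply] at this)]
      have : (topBasis J).det (topBasis J₀) = algebraMap ℂ _ c * (P * Q⁻¹) := by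
        rw [← mul_assoc, eq_mul_inv_iff_mul_eq₀ hQ0, mul_comm]
        exact hdet
      rw [this, show f * (h * (algebraMap ℂ _ c * (P * Q⁻¹))) = c • (f * (h * P * Q⁻¹)) by
        rw [Algebra.smul_def]; ring]
      exact Submodule.smul_mem_iff (Subalgebra.toSubmodule ((multiProj n).chart J)) hc
    ext f
    rw [key, Submodule.mem_span_singleton]
    constructor
    · intro hf
      refine ⟨⟨_, hf⟩, ?_⟩
      change f * (h * P * Q⁻¹) * ((h * P)⁻¹ * Q) = f
      field_simp
    · rintro ⟨g, rfl⟩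
      have : (g : functionField n) * ((h * P)⁻¹ * Q) * (h * P * Q⁻¹) = g := by field_simp
      change (g : functionField n) * ((h * P)⁻¹ * Q) * (h * P * Q⁻¹) ∈ _
      rw [this]
      exact g.2

end MultiProj

/-! ### Regular systems of parameters and derivations -/

/-- The Jacobian criterion: a derivation maps 𝔪² into 𝔪, so a relation in the cotangent space gives
a relation among the derivatives in the residue field. -/
lemma IsLocalRing.linearIndependent_toCotangent {O : Type} [CommRing O] [IsLocalRing O] {m : ℕ}
    {Q : Type} (f : Fin m → O) (δ : Q → Derivation ℤ O O)
    (h : ∀ lam : Fin m → IsLocalRing.ResidueField O,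
      (∀ j, lam j * IsLocalRing.residue O (f j) = 0) →
      (∀ q, ∑ j, lam j * IsLocalRing.residue O (δ q (f j)) = 0) → lam = 0) :
    LinearIndependent (IsLocalRing.ResidueField O)
      (fun i : {i // f i ∈ IsLocalRing.maximalIdeal O} =>
        ((IsLocalRing.maximalIdeal O).toCotangent ⟨f i, i.2⟩ : IsLocalRing.CotangentSpace O)) := by
  classical
  rw [Fintype.linearIndependent_iff]
  intro g hg
  choose l hl using fun i => IsLocalRing.residue_surjective (g i)
  have h1 : ∑ i, l i * f i.1 ∈ IsLocalRing.maximalIdeal O ^ 2 := by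
    have h2 : (IsLocalRing.maximalIdeal O).toCotangent
        (∑ i, l i • (⟨f i.1, i.2⟩ : IsLocalRing.maximalIdeal O)) = 0 := by
      rw [map_sum, ← hg]
      refine Finset.sum_congr rfl fun i _ => ?_
      rw [map_smul, ← hl]
      rfl
    rw [Ideal.toCotangent_eq_zero] at h2
    simpa using h2
  have h3 : ∀ q, ∀ y ∈ IsLocalRing.maximalIdeal O ^ 2, IsLocalRing.residue O (δ q y) = 0 := by
    intro q y hy
    rw [pow_two] at hy
    induction hy using Submodule.mul_induction_on' with
    | mem_mul_mem a ha b hb =>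
      rw [Derivation.leibniz, map_add, smul_eq_mul, smul_eq_mul, map_mul, map_mul,
        (IsLocalRing.residue_eq_zero_iff a).2 ha, (IsLocalRing.residue_eq_zero_iff b).2 hb]
      ring
    | add a _ b _ ha hb => rw [map_add, map_add, ha, hb, add_zero]
  let lam : Fin m → IsLocalRing.ResidueField O := fun j =>
    if hj : f j ∈ IsLocalRing.maximalIdeal O then g ⟨j, hj⟩ else 0
  have hsum : ∀ F : Fin m → IsLocalRing.ResidueField O, ∑ j, lam j * F j =
      ∑ i : {i // f i ∈ IsLocalRing.maximalIdeal O}, g i * F i.1 := fun F => by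
    rw [← Fintype.sum_subtype_add_sum_subtype (fun j => f j ∈ IsLocalRing.maximalIdeal O),
      Finset.sum_eq_zero (s := (Finset.univ : Finset {j // ¬f j ∈ IsLocalRing.maximalIdeal O})),
      add_zero]
    · refine Finset.sum_congr rfl fun i _ => ?_
      simp only [lam, dif_pos i.2]
    · intro j _
      simp only [lam, dif_neg j.2, zero_mul]
  have hlam := h lam (fun j => by
    by_cases hj : f j ∈ IsLocalRing.maximalIdeal O
    · rw [(IsLocalRing.residue_eq_zero_iff _).2 hj, mul_zero]
    · simp only [lam, dif_neg hj, zero_mul]) fun q => by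
    have h4 := h3 q _ h1
    rw [map_sum, map_sum] at h4
    rw [hsum, ← h4]
    refine Finset.sum_congr rfl fun i _ => ?_
    rw [Derivation.leibniz, map_add, smul_eq_mul, smul_eq_mul, map_mul, map_mul,
      (IsLocalRing.residue_eq_zero_iff _).2 i.2, hl, zero_mul, add_zero]
  intro i
  have := congrFun hlam i.1
  simp only [lam, dif_pos i.2] at this
  exact this

/-- The restriction of a derivation of a field to a subring that it preserves. -/
def Derivation.restrictSubring {K : Type} [Field K] [Algebra ℂ K] (D : Derivation ℂ K K)
    (O : Subring K) (h : ∀ f ∈ O, D f ∈ O) : Derivation ℤ O O :=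
  Derivation.mk'
    (AddMonoidHom.toIntLinearMap
      { toFun := fun f => ⟨D (f : K), h f f.2⟩
        map_zero' := Subtype.ext (map_zero D)
        map_add' := fun a b => Subtype.ext (map_add D (a : K) (b : K)) })
    fun a b => Subtype.ext (D.leibniz (a : K) (b : K))

lemma Derivation.coe_restrictSubring {K : Type} [Field K] [Algebra ℂ K] (D : Derivation ℂ K K)
    (O : Subring K) (h : ∀ f ∈ O, D f ∈ O) (f : O) : (D.restrictSubring O h f : K) = D (f : K) := rfl

lemma Variety.apply_mem_localRing {K : Type} [Field K] [Algebra ℂ K] {A : Subalgebra ℂ K}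
    {D : Derivation ℂ K K} (hD : D ∈ Variety.vectorFields A) (P : Ideal A) [P.IsMaximal] {f : K}
    (hf : f ∈ (Variety.localRing A P).toSubring) : D f ∈ (Variety.localRing A P).toSubring := by
  let P' : Ideal A.toSubring := P
  have hP : P'.IsPrime := Ideal.IsMaximal.isPrime (I := P) ‹_›
  obtain ⟨⟨a, s⟩, hs⟩ := IsLocalization.surj (M := P'.primeCompl)
    (S := (LocalSubring.ofPrime A.toSubring P').toSubring) ⟨f, hf⟩
  have hs' : f * (s.1 : K) = (a : K) := congrArg Subtype.val hs
  have hle : ∀ a ∈ A, a ∈ (Variety.localRing A P).toSubring := fun a ha =>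
    LocalSubring.le_ofPrime A.toSubring P ha
  obtain ⟨w, hw⟩ := IsLocalization.map_units (M := P'.primeCompl)
    (LocalSubring.ofPrime A.toSubring P').toSubring s
  have hw' : (s.1 : K) * ((w⁻¹ : Units _).1 : K) = 1 := by
    have := w.mul_inv
    rw [hw] at this
    exact congrArg Subtype.val this
  have h2 : D f = ((w⁻¹ : Units _).1 : K) * (D a - f * D s.1) := by
    rw [← hs', Derivation.leibniz, smul_eq_mul, smul_eq_mul]
    linear_combination (-(D f)) * hw'
  rw [h2]
  exact mul_mem (w⁻¹ : Units _).1.2 (sub_mem (hle _ (hD _ a.2)) (mul_mem hf (hle _ (hD _ s.1.2))))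

lemma Variety.span_subring_span_singleton {K : Type} [Field K] [Algebra ℂ K] {A : Subalgebra ℂ K}
    {O : Subring K} (hle : ∀ a ∈ A, a ∈ O) (w : K) :
    Submodule.span O (Submodule.span A {w} : Set K) = Submodule.span O {w} := by
  apply le_antisymm
  · rw [Submodule.span_le]
    intro y hy
    obtain ⟨g, rfl⟩ := Submodule.mem_span_singleton.1 hy
    exact Submodule.mem_span_singleton.2 ⟨⟨g, hle _ g.2⟩, rfl⟩
  · exact Submodule.span_mono Submodule.subset_span

namespace MultiProj

variable {t : ℕ} {n : Fin t → ℕ}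

/-! ### Multihomogeneous polynomials -/

/-- Euler's identity in a single factor. -/
lemma sum_X_mul_pderiv {P : MvPolynomial (Idx n) ℂ} {a : Fin t → ℕ}
    (hP : MvPolynomial.IsWeightedHomogeneous (mdeg n) P a) (i : Fin t) :
    ∑ k, MvPolynomial.X ⟨i, k⟩ * MvPolynomial.pderiv ⟨i, k⟩ P = a i • P := by
  have h1 : ∀ k, MvPolynomial.X ⟨i, k⟩ * MvPolynomial.pderiv ⟨i, k⟩ P =
      ∑ b ∈ P.support, b ⟨i, k⟩ • MvPolynomial.monomial b (MvPolynomial.coeff b P) := fun k => by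
    conv_lhs => rw [P.as_sum, map_sum, Finset.mul_sum]
    exact Finset.sum_congr rfl fun b _ => MvPolynomial.X_mul_pderiv_monomial
  simp only [h1]
  rw [Finset.sum_comm]
  conv_rhs => rw [P.as_sum, Finset.smul_sum]
  refine Finset.sum_congr rfl fun b hb => ?_
  rw [← Finset.sum_smul, ← weight_mdeg_apply, hP (MvPolynomial.mem_support_iff.1 hb)]

/-- The grouping `σ` is arbitrary: it is used for homogeneous coordinates grouped by factor and for
coefficients grouped by form. -/
lemma aeval_mul_of_isWeightedHomogeneous {S β ι : Type} [CommRing S] [Algebra ℂ S] [Fintype ι]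
    [DecidableEq ι] (σ : β → ι) {P : MvPolynomial β ℂ} {a : ι → ℕ}
    (hP : MvPolynomial.IsWeightedHomogeneous (fun b => (Pi.single (σ b) 1 : ι → ℕ)) P a)
    (c : ι → S) (v : β → S) :
    MvPolynomial.aeval (fun p => c (σ p) * v p) P = (∏ i, c i ^ a i) * MvPolynomial.aeval v P := by
  rw [P.as_sum, map_sum, map_sum, Finset.mul_sum]
  refine Finset.sum_congr rfl fun b hb => ?_
  rw [MvPolynomial.aeval_monomial, MvPolynomial.aeval_monomial, Finsupp.prod, Finsupp.prod]
  simp only [mul_pow, Finset.prod_mul_distrib]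
  rw [mul_left_comm]
  congr 1
  rw [← hP (MvPolynomial.mem_support_iff.1 hb), Finsupp.weight_apply, Finsupp.sum]
  simp only [Finset.sum_apply, Pi.smul_apply, ← Finset.prod_pow_eq_pow_sum]
  rw [Finset.prod_comm]
  refine Finset.prod_congr rfl fun p _ => ?_
  rw [Finset.prod_eq_single (σ p)]
  · simp
  · intro i _ hi
    simp [hi]
  · simp

lemma algebraMap_eq_aeval (P : MvPolynomial (Idx n) ℂ) :
    algebraMap _ (BigField n) P = MvPolynomial.aeval (x n) P := by
  have : IsScalarTower.toAlgHom ℂ (MvPolynomial (Idx n) ℂ) (BigField n) =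
      MvPolynomial.aeval (x n) := by
    apply MvPolynomial.algHom_ext
    intro p
    rw [MvPolynomial.aeval_X]
    rfl
  exact DFunLike.congr_fun this P

lemma lm_lmOn (J : ∀ i, Fin (n i + 1)) (a : Fin t → ℤ) :
    lm n (lmOn J a) = ∏ i, x n ⟨i, J i⟩ ^ a i := by
  classical
  rw [lm, Fintype.prod_sigma]
  refine Finset.prod_congr rfl fun i _ => ?_
  rw [Finset.prod_eq_single (J i)]
  · rw [lmOn, if_pos rfl]
  · intro k _ hk
    rw [lmOn_of_notMem hk, zpow_zero]
  · simp

lemma algebraMap_eq_aeval_coord_mul (J : ∀ i, Fin (n i + 1)) {P : MvPolynomial (Idx n) ℂ}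
    {a : Fin t → ℕ} (hP : MvPolynomial.IsWeightedHomogeneous (mdeg n) P a) :
    algebraMap _ (BigField n) P = ((MvPolynomial.aeval (coord J) P : functionField n) : BigField n) *
      lm n (lmOn J fun i => (a i : ℤ)) := by
  have h1 : ((MvPolynomial.aeval (coord J) P : functionField n) : BigField n) =
      MvPolynomial.aeval (fun p => (coord J p : BigField n)) P :=
    MvPolynomial.comp_aeval_apply (coord J) (functionField n).val P
  rw [h1, lm_lmOn, mul_comm]
  simp only [zpow_natCast]
  rw [← aeval_mul_of_isWeightedHomogeneous Sigma.fst hP, algebraMap_eq_aeval]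
  congr 2
  funext p
  rw [coe_coord, mul_div_cancel₀ _ (x_ne_zero n _)]

/-- The missing derivatives in the directions ⟨i, J i⟩ are supplied by Euler's identity, as the
multiples `λ_j P_j` vanish at the point. -/
lemma _root_.IsTransversal.eq_zero_of_chart {m : ℕ} {P : Fin m → MvPolynomial (Idx n) ℂ}
    {a : Fin m → Fin t → ℕ} (hP : IsTransversal P)
    (ha : ∀ j, MvPolynomial.IsWeightedHomogeneous (mdeg n) (P j) (a j))
    (J : ∀ i, Fin (n i + 1)) {κ : Type} [Field κ] [Algebra ℂ κ] {p : Idx n → κ}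
    (hp : ∀ i, p ⟨i, J i⟩ = 1) {lam : Fin m → κ}
    (h : ∀ j, lam j * MvPolynomial.aeval p (P j) = 0)
    (h' : ∀ q : Off J, ∑ j, lam j * MvPolynomial.aeval p (MvPolynomial.pderiv q.1 (P j)) = 0) :
    lam = 0 := by
  refine hP κ p lam (fun i => ⟨J i, by rw [hp]; exact one_ne_zero⟩) h fun ⟨i, k⟩ => ?_
  by_cases hk : k = J i
  · subst hk
    have h1 : ∀ j, lam j * ∑ k, p ⟨i, k⟩ * MvPolynomial.aeval p
        (MvPolynomial.pderiv ⟨i, k⟩ (P j)) = 0 := fun j => by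
      have h2 := congrArg (MvPolynomial.aeval p) (sum_X_mul_pderiv (ha j) i)
      simp only [map_sum, map_mul, MvPolynomial.aeval_X, map_nsmul] at h2
      rw [h2, mul_smul_comm, h, smul_zero]
    have h3 : ∑ k, p ⟨i, k⟩ * ∑ j, lam j * MvPolynomial.aeval p
        (MvPolynomial.pderiv ⟨i, k⟩ (P j)) = 0 := by
      rw [← Finset.sum_eq_zero fun j _ => h1 j]
      simp only [Finset.mul_sum]
      rw [Finset.sum_comm]
      exact Finset.sum_congr rfl fun _ _ => Finset.sum_congr rfl fun _ _ => by ring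
    rw [Finset.sum_eq_single (J i)] at h3
    · rwa [hp, one_mul] at h3
    · intro k _ hk
      rw [h' ⟨⟨i, k⟩, hk⟩, mul_zero]
    · simp
  · exact h' ⟨⟨i, k⟩, hk⟩

lemma _root_.IsTransversal.ne_zero {m : ℕ} {P : Fin m → MvPolynomial (Idx n) ℂ} (hP : IsTransversal P)
    (j : Fin m) : P j ≠ 0 := by
  classical
  intro h0
  have h1 := hP ℂ (fun _ => 1) (Pi.single j 1) (fun i => ⟨0, one_ne_zero⟩)
    (fun l => by
      by_cases hl : l = j
      · rw [hl, h0, map_zero, mul_zero]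
      · rw [Pi.single_eq_of_ne hl, zero_mul])
    (fun q => Finset.sum_eq_zero fun l _ => by
      by_cases hl : l = j
      · rw [hl, h0, map_zero, map_zero, mul_zero]
      · rw [Pi.single_eq_of_ne hl, zero_mul])
  have h2 := congrFun h1 j
  rw [Pi.single_eq_same] at h2
  exact one_ne_zero h2

/-- Setting x_{i, J i} = 1 in `P j` gives its local equation on the chart. The residues of the
affine coordinates form a point over the residue field, where transversality is the hypothesis of
the Jacobian criterion. -/
lemma _root_.IsTransversal.isSNC {m : ℕ} {P : Fin m → MvPolynomial (Idx n) ℂ} (hP : IsTransversal P)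
    {T : Fin m → (multiProj n).LineBundle} {u : Fin m → BigField n} {a : Fin m → Fin t → ℕ}
    (hT : ∀ j, HasForm (T j) (u j) fun i => (a j i : ℤ))
    (ha : ∀ j, MvPolynomial.IsWeightedHomogeneous (mdeg n) (P j) (a j)) {s : ∀ j, (T j).H0}
    (hs : ∀ j, ((s j : functionField n) : BigField n) = u j * algebraMap _ _ (P j)) :
    Variety.IsSNC T s := by
  refine ⟨fun j h0 => ?_, fun J M hM => ?_⟩
  · have h1 := hs j
    rw [h0] at h1
    refine mul_ne_zero (hT j).ne_zero ?_ h1.symm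
    exact (map_ne_zero_iff _ (IsFractionRing.injective _ _)).2 (hP.ne_zero j)
  · let J : ∀ i, Fin (n i + 1) := J
    let O := (Variety.localRing ((multiProj n).chart J) M).toSubring
    have hle : ∀ a ∈ (multiProj n).chart J, a ∈ O := fun a ha =>
      LocalSubring.le_ofPrime ((multiProj n).chart J).toSubring M ha
    let _ : Algebra ℂ O := ((algebraMap ℂ (functionField n)).codRestrict O
      fun c => hle _ (Subalgebra.algebraMap_mem _ c)).toAlgebra
    let v : Idx n → O := fun p => ⟨coord J p, hle _ (coord_mem_chart J p)⟩
    let emb : O →ₐ[ℂ] functionField n := { O.subtype with commutes' := fun _ => rfl }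
    let res : O →ₐ[ℂ] IsLocalRing.ResidueField O :=
      { IsLocalRing.residue O with commutes' := fun _ => rfl }
    have hemb : ∀ Q : MvPolynomial (Idx n) ℂ, ((MvPolynomial.aeval v Q : O) : functionField n) =
        MvPolynomial.aeval (coord J) Q := fun Q =>
      MvPolynomial.comp_aeval_apply v emb Q
    have hres : ∀ Q : MvPolynomial (Idx n) ℂ, IsLocalRing.residue O (MvPolynomial.aeval v Q) =
        MvPolynomial.aeval (fun p => res (v p)) Q := fun Q =>
      MvPolynomial.comp_aeval_apply v res Q
    refine ⟨fun j => MvPolynomial.aeval v (P j), fun j => ?_, ?_⟩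
    · obtain ⟨w, hw, hwu, hspan⟩ := hT j J
      refine ⟨w, ?_, Subtype.ext ?_⟩
      · rw [hspan]
        exact Variety.span_subring_span_singleton hle w
      · rw [hs, IntermediateField.coe_mul, hemb, hwu, algebraMap_eq_aeval_coord_mul J (ha j)]
        ring
    · refine IsLocalRing.linearIndependent_toCotangent (O := O) (fun j => MvPolynomial.aeval v (P j))
        (fun q : Off J => (coordDer J q).restrictSubring O fun f hf =>
          Variety.apply_mem_localRing (coordDer_mem_vectorFields J q) M hf) ?_
      intro lam h1 h2
      refine hP.eq_zero_of_chart ha J (p := fun p => res (v p)) (fun i => ?_)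
        (fun j => by rw [← hres]; exact h1 j) fun q => ?_
      · have : v ⟨i, J i⟩ = 1 := Subtype.ext (coord_self J i)
        rw [this, map_one]
      · rw [← h2 q]
        refine Finset.sum_congr rfl fun j _ => ?_
        rw [← hres]
        congr 2
        apply Subtype.ext
        classical
        rw [Derivation.coe_restrictSubring, hemb, hemb, Derivation.apply_aeval,
          Finset.sum_eq_single q.1]
        · rw [coordDer_coord, if_pos rfl, mul_one]
        · intro r _ hr
          rw [coordDer_coord, if_neg hr, mul_zero]
        · simp

end MultiProj

/-! ### Characters of products of special linear groups -/
namespace Matrix.SpecialLinearGroup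

variable {ι : Type} [DecidableEq ι] [Fintype ι]

lemma coe_transvection_mul {i j : ι} (hij : i ≠ j) (c : ℂ) (M : Matrix ι ι ℂ) (p q : ι) :
    ((transvection hij c : SpecialLinearGroup ι ℂ).1 * M) p q =
      if p = i then M i q + c * M j q else M p q := by
  split_ifs with h
  · rw [h]
    exact transvection_mul_apply_same i j q c M
  · exact transvection_mul_apply_of_ne i j p q h c M

lemma coe_transvection_apply {i j : ι} (hij : i ≠ j) (c : ℂ) (p q : ι) :
    (transvection hij c : SpecialLinearGroup ι ℂ).1 p q =
      if p = i then (1 : Matrix ι ι ℂ) i q + c * (1 : Matrix ι ι ℂ) j q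
      else (1 : Matrix ι ι ℂ) p q := by
  rw [← coe_transvection_mul hij, mul_one]

/-- Expresses diagonal elements by transvections, so a homomorphism trivial on transvections is
trivial on them too. -/
lemma transvection_mul_transvection_mul_transvection {i j : ι} (hij : i ≠ j) {a : ℂ} (ha : a ≠ 0) :
    transvection hij a * (transvection hij.symm (-a⁻¹) * transvection hij a) =
      diag2n hij a ha * (transvection hij 1 * (transvection hij.symm (-1) * transvection hij 1)) := by
  ext p q
  rw [coe_mul, coe_mul, coe_mul, coe_mul, coe_mul, diag2n_coe, Matrix.diagonal_mul]
  simp only [coe_transvection_mul, coe_transvection_apply]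
  by_cases hp : p = i
  · subst hp
    simp [hij, hij.symm]
    field_simp
    ring
  · by_cases hp' : p = j
    · subst hp'
      simp [hij.symm]
      field_simp
      ring
    · simp [hp, hp']

lemma diag2n_mul_transvection {i j : ι} (hij : i ≠ j) {a : ℂ} (ha : a ≠ 0) (c : ℂ) :
    diag2n hij a ha * transvection hij c = transvection hij (a ^ 2 * c) * diag2n hij a ha := by
  ext p q
  rw [coe_mul, coe_mul, diag2n_coe, Matrix.diagonal_mul, coe_transvection_mul,
    coe_transvection_apply]
  by_cases hp : p = i
  · subst hp
    simp [Matrix.diagonal_apply, Matrix.one_apply, hij.symm]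
    split_ifs <;> simp_all
    field_simp
  · simp [hp, Matrix.diagonal_apply, Matrix.one_apply]

/-- Conjugation by diag(a, a⁻¹) with a² = 2 doubles the parameter of a transvection, so its image
equals its own square. Transvections and diagonal elements generate. -/
lemma monoidHom_eq_one {A : Type} [CommGroup A] [Nontrivial ι] (χ : SpecialLinearGroup ι ℂ →* A) :
    χ = 1 := by
  have ht : ∀ (i j : ι) (hij : i ≠ j) (c : ℂ), χ (transvection hij c) = 1 := fun i j hij c => by
    obtain ⟨a, ha⟩ := IsAlgClosed.exists_pow_nat_eq (2 : ℂ) two_pos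
    have ha0 : a ≠ 0 := by rintro rfl; norm_num at ha
    have h1 := congrArg χ (diag2n_mul_transvection hij ha0 c)
    rw [map_mul, map_mul, mul_comm, ha, two_mul, transvection_add, map_mul] at h1
    simpa using h1
  refine MonoidHom.ext fun g => ?_
  rw [MonoidHom.one_apply]
  induction g using diagonal_transvection_induction' with
  | hdiag i j hij hc =>
    have h1 := congrArg χ (transvection_mul_transvection_mul_transvection hij hc)
    simpa only [map_mul, ht, mul_one, eq_comm] using h1
  | htransvec i j hij a => exact ht i j hij a
  | hmul A B hA hB => rw [map_mul, hA, hB, mul_one]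

end Matrix.SpecialLinearGroup

lemma MultiProj.monoidHom_eq_one {t : ℕ} {n : Fin t → ℕ} {A : Type} [CommGroup A]
    (χ : SLProd n →* A) : χ = 1 := by
  refine MonoidHom.pi_ext fun i g => ?_
  rw [MonoidHom.one_apply]
  by_cases hi : n i = 0
  · have : g = 1 := by
      have : Subsingleton (Fin (n i + 1)) := by rw [hi]; exact Fin.subsingleton_one
      exact Subsingleton.elim _ _
    rw [this, Pi.mulSingle_one, map_one]
  · have : Nontrivial (Fin (n i + 1)) := Fin.nontrivial_iff_two_le.2 (by omega)
    exact DFunLike.congr_fun (Matrix.SpecialLinearGroup.monoidHom_eq_one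
      (χ.comp (MonoidHom.mulSingle
        (fun i => Matrix.SpecialLinearGroup (Fin (n i + 1)) ℂ) i))) g

namespace MultiProj

variable {t : ℕ} {n : Fin t → ℕ}

/-! ### Linearizations -/

lemma polyAction_eq_linSub (g : SLProd n) (P : MvPolynomial (Idx n) ℂ) :
    polyAction n g P = linSub (fun i => ((g i)⁻¹ : Matrix.SpecialLinearGroup _ ℂ).1) P := by
  have : polyAction n g = linSub (fun i => ((g i)⁻¹ : Matrix.SpecialLinearGroup _ ℂ).1) := by
    apply MvPolynomial.algHom_ext
    intro p
    rw [linSub_X]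
    refine (MvPolynomial.aeval_X _ p).trans (Finset.sum_congr rfl fun l _ => ?_)
    rw [MvPolynomial.smul_eq_C_mul]
  rw [this]

lemma bigFieldAction_x_div_mem (g : SLProd n) (p : Idx n) (k : Fin (n p.1 + 1)) :
    bigFieldAction n g (x n p) / x n ⟨p.1, k⟩ ∈ functionField n := by
  rw [bigFieldAction_x]
  exact linear_div_mem n p.1 k _

/-- The function `g x_{i,k} / x_{i, J i}`. -/
def actionCoord (g : SLProd n) (J : ∀ i, Fin (n i + 1)) (p : Idx n) : functionField n :=
  ⟨bigFieldAction n g (x n p) / x n ⟨p.1, J p.1⟩, bigFieldAction_x_div_mem g p _⟩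

lemma actionCoord_mem (g : SLProd n) (J : ∀ i, Fin (n i + 1)) (p : Idx n) :
    actionCoord g J p ∈ (multiProj n).chart J := by
  have : actionCoord g J p = ∑ l, ((g p.1)⁻¹ : Matrix.SpecialLinearGroup (Fin (n p.1 + 1)) ℂ).1 p.2 l •
      coord J ⟨p.1, l⟩ := by
    apply Subtype.ext
    change bigFieldAction n g (x n p) / x n ⟨p.1, J p.1⟩ = _
    rw [bigFieldAction_x, Finset.sum_div, ← IntermediateField.algebraMap_apply, map_sum]
    refine Finset.sum_congr rfl fun l _ => ?_
    rw [smul_div_assoc]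
    rfl
  rw [this]
  exact sum_mem fun l _ => Subalgebra.smul_mem _ (coord_mem_chart _ _) _

lemma actionCoord_ne_zero (g : SLProd n) (J : ∀ i, Fin (n i + 1)) (p : Idx n) :
    actionCoord g J p ≠ 0 := fun h =>
  div_ne_zero ((map_ne_zero _).2 (x_ne_zero n p)) (x_ne_zero n ⟨p.1, J p.1⟩)
    (congrArg Subtype.val h)

/-- Shows that `actionCoord g J' ⟨i, J i⟩` is invertible on the overlap of the translate of chart
`J` with chart `J'`. -/
lemma inv_actionCoord (g : SLProd n) (J J' : ∀ i, Fin (n i + 1)) (i : Fin t) :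
    (actionCoord g J' ⟨i, J i⟩)⁻¹ = action n g (actionCoord g⁻¹ J ⟨i, J' i⟩) := by
  apply Subtype.ext
  rw [coe_action]
  change (bigFieldAction n g (x n ⟨i, J i⟩) / x n ⟨i, J' i⟩)⁻¹ =
    bigFieldAction n g (bigFieldAction n g⁻¹ (x n ⟨i, J' i⟩) / x n ⟨i, J i⟩)
  rw [map_div₀, ← AlgEquiv.mul_apply, ← map_mul, mul_inv_cancel, map_one, AlgEquiv.one_apply,
    inv_div]

/-! ### The linearization by substitution in polynomials -/

section StandardLinearization

variable {M : (multiProj n).LineBundle} {u : BigField n} {a : Fin t → ℕ}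

/-- `u` itself need not have degree zero, but `u` times a monomial of multidegree `a` does; the
monomial and its transform contribute the ratios `actionCoord`. -/
lemma HasForm.div_action_mem (h : HasForm M u fun i => (a i : ℤ)) (g : SLProd n) :
    u / bigFieldAction n g u ∈ functionField n := by
  obtain ⟨w, hw, hwu, -⟩ := h fun _ => 0
  have h1 : u / bigFieldAction n g u = ((w / action n g w * ∏ i, actionCoord g (fun _ => 0) ⟨i, 0⟩ ^ a i :
      functionField n) : BigField n) := by
    have h2 : ((∏ i, actionCoord g (fun _ => 0) ⟨i, 0⟩ ^ a i : functionField n) : BigField n) =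
        ∏ i, (bigFieldAction n g (x n ⟨i, 0⟩) / x n ⟨i, 0⟩) ^ a i := by
      rw [← IntermediateField.algebraMap_apply, map_prod]
      rfl
    rw [IntermediateField.coe_mul, h2, IntermediateField.coe_div, coe_action, hwu, lm_lmOn]
    simp only [zpow_natCast, div_pow, Finset.prod_div_distrib, map_mul, map_prod, map_pow]
    have h3 : ∏ i, x n ⟨i, (0 : Fin (n i + 1))⟩ ^ a i ≠ 0 :=
      Finset.prod_ne_zero_iff.2 fun i _ => pow_ne_zero _ (x_ne_zero n _)
    have h4 : ∏ i, bigFieldAction n g (x n ⟨i, (0 : Fin (n i + 1))⟩) ^ a i ≠ 0 :=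
      Finset.prod_ne_zero_iff.2 fun i _ => pow_ne_zero _ ((map_ne_zero _).2 (x_ne_zero n _))
    have h5 : bigFieldAction n g u ≠ 0 := (map_ne_zero _).2 h.ne_zero
    field_simp
  rw [h1]
  exact Subtype.mem _

/-- The factor of automorphy of the linearization of `u · 𝒪(a)` for which the group acts on
sections through its action on polynomials. -/
def stdFactor (h : HasForm M u fun i => (a i : ℤ)) (g : SLProd n) : (functionField n)ˣ :=
  Units.mk0 ⟨u / bigFieldAction n g u, h.div_action_mem g⟩ fun h0 =>
    div_ne_zero h.ne_zero ((map_ne_zero _).2 h.ne_zero) (congrArg Subtype.val h0)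

lemma coe_stdFactor_mul (h : HasForm M u fun i => (a i : ℤ)) (g : SLProd n) {f : functionField n}
    {F : BigField n} (hf : (f : BigField n) = u * F) :
    ((stdFactor h g * action n g f : functionField n) : BigField n) = u * bigFieldAction n g F := by
  rw [IntermediateField.coe_mul, coe_action, hf, map_mul]
  change u / bigFieldAction n g u * (bigFieldAction n g u * bigFieldAction n g F) = _
  rw [← mul_assoc, div_mul_cancel₀ _ ((map_ne_zero _).2 h.ne_zero)]

lemma stdFactor_mul (h : HasForm M u fun i => (a i : ℤ)) (g g' : SLProd n) :
    (stdFactor h (g * g') : functionField n) = stdFactor h g * action n g (stdFactor h g') := by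
  apply Subtype.ext
  rw [IntermediateField.coe_mul, coe_action]
  change u / bigFieldAction n (g * g') u =
    u / bigFieldAction n g u * bigFieldAction n g (u / bigFieldAction n g' u)
  rw [map_div₀, map_mul, AlgEquiv.mul_apply, div_mul_div_cancel₀ ((map_ne_zero _).2 h.ne_zero)]

lemma stdFactor_overlap (h : HasForm M u fun i => (a i : ℤ)) (g : SLProd n)
    (J J' : ∀ i, Fin (n i + 1)) :
    Submodule.span (((multiProj n).chart J).map (action n g).toAlgHom
        ⊔ (multiProj n).chart J' : Subalgebra ℂ (functionField n))
      ((fun f => (stdFactor h g : functionField n) * action n g f) ''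
        (M.sectionsOn J : Set (functionField n))) =
    Submodule.span (((multiProj n).chart J).map (action n g).toAlgHom
        ⊔ (multiProj n).chart J' : Subalgebra ℂ (functionField n))
      (M.sectionsOn J' : Set (functionField n)) := by
  obtain ⟨w, hw, hwu, hM⟩ := h J
  obtain ⟨w', hw', hwu', hM'⟩ := h J'
  set B : Subalgebra ℂ (functionField n) := ((multiProj n).chart J).map (action n g).toAlgHom
        ⊔ (multiProj n).chart J' with hB
  have hleft : ∀ f ∈ (multiProj n).chart J, action n g f ∈ B := fun f hf =>
    (le_sup_left : ((multiProj n).chart J).map (action n g).toAlgHom ≤ B) ⟨f, hf, rfl⟩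
  have hright : (multiProj n).chart J' ≤ B := le_sup_right
  -- `r` is the ratio between the transformed generator of chart `J` and the generator of chart
  -- `J'`; it is a unit on the overlap.
  let r : functionField n := ∏ i, actionCoord g J' ⟨i, J i⟩ ^ a i
  have hr0 : r ≠ 0 := Finset.prod_ne_zero_iff.2 fun i _ => pow_ne_zero _ (actionCoord_ne_zero _ _ _)
  have hr : r ∈ B := prod_mem fun i _ => pow_mem (hright (actionCoord_mem g J' _)) _
  have hr' : r⁻¹ ∈ B := by
    rw [← Finset.prod_inv_distrib]
    refine prod_mem fun i _ => ?_
    rw [← inv_pow, inv_actionCoord]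
    exact pow_mem (hleft _ (actionCoord_mem _ _ _)) _
  have hrw : (stdFactor h g : functionField n) * action n g w = r * w' := by
    apply Subtype.ext
    have h2 : (r : BigField n) = ∏ i, (bigFieldAction n g (x n ⟨i, J i⟩) / x n ⟨i, J' i⟩) ^ a i := by
      rw [← IntermediateField.algebraMap_apply, map_prod]
      rfl
    rw [coe_stdFactor_mul h g hwu, IntermediateField.coe_mul, h2, hwu', lm_lmOn, lm_lmOn]
    simp only [zpow_natCast, div_pow, Finset.prod_div_distrib, map_prod, map_pow]
    have h3 : ∏ i, x n ⟨i, J' i⟩ ^ a i ≠ 0 :=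
      Finset.prod_ne_zero_iff.2 fun i _ => pow_ne_zero _ (x_ne_zero n _)
    field_simp
  rw [hM, hM', Variety.span_span_of_le hright]
  apply le_antisymm
  · rw [Submodule.span_le]
    rintro _ ⟨f, hf, rfl⟩
    obtain ⟨b, rfl⟩ := Submodule.mem_span_singleton.1 hf
    refine Submodule.mem_span_singleton.2 ⟨⟨action n g b * r, mul_mem (hleft _ b.2) hr⟩, ?_⟩
    change action n g b * r * w' = stdFactor h g * action n g (b * w)
    rw [map_mul, mul_left_comm, hrw, mul_assoc]
  · rw [Submodule.span_singleton_le_iff_mem]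
    have h3 : (⟨r⁻¹, hr'⟩ : B) • ((stdFactor h g : functionField n) * action n g w) = w' := by
      change r⁻¹ * ((stdFactor h g : functionField n) * action n g w) = w'
      rw [hrw, inv_mul_cancel_left₀ hr0]
    rw [← h3]
    exact Submodule.smul_mem _ _ (Submodule.subset_span ⟨w, Submodule.mem_span_singleton_self w, rfl⟩)

lemma stdFactor_mem_H0 (h : HasForm M u fun i => (a i : ℤ)) (g : SLProd n) {s : functionField n}
    (hs : s ∈ M.H0) : (stdFactor h g : functionField n) * action n g s ∈ M.H0 := by
  obtain ⟨P, hP, hPs⟩ := h.mem_H0_iff.1 hs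
  refine h.mem_H0_iff.2 ⟨polyAction n g P, ?_, ?_⟩
  · rw [polyAction_eq_linSub]
    exact isWeightedHomogeneous_linSub _ hP
  · rw [coe_stdFactor_mul h g hPs, bigFieldAction_algebraMap]

/-- The indices of the entries of a family of matrices. -/
abbrev Entry (n : Fin t → ℕ) : Type := Σ i : Fin t, Fin (n i + 1) × Fin (n i + 1)

/-- The family of matrices with indeterminate entries. -/
def genericMatrix (n : Fin t → ℕ) (i : Fin t) :
    Matrix (Fin (n i + 1)) (Fin (n i + 1)) (MvPolynomial (Entry n) ℂ) :=
  fun k l => MvPolynomial.X ⟨i, k, l⟩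

lemma isWeightedHomogeneous_map {R S : Type} [CommRing R] [CommRing S] (f : R →+* S)
    {P : MvPolynomial (Idx n) R} {a : Fin t → ℕ}
    (hP : MvPolynomial.IsWeightedHomogeneous (mdeg n) P a) :
    MvPolynomial.IsWeightedHomogeneous (mdeg n) (MvPolynomial.map f P) a := fun b hb => hP fun h0 =>
  hb (by rw [MvPolynomial.coeff_map, h0, map_zero])

lemma map_genericMatrix {R : Type} [CommRing R] (ev : MvPolynomial (Entry n) ℂ →+* R) (i : Fin t)
    (k l : Fin (n i + 1)) :
    (genericMatrix n i).map ev k l = ev (MvPolynomial.X ⟨i, k, l⟩) :=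
  rfl

lemma stdFactor_algebraic (h : HasForm M u fun i => (a i : ℤ)) {s : functionField n}
    (hs : s ∈ M.H0) (ℓ : Module.Dual ℂ (functionField n)) :
    ∃ F : MvPolynomial (Entry n) ℂ, ∀ g : SLProd n,
      ℓ ((stdFactor h g : functionField n) * action n g s) =
        MvPolynomial.eval (fun q => (g q.1).1 q.2.1 q.2.2) F := by
  classical
  obtain ⟨P, hP, hPs⟩ := h.mem_H0_iff.1 hs
  let R := MvPolynomial (Entry n) ℂ
  -- The adjugate is the inverse in determinant one and is polynomial in the entries.
  let Q : MvPolynomial (Idx n) R := linSub (fun i => (genericMatrix n i).adjugate)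
    (MvPolynomial.map MvPolynomial.C P)
  have hQ : MvPolynomial.IsWeightedHomogeneous (mdeg n) Q a :=
    isWeightedHomogeneous_linSub _ (isWeightedHomogeneous_map _ hP)
  -- `κ b` is the section with monomial `b`. The default value 0 plays no role, since the exponents
  -- in the support of `Q` have multidegree `a`.
  let κ : (Idx n →₀ ℕ) → functionField n := fun b =>
    if hb : u * algebraMap _ (BigField n) (MvPolynomial.monomial b (1 : ℂ)) ∈ functionField n
      then ⟨_, hb⟩ else 0
  have hκ : ∀ b ∈ Q.support, (κ b : BigField n) =
      u * algebraMap _ (BigField n) (MvPolynomial.monomial b (1 : ℂ)) := fun b hb => by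
    obtain ⟨w, hw, hwu, -⟩ := h fun _ => 0
    have hmem : u * algebraMap _ (BigField n) (MvPolynomial.monomial b (1 : ℂ)) ∈
        functionField n := by
      have hb' : MvPolynomial.IsWeightedHomogeneous (mdeg n) (MvPolynomial.monomial b (1 : ℂ)) a :=
        MvPolynomial.isWeightedHomogeneous_monomial _ _ _ (hQ (MvPolynomial.mem_support_iff.1 hb))
      rw [algebraMap_eq_aeval_coord_mul (fun _ => 0) hb', mul_left_comm, ← hwu]
      exact mul_mem (Subtype.mem _) (Subtype.mem _)
    simp only [κ, dif_pos hmem]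
  refine ⟨∑ b ∈ Q.support, MvPolynomial.coeff b Q * MvPolynomial.C (ℓ (κ b)), fun g => ?_⟩
  let ev : R →+* ℂ := MvPolynomial.eval fun q : Entry n => (g q.1).1 q.2.1 q.2.2
  have h1 : polyAction n g P = ∑ b ∈ Q.support,
      MvPolynomial.monomial b (ev (MvPolynomial.coeff b Q)) := by
    have h2 : polyAction n g P = MvPolynomial.map ev Q := by
      rw [map_linSub, MvPolynomial.map_map, polyAction_eq_linSub]
      have h3 : ev.comp MvPolynomial.C = RingHom.id ℂ := RingHom.ext fun c => MvPolynomial.eval_C c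
      rw [h3, MvPolynomial.map_id]
      congr 2
      funext i
      rw [Matrix.SpecialLinearGroup.coe_inv, ← RingHom.mapMatrix_apply, RingHom.map_adjugate]
      congr 1
      ext k l
      exact (MvPolynomial.eval_X (f := fun q : Entry n => (g q.1).1 q.2.1 q.2.2) ⟨i, k, l⟩).symm
    rw [h2]
    conv_lhs => rw [Q.as_sum, map_sum]
    exact Finset.sum_congr rfl fun b _ => MvPolynomial.map_monomial _ _ _
  have h4 : (stdFactor h g : functionField n) * action n g s =
      ∑ b ∈ Q.support, ev (MvPolynomial.coeff b Q) • κ b := by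
    apply Subtype.ext
    rw [coe_stdFactor_mul h g hPs, bigFieldAction_algebraMap, h1, map_sum, Finset.mul_sum,
      ← IntermediateField.algebraMap_apply, map_sum]
    refine Finset.sum_congr rfl fun b hb => ?_
    rw [algebraMap_monomial, mul_smul_comm, ← one_smul ℂ (lm n _), ← algebraMap_monomial, ← hκ b hb]
    rfl
  rw [h4, map_sum, map_sum]
  refine Finset.sum_congr rfl fun b _ => ?_
  rw [map_smul, map_mul, MvPolynomial.eval_C, smul_eq_mul]

/-- The linearization of `u · 𝒪(a)` for which the group acts on sections through its action on
polynomials. -/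
def stdLinearization (h : HasForm M u fun i => (a i : ℤ)) : Linearization M where
  factor := stdFactor h
  factor_mul := stdFactor_mul h
  overlap := stdFactor_overlap h
  map_H0 g _ hs := stdFactor_mem_H0 h g hs
  algebraic _ hs := stdFactor_algebraic h hs

end StandardLinearization

end MultiProj

namespace MultiProj

variable {t : ℕ} {n : Fin t → ℕ}

/-! ### Global sections as polynomials -/

/-- The exponents of the monomials of multidegree `a`. -/
abbrev Mono (n : Fin t → ℕ) (a : Fin t → ℕ) : Type :=
  {b : Idx n →₀ ℕ // Finsupp.weight (mdeg n) b = a}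

instance (a : Fin t → ℕ) : Finite (Mono n a) := by
  refine Set.Finite.subset (Set.finite_Icc 0 (Finsupp.equivFunOnFinite.symm fun p : Idx n => a p.1))
    fun b hb => ⟨zero_le, fun p => ?_⟩
  change b p ≤ a p.1
  rw [← congrFun hb p.1, weight_mdeg_apply]
  exact Finset.single_le_sum (f := fun k => b ⟨p.1, k⟩) (fun _ _ => Nat.zero_le _)
    (Finset.mem_univ p.2)

section Sections

variable {M : (multiProj n).LineBundle} {u : BigField n} {a : Fin t → ℕ}

lemma algebraMap_bigField_injective :
    Function.Injective (algebraMap (MvPolynomial (Idx n) ℂ) (BigField n)) :=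
  IsFractionRing.injective _ _

/-- The polynomial `P` such that a global section of `u · 𝒪(a)` is `u P`. -/
def toPoly (h : HasForm M u fun i => (a i : ℤ)) : M.H0 →ₗ[ℂ] MvPolynomial (Idx n) ℂ where
  toFun s := (h.mem_H0_iff.1 s.2).choose
  map_add' s s' := algebraMap_bigField_injective <| mul_left_cancel₀ h.ne_zero <| by
    rw [map_add, mul_add, ← (h.mem_H0_iff.1 s.2).choose_spec.2,
      ← (h.mem_H0_iff.1 s'.2).choose_spec.2, ← (h.mem_H0_iff.1 (s + s').2).choose_spec.2]
    rfl
  map_smul' c s := algebraMap_bigField_injective <| mul_left_cancel₀ h.ne_zero <| by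
    rw [RingHom.id_apply, MvPolynomial.smul_eq_C_mul, map_mul, mul_left_comm,
      ← (h.mem_H0_iff.1 s.2).choose_spec.2, ← (h.mem_H0_iff.1 (c • s).2).choose_spec.2]
    change c • ((s : functionField n) : BigField n) = _
    rw [Algebra.smul_def]
    rfl

variable (h : HasForm M u fun i => (a i : ℤ))

lemma coe_eq_mul_toPoly (s : M.H0) :
    ((s : functionField n) : BigField n) = u * algebraMap _ _ (toPoly h s) :=
  (h.mem_H0_iff.1 s.2).choose_spec.2

lemma isWeightedHomogeneous_toPoly (s : M.H0) :
    MvPolynomial.IsWeightedHomogeneous (mdeg n) (toPoly h s) a :=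
  (h.mem_H0_iff.1 s.2).choose_spec.1

lemma toPoly_eq_of_coe_eq {s : M.H0} {P : MvPolynomial (Idx n) ℂ}
    (hs : ((s : functionField n) : BigField n) = u * algebraMap _ _ P) : toPoly h s = P :=
  algebraMap_bigField_injective <| mul_left_cancel₀ h.ne_zero <| by rw [← coe_eq_mul_toPoly, hs]

lemma toPoly_injective : Function.Injective (toPoly h) := fun s s' hs =>
  Subtype.ext <| Subtype.ext <| by rw [coe_eq_mul_toPoly h, coe_eq_mul_toPoly h, hs]

lemma exists_toPoly_eq {P : MvPolynomial (Idx n) ℂ}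
    (hP : MvPolynomial.IsWeightedHomogeneous (mdeg n) P a) : ∃ s : M.H0, toPoly h s = P := by
  obtain ⟨w, hw, hwu, -⟩ := h fun _ => 0
  have hmem : u * algebraMap _ (BigField n) P ∈ functionField n := by
    rw [algebraMap_eq_aeval_coord_mul (fun _ => 0) hP, mul_left_comm, ← hwu]
    exact mul_mem (Subtype.mem _) (Subtype.mem _)
  exact ⟨⟨⟨_, hmem⟩, h.mem_H0_iff.2 ⟨P, hP, rfl⟩⟩, toPoly_eq_of_coe_eq h rfl⟩

/-- The coefficient of a monomial, as a linear form on global sections. -/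
def sectionCoeff (b : Mono n a) : Module.Dual ℂ M.H0 :=
  MvPolynomial.lcoeff ℂ b.1 ∘ₗ toPoly h

lemma sectionCoeff_apply (b : Mono n a) (s : M.H0) :
    sectionCoeff h b s = MvPolynomial.coeff b.1 (toPoly h s) :=
  rfl

lemma section_ext {s s' : M.H0} (hs : ∀ b, sectionCoeff h b s = sectionCoeff h b s') : s = s' := by
  refine toPoly_injective h (MvPolynomial.ext _ _ fun b => ?_)
  by_cases hb : Finsupp.weight (mdeg n) b = a
  · exact hs ⟨b, hb⟩
  · rw [(isWeightedHomogeneous_toPoly h s).coeff_eq_zero b hb,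
      (isWeightedHomogeneous_toPoly h s').coeff_eq_zero b hb]

include h in
lemma finiteDimensional_H0 : FiniteDimensional ℂ M.H0 :=
  FiniteDimensional.of_injective (LinearMap.pi (sectionCoeff h)) fun _ _ hs =>
    section_ext h fun b => congrFun hs b

/-! ### Uniqueness of the linearization -/

lemma Linearization.coe_rep (φ : Linearization M) (g : SLProd n) (s : M.H0) :
    (φ.rep g s : functionField n) = φ.factor g * action n g s :=
  rfl

/-- Applying ψ(g⁻¹) and then φ(g) multiplies sections by a rational function. On the
finite-dimensional space of sections it has an eigenvector, so this function is the eigenvalue. -/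
lemma Linearization.exists_factor_eq (φ ψ : Linearization M) (hM : M.H0 ≠ ⊥)
    [FiniteDimensional ℂ M.H0] (g : SLProd n) :
    ∃ c : ℂˣ, (φ.factor g : functionField n) = c.1 • (ψ.factor g : functionField n) := by
  have : Nontrivial M.H0 := Submodule.nontrivial_iff_ne_bot.2 hM
  obtain ⟨c, hc⟩ := Module.End.exists_eigenvalue (φ.rep g * ψ.rep g⁻¹)
  obtain ⟨s, hs⟩ := hc.exists_hasEigenvector
  have h0 : (s : functionField n) ≠ 0 := fun h0 => hs.2 (Subtype.ext h0)
  have h1 : (φ.factor g : functionField n) * action n g (ψ.factor g⁻¹ * action n g⁻¹ s) = c • s.1 :=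
    congrArg Subtype.val hs.apply_eq_smul
  rw [map_mul, ← AlgEquiv.mul_apply, ← map_mul, mul_inv_cancel, map_one, AlgEquiv.one_apply,
    ← mul_assoc, Algebra.smul_def] at h1
  have h2 : (ψ.factor g : functionField n) * action n g (ψ.factor g⁻¹) = 1 := by
    rw [← ψ.factor_mul, mul_inv_cancel, ψ.factor_one, Units.val_one]
  have h3 : (φ.factor g : functionField n) = c • (ψ.factor g : functionField n) := by
    rw [Algebra.smul_def, ← mul_right_cancel₀ h0 h1, mul_assoc, mul_comm (action n g _), h2, mul_one]
  refine ⟨Units.mk0 c fun hc0 => (φ.factor g).ne_zero ?_, h3⟩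
  rw [h3, hc0, zero_smul]

/-- The scalars relating two linearizations form a character of the group, which is trivial. -/
lemma Linearization.factor_eq (φ ψ : Linearization M) (hM : M.H0 ≠ ⊥)
    [FiniteDimensional ℂ M.H0] (g : SLProd n) :
    (φ.factor g : functionField n) = ψ.factor g := by
  choose c hc using φ.exists_factor_eq ψ hM
  let χ : SLProd n →* ℂˣ := MonoidHom.mk' c fun g g' => Units.ext <| by
    have h1 := φ.factor_mul g g'
    have h2 : ∀ (z : ℂ) f, action n g (z • f) = z • action n g f := fun z f => by
      rw [Algebra.smul_def, map_mul, AlgEquiv.commutes, ← Algebra.smul_def]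
    rw [hc, hc, hc, ψ.factor_mul, h2, smul_mul_smul_comm] at h1
    exact smul_left_injective ℂ (mul_ne_zero (ψ.factor g).ne_zero
      ((map_ne_zero (action n g)).2 (ψ.factor g').ne_zero)) h1
  rw [hc, show c g = 1 from DFunLike.congr_fun (monoidHom_eq_one χ) g, Units.val_one, one_smul]

lemma toPoly_rep (φ : Linearization M) (hM : M.H0 ≠ ⊥) (g : SLProd n) (s : M.H0) :
    toPoly h (φ.rep g s) =
      linSub (fun i => ((g i)⁻¹ : Matrix.SpecialLinearGroup _ ℂ).1) (toPoly h s) := by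
  have := finiteDimensional_H0 h
  apply toPoly_eq_of_coe_eq
  rw [← polyAction_eq_linSub, Linearization.coe_rep, φ.factor_eq (stdLinearization h) hM]
  exact (coe_stdFactor_mul h g (coe_eq_mul_toPoly h s)).trans
    (by rw [bigFieldAction_algebraMap])

end Sections

/-! ### The orbit morphism is finite -/

/-- The ideal of the product of special linear groups in the space of families of matrices. -/
def detIdeal (n : Fin t → ℕ) : Ideal (MvPolynomial (Entry n) ℂ) :=
  Ideal.span (Set.range fun i => (genericMatrix n i).det - 1)

/-- A coefficient of the polynomial obtained from `Q` by a generic linear substitution. -/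
def orbitCoeff (Q : MvPolynomial (Idx n) ℂ) (b : Idx n →₀ ℕ) : MvPolynomial (Entry n) ℂ :=
  MvPolynomial.coeff b (linSub (genericMatrix n) (MvPolynomial.map MvPolynomial.C Q))

lemma map_orbitCoeff {R : Type} [CommRing R] (ev : MvPolynomial (Entry n) ℂ →+* R)
    (Q : MvPolynomial (Idx n) ℂ) (b : Idx n →₀ ℕ) :
    ev (orbitCoeff Q b) = MvPolynomial.coeff b (linSub (fun i => (genericMatrix n i).map ev)
      (MvPolynomial.map (ev.comp MvPolynomial.C) Q)) := by
  rw [orbitCoeff, ← MvPolynomial.coeff_map, map_linSub, MvPolynomial.map_map]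

lemma eval_orbitCoeff (v : Entry n → ℂ) (Q : MvPolynomial (Idx n) ℂ) (b : Idx n →₀ ℕ) :
    MvPolynomial.eval v (orbitCoeff Q b) =
      MvPolynomial.coeff b (linSub (fun i => Matrix.of fun k l => v ⟨i, k, l⟩) Q) := by
  have h1 : (MvPolynomial.eval v).comp MvPolynomial.C = RingHom.id ℂ :=
    RingHom.ext fun c => MvPolynomial.eval_C c
  have h2 : (fun i => (genericMatrix n i).map (MvPolynomial.eval v)) =
      fun i => Matrix.of fun k l => v ⟨i, k, l⟩ := by
    funext i
    ext k l
    rw [map_genericMatrix, MvPolynomial.eval_X, Matrix.of_apply]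
  rw [map_orbitCoeff, h1, MvPolynomial.map_id, h2]

lemma eval_eq_zero_of_mem_detIdeal_iff (v : Entry n → ℂ) :
    (∀ f ∈ detIdeal n, MvPolynomial.eval v f = 0) ↔
      ∀ i, (Matrix.of fun k l => v ⟨i, k, l⟩ : Matrix (Fin (n i + 1)) (Fin (n i + 1)) ℂ).det = 1 := by
  have h1 : ∀ i, MvPolynomial.eval v ((genericMatrix n i).det - 1) =
      (Matrix.of fun k l => v ⟨i, k, l⟩ : Matrix (Fin (n i + 1)) (Fin (n i + 1)) ℂ).det - 1 := fun i => by
    rw [map_sub, map_one, RingHom.map_det]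
    congr 2
    ext k l
    exact MvPolynomial.eval_X (f := v) ⟨i, k, l⟩
  constructor
  · intro h i
    rw [← sub_eq_zero, ← h1]
    exact h _ (Ideal.subset_span ⟨i, rfl⟩)
  · intro h f hf
    have : detIdeal n ≤ RingHom.ker (MvPolynomial.eval v) := by
      refine Ideal.span_le.2 ?_
      rintro _ ⟨i, rfl⟩
      exact (h1 i).trans (sub_eq_zero.2 (h i))
    exact this hf

/-- A non-integral matrix entry would yield, by the valuative criterion, matrices over a valued
field contradicting `mem_of_coeff_linSub_mem`. -/
lemma _root_.IsTransversal.isFiniteMorphism {m : ℕ} {Q : Fin m → MvPolynomial (Idx n) ℂ}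
    {a : Fin m → Fin t → ℕ} (hQ : IsTransversal Q)
    (ha : ∀ j, MvPolynomial.IsWeightedHomogeneous (mdeg n) (Q j) (a j))
    (hdeg : ∀ i, n i ≠ 0 → n i + 2 ≤ ∑ j, a j i) :
    IsFiniteMorphism (detIdeal n) fun b : Mono n (∑ j, a j) => orbitCoeff (∏ j, Q j) b.1 := by
  rintro ⟨i, k, l⟩
  by_contra hint
  let A := MvPolynomial (Entry n) ℂ ⧸ detIdeal n
  let θ : MvPolynomial (Mono n (∑ j, a j)) ℂ →+* A := (MvPolynomial.aeval (R := ℂ)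
    (fun b : Mono n (∑ j, a j) => Ideal.Quotient.mk (detIdeal n) (orbitCoeff (∏ j, Q j) b.1))).toRingHom
  let _ : Algebra (MvPolynomial (Mono n (∑ j, a j)) ℂ) A := θ.toAlgebra
  obtain ⟨F, _, ψ, O, hO, hx⟩ := exists_valuationSubring_of_not_isIntegral
    (R := MvPolynomial (Mono n (∑ j, a j)) ℂ) (A := A) hint
  let _ : Algebra ℂ F := (ψ.comp (algebraMap ℂ A)).toAlgebra
  let ev : MvPolynomial (Entry n) ℂ →+* F := ψ.comp (Ideal.Quotient.mk (detIdeal n))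
  have hev : ev.comp MvPolynomial.C = algebraMap ℂ F := rfl
  refine hx (mem_of_coeff_linSub_mem hQ ha hdeg O (fun c => ?_)
    (fun i => (genericMatrix n i).map ev) (fun i => ?_) (fun b => ?_) i k l)
  · have h1 : θ (MvPolynomial.C c) = algebraMap ℂ A c := MvPolynomial.algHom_C _ _
    have h2 : algebraMap ℂ F c = ψ (θ (MvPolynomial.C c)) := by rw [h1]; rfl
    rw [h2]
    exact hO (MvPolynomial.C c)
  · have h1 : ev (genericMatrix n i).det = 1 := by
      rw [← sub_eq_zero, ← map_one ev, ← map_sub]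
      change ψ _ = 0
      have h2 : (genericMatrix n i).det - 1 ∈ detIdeal n := Ideal.subset_span ⟨i, rfl⟩
      exact (congrArg ψ (Ideal.Quotient.eq_zero_iff_mem.2 h2)).trans (map_zero ψ)
    rw [← h1, RingHom.map_det]
    rfl
  · rw [← hev, ← map_orbitCoeff]
    by_cases hb : Finsupp.weight (mdeg n) b = ∑ j, a j
    · have h1 : θ (MvPolynomial.X ⟨b, hb⟩) = Ideal.Quotient.mk (detIdeal n) (orbitCoeff (∏ j, Q j) b) :=
        MvPolynomial.aeval_X _ _
      have h2 : ev (orbitCoeff (∏ j, Q j) b) = ψ (θ (MvPolynomial.X ⟨b, hb⟩)) := by rw [h1]; rfl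
      rw [h2]
      exact hO _
    · have h1 : MvPolynomial.IsWeightedHomogeneous (mdeg n) (∏ j, Q j) (∑ j, a j) :=
        MvPolynomial.IsWeightedHomogeneous.prod _ _ _ fun j _ => ha j
      have h2 : orbitCoeff (∏ j, Q j) b = 0 :=
        (isWeightedHomogeneous_linSub _ (isWeightedHomogeneous_map _ h1)).coeff_eq_zero b hb
      rw [h2, map_zero]
      exact O.zero_mem

/-! ### Stability -/

section Stability

variable {M : (multiProj n).LineBundle} {u : BigField n} {a : Fin t → ℕ}

/-- The entries of the inverse of an element of the group. -/
def invEntry (g : SLProd n) (q : Entry n) : ℂ :=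
  ((g q.1)⁻¹ : Matrix.SpecialLinearGroup (Fin (n q.1 + 1)) ℂ).1 q.2.1 q.2.2

lemma invEntry_injective : Function.Injective (invEntry (n := n)) := fun g g' hg => by
  funext i
  refine inv_injective (Subtype.ext (Matrix.ext fun k l => ?_))
  exact congrFun hg ⟨i, k, l⟩

lemma exists_invEntry_eq (v : Entry n → ℂ)
    (hv : ∀ f ∈ detIdeal n, MvPolynomial.eval v f = 0) : ∃ g, invEntry g = v := by
  rw [eval_eq_zero_of_mem_detIdeal_iff] at hv
  let g : SLProd n := fun i => ⟨_, hv i⟩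
  refine ⟨g⁻¹, ?_⟩
  funext q
  rw [invEntry, Pi.inv_apply, inv_inv]
  rfl

lemma eval_invEntry_of_mem_detIdeal (g : SLProd n) :
    ∀ f ∈ detIdeal n, MvPolynomial.eval (invEntry g) f = 0 :=
  (eval_eq_zero_of_mem_detIdeal_iff _).2 fun i => (g i)⁻¹.2

/-- The group acts through inverse matrices, so the orbit is parametrized by `invEntry`; inversion
is a bijection and changes neither image nor finiteness of fibres. -/
lemma sectionCoeff_rep (h : HasForm M u fun i => (a i : ℤ)) (φ : Linearization M) (hM : M.H0 ≠ ⊥)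
    (g : SLProd n) (s : M.H0) (b : Mono n a) :
    sectionCoeff h b (φ.rep g s) =
      MvPolynomial.eval (invEntry g) (orbitCoeff (toPoly h s) b.1) := by
  rw [sectionCoeff_apply, toPoly_rep h φ hM, eval_orbitCoeff]
  rfl

/-- The orbit is the image of the orbit morphism, hence closed, and the stabilizer corresponds to
the fibre over `w`. -/
lemma isGITStable_of_isFiniteMorphism (h : HasForm M u fun i => (a i : ℤ)) (φ : Linearization M)
    {w : M.H0} (hw : w ≠ 0)
    (hfin : IsFiniteMorphism (detIdeal n) fun b : Mono n a => orbitCoeff (toPoly h w) b.1) :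
    IsGITStable φ.rep w := by
  have hM : M.H0 ≠ ⊥ := (Submodule.ne_bot_iff _).2 ⟨w, w.2, fun h0 => hw (Subtype.ext h0)⟩
  refine ⟨hw, ⟨{F | ∀ g, evalAt F (φ.rep g w) = 0}, ?_⟩, ?_⟩
  · ext v
    constructor
    · rintro ⟨g, rfl⟩ F hF
      exact hF g
    · intro hv
      -- A relation between the components of the orbit morphism vanishes on the orbit, hence at
      -- `v`.
      obtain ⟨x, hx, hxv⟩ := hfin.exists_preimage (fun b => sectionCoeff h b v) fun P hP => by
        have h1 : ∀ v' : M.H0, evalAt (MvPolynomial.rename (sectionCoeff h) P) v' =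
            MvPolynomial.eval (fun b => sectionCoeff h b v') P := fun v' =>
          MvPolynomial.eval_rename _ _ _
        rw [← h1]
        refine hv _ fun g => ?_
        rw [h1, ← eval_invEntry_of_mem_detIdeal g _ hP]
        simp only [sectionCoeff_rep h φ hM, ← MvPolynomial.coe_aeval_eq_eval, RingHom.coe_coe]
        exact (MvPolynomial.comp_aeval_apply _ (MvPolynomial.aeval (invEntry g)) P).symm
      obtain ⟨g, rfl⟩ := exists_invEntry_eq x hx
      exact ⟨g, section_ext h fun b => (sectionCoeff_rep h φ hM g w b).trans (hxv b)⟩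
  · refine Set.Finite.of_finite_image (f := invEntry) ?_ invEntry_injective.injOn
    refine (hfin.finite_fiber fun b => sectionCoeff h b w).subset ?_
    rintro _ ⟨g, hg, rfl⟩
    refine ⟨eval_invEntry_of_mem_detIdeal g, fun b => ?_⟩
    rw [← sectionCoeff_rep h φ hM, show φ.rep g w = w from hg]

end Stability

end MultiProj

namespace MultiProj

variable {t : ℕ} {n : Fin t → ℕ} {m : ℕ}

/-! ### Generic tuples of sections -/

lemma exists_eval_ne_zero {β : Type} {F : MvPolynomial β ℂ} (hF : F ≠ 0) :
    ∃ c : β → ℂ, MvPolynomial.eval c F ≠ 0 := by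
  by_contra! h
  exact hF (MvPolynomial.funext fun c => by rw [h c, map_zero])

/-- Base point freeness: powers of one nonvanishing coordinate per factor suffice. -/
lemma exists_monomial_ne_zero (a : Fin t → ℕ) {κ : Type} [Field κ] [Algebra ℂ κ] (p : Idx n → κ)
    (hp : ∀ i, ∃ k, p ⟨i, k⟩ ≠ 0) :
    ∃ b : Mono n a, MvPolynomial.aeval p (MvPolynomial.monomial b.1 (1 : ℂ)) ≠ 0 := by
  choose k hk using hp
  refine ⟨⟨Finsupp.equivFunOnFinite.symm fun q : Idx n => if q.2 = k q.1 then a q.1 else 0, ?_⟩, ?_⟩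
  · funext i
    rw [weight_mdeg_apply]
    simp
  · rw [MvPolynomial.aeval_monomial, map_one, one_mul]
    refine Finset.prod_ne_zero_iff.2 fun q hq => pow_ne_zero _ ?_
    have h1 : q.2 = k q.1 := by
      by_contra h1
      exact (Finsupp.mem_support_iff.1 hq) (if_neg h1)
    have := hk q.1
    rwa [← h1] at this

lemma isTransversal_of_C_mul {Q : Fin m → MvPolynomial (Idx n) ℂ} {r : Fin m → ℂ}
    (hr : ∀ j, r j ≠ 0) (hQ : IsTransversal fun j => MvPolynomial.C (r j) * Q j) :
    IsTransversal Q := fun κ _ _ p lam hp h1 h2 => by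
  have hr' : ∀ j, algebraMap ℂ κ (r j) ≠ 0 := fun j => (map_ne_zero _).2 (hr j)
  have h3 := hQ κ p (fun j => lam j * (algebraMap ℂ κ (r j))⁻¹) hp (fun j => ?_) fun q => ?_
  · funext j
    exact (mul_eq_zero.1 (congrFun h3 j)).resolve_right (inv_ne_zero (hr' j))
  · rw [map_mul, MvPolynomial.aeval_C, mul_assoc, inv_mul_cancel_left₀ (hr' j), h1]
  · rw [← h2 q]
    refine Finset.sum_congr rfl fun j _ => ?_
    rw [MvPolynomial.pderiv_C_mul, map_mul, MvPolynomial.aeval_C, mul_assoc,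
      inv_mul_cancel_left₀ (hr' j)]

/-- If a multihomogeneous component of `D` does not vanish at `c`, then `D` does not vanish at some
multiple of `c`. -/
lemma exists_eval_mul_ne_zero {β : Type} (σ : β → Fin m) (D : MvPolynomial β ℂ) (c : β → ℂ)
    (e : Fin m → ℕ)
    (h : MvPolynomial.eval c (MvPolynomial.weightedHomogeneousComponent
      (fun b => (Pi.single (σ b) 1 : Fin m → ℕ)) e D) ≠ 0) :
    ∃ r : Fin m → ℂ, (∀ j, r j ≠ 0) ∧ MvPolynomial.eval (fun b => r (σ b) * c b) D ≠ 0 := by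
  classical
  set w : β → Fin m → ℕ := fun b => Pi.single (σ b) 1 with hw
  let A := MvPolynomial (Fin m) ℂ
  -- Scaling `c` by indeterminates sends the multihomogeneous components of `D` to distinct
  -- monomials, so they cannot cancel.
  let p : MvPolynomial β ℂ →ₐ[ℂ] A := MvPolynomial.aeval fun b =>
    MvPolynomial.X (σ b) * MvPolynomial.C (c b)
  have hp : ∀ e', p (MvPolynomial.weightedHomogeneousComponent w e' D) = MvPolynomial.monomial
      (Finsupp.equivFunOnFinite.symm e')
      (MvPolynomial.eval c (MvPolynomial.weightedHomogeneousComponent w e' D)) := fun e' => by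
    refine (aeval_mul_of_isWeightedHomogeneous σ
      (MvPolynomial.weightedHomogeneousComponent_isWeightedHomogeneous e' D) _ _).trans ?_
    rw [MvPolynomial.monomial_eq, mul_comm, Finsupp.prod_fintype _ _ (by simp)]
    congr 1
    exact (MvPolynomial.comp_aeval_apply c (Algebra.ofId ℂ A) _).symm
  have hp0 : p D ≠ 0 := fun h0 => h <| by
    have h1 := congrArg (MvPolynomial.coeff (Finsupp.equivFunOnFinite.symm e)) h0
    rw [← MvPolynomial.sum_weightedHomogeneousComponent w D,
      finsum_eq_sum _ (MvPolynomial.weightedHomogeneousComponent_finsupp D), map_sum,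
      MvPolynomial.coeff_sum, MvPolynomial.coeff_zero] at h1
    simp only [hp, MvPolynomial.coeff_monomial, EmbeddingLike.apply_eq_iff_eq,
      Finset.sum_ite_eq'] at h1
    by_contra h2
    rw [if_pos] at h1
    · exact h2 h1
    · exact (Set.Finite.mem_toFinset _).2 fun h3 =>
        h2 ((congrArg _ h3).trans (map_zero _))
  -- The extra factor ∏ X_j makes every `r j` nonzero.
  obtain ⟨r, hr⟩ := exists_eval_ne_zero (mul_ne_zero hp0
    (Finset.prod_ne_zero_iff.2 fun j (_ : j ∈ Finset.univ) => MvPolynomial.X_ne_zero (R := ℂ) j))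
  rw [map_mul, map_prod, mul_ne_zero_iff, Finset.prod_ne_zero_iff] at hr
  refine ⟨r, fun j => ?_, ?_⟩
  · have := hr.2 j (Finset.mem_univ j)
    rwa [MvPolynomial.eval_X] at this
  · have h1 : MvPolynomial.eval r (p D) = MvPolynomial.eval (fun b => r (σ b) * c b) D := by
      refine (MvPolynomial.comp_aeval_apply _ (MvPolynomial.aeval r) D).trans ?_
      simp only [map_mul, MvPolynomial.aeval_X, MvPolynomial.algHom_C]
      rfl
    rw [← h1]
    exact hr.1

lemma isWeightedHomogeneous_rename {β γ Γ : Type} [AddCommMonoid Γ] (f : β → γ) (w : γ → Γ)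
    {F : MvPolynomial β ℂ} {e : Γ} (hF : MvPolynomial.IsWeightedHomogeneous (fun b => w (f b)) F e) :
    MvPolynomial.IsWeightedHomogeneous w (MvPolynomial.rename f F) e := by
  classical
  rw [F.as_sum, map_sum]
  refine MvPolynomial.IsWeightedHomogeneous.sum _ _ _ fun b hb => ?_
  rw [MvPolynomial.rename_monomial]
  refine MvPolynomial.isWeightedHomogeneous_monomial _ _ _ ?_
  rw [← hF (MvPolynomial.mem_support_iff.1 hb), Finsupp.weight_apply, Finsupp.weight_apply,
    Finsupp.sum_mapDomain_index (by simp) (by simp [add_smul])]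

/-! ### The open set of transversal tuples of sections -/

section Generic

variable {T : Fin m → (multiProj n).LineBundle} {u : Fin m → BigField n} {a : Fin m → Fin t → ℕ}

lemma specialForm_sectionCoeff [∀ j, Fintype (Mono n (a j))] (h : ∀ j, HasForm (T j) (u j) fun i => (a j i : ℤ))
    (s : ∀ j, (T j).H0) (r : Fin m → ℂ) (j : Fin m) :
    specialForm (Sigma.fst : (Σ j, Mono n (a j)) → Fin m)
      (fun b => MvPolynomial.monomial b.2.1 1)
      (fun b => r b.1 * sectionCoeff (h b.1) b.2 (s b.1)) j =
      MvPolynomial.C (r j) * toPoly (h j) (s j) := by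
  classical
  rw [specialForm, Fintype.sum_sigma, Finset.sum_eq_single j]
  · simp only [if_true, map_mul, mul_assoc, ← Finset.mul_sum]
    congr 1
    refine MvPolynomial.ext _ _ fun b => ?_
    simp only [MvPolynomial.coeff_sum, MvPolynomial.coeff_C_mul, MvPolynomial.coeff_monomial,
      sectionCoeff_apply, mul_ite, mul_one, mul_zero]
    by_cases hb : Finsupp.weight (mdeg n) b = a j
    · rw [Finset.sum_eq_single (⟨b, hb⟩ : Mono n (a j))]
      · simp
      · intro b' _ hb'
        exact if_neg fun h0 => hb' (Subtype.ext h0)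
      · simp
    · rw [(isWeightedHomogeneous_toPoly (h j) (s j)).coeff_eq_zero b hb]
      exact Finset.sum_eq_zero fun b' _ => if_neg fun (h0 : b'.1 = b) => hb (h0 ▸ b'.2)
  · intro j' _ hj'
    exact Finset.sum_eq_zero fun b _ => if_neg hj'
  · simp

/-- The Bertini polynomial `D` need not be multihomogeneous, so it is replaced by a nonzero
component. Where this does not vanish, `D` does not vanish at some rescaling of the forms, and
transversality is unaffected by rescaling. -/
lemma exists_isZariskiOpenProd_isTransversal (h : ∀ j, HasForm (T j) (u j) fun i => (a j i : ℤ)) :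
    ∃ U : Set (∀ j, Projectivization ℂ (T j).H0), U.Nonempty ∧ IsZariskiOpenProd U ∧
      ∀ (s : ∀ j, (T j).H0) (hs : ∀ j, s j ≠ 0),
        (fun j => Projectivization.mk ℂ (s j) (hs j)) ∈ U →
        IsTransversal fun j => toPoly (h j) (s j) := by
  classical
  have : ∀ j, Fintype (Mono n (a j)) := fun j => Fintype.ofFinite _
  let β := Σ j, Mono n (a j)
  obtain ⟨D, hD, hDt⟩ := exists_polynomial_isTransversal (n := n) (Sigma.fst : β → Fin m)
    (fun b => MvPolynomial.monomial b.2.1 1) fun κ _ _ p hp j => by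
      obtain ⟨b, hb⟩ := exists_monomial_ne_zero (a j) p hp
      exact ⟨⟨j, b⟩, rfl, hb⟩
  let w : β → Fin m → ℕ := fun b => Pi.single b.1 1
  obtain ⟨e, he⟩ : ∃ e, MvPolynomial.weightedHomogeneousComponent w e D ≠ 0 := by
    by_contra! h0
    exact hD (by rw [← MvPolynomial.sum_weightedHomogeneousComponent w D]; simp only [h0, finsum_zero])
  set De := MvPolynomial.weightedHomogeneousComponent w e D with hDe
  have hDew : MvPolynomial.IsWeightedHomogeneous w De e :=
    MvPolynomial.weightedHomogeneousComponent_isWeightedHomogeneous e D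
  let f : β → Σ j, Module.Dual ℂ (T j).H0 := fun b => ⟨b.1, sectionCoeff (h b.1) b.2⟩
  let F := MvPolynomial.rename f De
  let co : (∀ j, (T j).H0) → β → ℂ := fun s b => sectionCoeff (h b.1) b.2 (s b.1)
  have hF : ∀ s : ∀ j, (T j).H0, MvPolynomial.eval (fun q : Σ j, Module.Dual ℂ (T j).H0 =>
      q.2 (s q.1)) F = MvPolynomial.eval (co s) De := fun s =>
    MvPolynomial.eval_rename _ _ _
  have hscale : ∀ (s : ∀ j, (T j).H0) (r : Fin m → ℂ), (∀ j, r j ≠ 0) →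
      (MvPolynomial.eval (co s) De ≠ 0 ↔ MvPolynomial.eval (co fun j => r j • s j) De ≠ 0) :=
    fun s r hr => by
      have h1 : co (fun j => r j • s j) = fun b => r b.1 * co s b := by
        funext b
        exact map_smul _ _ _
      have h2 : MvPolynomial.eval (fun b => r b.1 * co s b) De =
          (∏ j, r j ^ e j) * MvPolynomial.eval (co s) De :=
        aeval_mul_of_isWeightedHomogeneous Sigma.fst hDew r (co s)
      rw [h1, h2, mul_ne_zero_iff, and_iff_right]
      exact Finset.prod_ne_zero_iff.2 fun j _ => pow_ne_zero _ (hr j)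
  have hrep : ∀ (s : ∀ j, (T j).H0) (hs : ∀ j, s j ≠ 0), MvPolynomial.eval
      (fun q : Σ j, Module.Dual ℂ (T j).H0 =>
        q.2 (Projectivization.mk ℂ (s q.1) (hs q.1)).rep) F ≠ 0 ↔
      MvPolynomial.eval (co s) De ≠ 0 := fun s hs => by
    choose r hr using fun j => Projectivization.exists_smul_eq_mk_rep ℂ (s j) (hs j)
    rw [hscale s (fun j => r j) fun j => (r j).ne_zero,
      hF fun j => (Projectivization.mk ℂ (s j) (hs j)).rep]
    simp only [← hr]
    rfl
  refine ⟨{x | ∃ F' ∈ ({F} : Set (MvPolynomial (Σ j, Module.Dual ℂ (T j).H0) ℂ)),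
    MvPolynomial.eval (fun q => q.2 (x q.1).rep) F' ≠ 0}, ?_, ⟨{F}, ?_, rfl⟩, ?_⟩
  · choose b hb using fun j => exists_monomial_ne_zero (n := n) (κ := ℂ) (a j) 1
      fun _ => ⟨0, one_ne_zero⟩
    -- One coefficient of each form is also required to be nonzero, so that each section defines a
    -- point of a projective space.
    obtain ⟨c, hc⟩ := exists_eval_ne_zero (mul_ne_zero he (Finset.prod_ne_zero_iff.2
      fun j (_ : j ∈ Finset.univ) => MvPolynomial.X_ne_zero (R := ℂ) (⟨j, b j⟩ : β)))
    rw [map_mul, map_prod, mul_ne_zero_iff, Finset.prod_ne_zero_iff] at hc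
    choose s hs using fun j => exists_toPoly_eq (h j)
      (P := ∑ b : Mono n (a j), MvPolynomial.monomial b.1 (c ⟨j, b⟩))
      (MvPolynomial.IsWeightedHomogeneous.sum _ _ _ fun b _ =>
        MvPolynomial.isWeightedHomogeneous_monomial _ _ _ b.2)
    have hco : co s = c := by
      funext ⟨j, b⟩
      change MvPolynomial.coeff b.1 (toPoly (h j) (s j)) = _
      rw [hs, MvPolynomial.coeff_sum, Finset.sum_eq_single b]
      · rw [MvPolynomial.coeff_monomial, if_pos rfl]
      · intro b' _ hb'
        rw [MvPolynomial.coeff_monomial, if_neg fun h0 => hb' (Subtype.ext h0)]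
      · simp
    have hs0 : ∀ j, s j ≠ 0 := fun j h0 => by
      refine hc.2 j (Finset.mem_univ j) ?_
      rw [MvPolynomial.eval_X, ← hco]
      change sectionCoeff (h j) (b j) (s j) = 0
      rw [h0, map_zero]
    exact ⟨fun j => Projectivization.mk ℂ (s j) (hs0 j), F, rfl, (hrep s hs0).2 (hco ▸ hc.1)⟩
  · rintro _ rfl
    exact ⟨e, isWeightedHomogeneous_rename f _ hDew⟩
  · rintro s hs ⟨_, rfl, hU⟩
    obtain ⟨r, hr, hrD⟩ := exists_eval_mul_ne_zero Sigma.fst D (co s) e ((hrep s hs).1 hU)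
    refine isTransversal_of_C_mul hr ?_
    convert hDt _ hrD using 2 with j
    exact (specialForm_sectionCoeff h s r _).symm

end Generic

end MultiProj

/-! ### Comparison of multidegrees and conclusion -/

namespace MultiProj

variable {t : ℕ} {n : Fin t → ℕ} {m : ℕ}

lemma exists_principal_mul_eq {K : Type} [Field K] [Algebra ℂ K] {Z : Variety K}
    {M N : Z.LineBundle} (h : M.cls = N.cls) : ∃ c, Z.principal c * M = N := by
  obtain ⟨c, hc⟩ := QuotientGroup.eq.1 h
  exact ⟨c, by rw [hc, mul_comm, mul_inv_cancel_left]⟩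

lemma cls_mul {K : Type} [Field K] [Algebra ℂ K] {Z : Variety K} (M N : Z.LineBundle) :
    (M * N).cls = M.cls * N.cls :=
  rfl

lemma cls_pow {K : Type} [Field K] [Algebra ℂ K] {Z : Variety K} (M : Z.LineBundle) (d : ℕ) :
    (M ^ d).cls = M.cls ^ d :=
  rfl

lemma cls_one {K : Type} [Field K] [Algebra ℂ K] {Z : Variety K} :
    (1 : Z.LineBundle).cls = 1 :=
  rfl

section

variable {d : ℕ} {L : (multiProj n).LineBundle} {T : Fin m → (multiProj n).LineBundle}
  {u : Fin m → BigField n} {a : Fin m → Fin t → ℕ}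

/-- A tuple of multidegrees which adds up to `d L`, where `-K = (d - 1) L`, adds up to more than
the anticanonical multidegree. -/
lemma add_two_le_sum_multidegree (hd : 2 ≤ d) (hT : (∏ j, T j).cls = L.cls ^ d)
    (hK : (multiProj n).AnticanonicalEq d L) (h : ∀ j, HasForm (T j) (u j) fun i => (a j i : ℤ))
    {i : Fin t} (hi : n i ≠ 0) : n i + 2 ≤ ∑ j, a j i := by
  obtain ⟨v, l, -, hL⟩ := exists_hasForm L
  obtain ⟨M, hM, hML⟩ := hK
  obtain ⟨v', hM⟩ := HasForm.of_isCanonical hM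
  obtain ⟨c, hc⟩ := exists_principal_mul_eq (M := L ^ (d - 1) * M) (N := 1) (by
    rw [cls_mul, cls_pow, ← hML, inv_mul_cancel, cls_one])
  obtain ⟨c', hc'⟩ := exists_principal_mul_eq (M := ∏ j, T j) (N := L ^ d) hT
  -- With `l` the multidegree of `L`, `h1` says (d-1) l i = n i + 1 and `h2` says that the total
  -- degree is d · l i. The difference l i is positive, whence the bound n i + 2.
  have h1 := (hc ▸ (HasForm.principal c).mul ((hL.pow (d - 1)).mul hM)).eq_of_ne_zero HasForm.one hi
  have h2 := (hc' ▸ (HasForm.principal c').mul (HasForm.prod Finset.univ h)).eq_of_ne_zero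
    (hL.pow d) hi
  simp only [Pi.add_apply, Pi.zero_apply, Pi.smul_apply, zero_add, Finset.sum_apply, nsmul_eq_mul,
    Nat.cast_sub (by omega : 1 ≤ d), Nat.cast_one] at h1 h2
  replace h1 : ((d : ℤ) - 1) * l i + -(n i + 1) = 0 := h1
  have h3 : (0 : ℤ) < l i := by
    have : (2 : ℤ) ≤ d := by exact_mod_cast hd
    by_contra! h0
    nlinarith
  have h4 : ((n i + 2 : ℕ) : ℤ) ≤ ((∑ j, a j i : ℕ) : ℤ) := by
    push_cast
    linarith
  exact_mod_cast h4

/-- With this choice of `u` for the product bundle, c ∏ s_j corresponds exactly to the product of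
the polynomials of the s_j. -/
lemma hasForm_of_principal_mul_prod_eq {c : (functionField n)ˣ} {N : (multiProj n).LineBundle}
    (hc : (multiProj n).principal c * ∏ j, T j = N)
    (h : ∀ j, HasForm (T j) (u j) fun i => (a j i : ℤ)) :
    HasForm N ((c : functionField n) * ∏ j, u j) fun i => (((∑ j, a j) i : ℕ) : ℤ) := by
  have h1 := (HasForm.principal c).mul (HasForm.prod Finset.univ h)
  rw [hc] at h1
  convert h1 using 1
  funext i
  simp

end

end MultiProj

end

open MultiProj in
theorem mainTheorem12 {t : ℕ} (n : Fin t → ℕ) (d : ℕ) (hd : 2 ≤ d)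
    (L : (multiProj n).LineBundle) {m : ℕ} (T : Fin m → (multiProj n).LineBundle)
    (hT : (∏ i, T i).cls = L.cls ^ d)
    (hK : (multiProj n).AnticanonicalEq d L)
    (heff : ∀ i, (T i).IsEffective) :
    Variety.BasicCondition (multiProj n) d L T ∧
    (3 ≤ d → Variety.Condition (multiProj n) d L T) ∧
    Nonempty (MultiProj.Linearization (L ^ d)) ∧
    ∃ U : Set (∀ i, Projectivization ℂ (T i).H0), U.Nonempty ∧ IsZariskiOpenProd U ∧
      ∀ (φ : MultiProj.Linearization (L ^ d)) (c : (MultiProj.functionField n)ˣ),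
        (multiProj n).principal c * ∏ i, T i = L ^ d →
        ∀ (s : ∀ i, (T i).H0) (hs : ∀ i, s i ≠ 0),
          (fun i => Projectivization.mk ℂ (s i) (hs i)) ∈ U →
          ∃ w : (L ^ d).H0,
            (w : MultiProj.functionField n) = c * ∏ i, (s i : MultiProj.functionField n) ∧
            IsGITStable φ.rep w := by
  choose u a ha h using fun j => exists_hasForm_of_isEffective (heff j)
  have hdeg : ∀ i, n i ≠ 0 → n i + 2 ≤ ∑ j, a j i := fun i hi =>
    add_two_le_sum_multidegree hd hT hK h hi
  obtain ⟨U, ⟨x, hx⟩, hU, hUt⟩ := exists_isZariskiOpenProd_isTransversal h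
  have hbasic : Variety.BasicCondition (multiProj n) d L T :=
    { smoothProjective := isSmoothProjective
      forms_eq_bot := fun i hi _ => globalForms_eq_bot hi
      rigid := subsingleton_tangentH1
      exists_snc := by
        have hx' : (fun j => Projectivization.mk ℂ (x j).rep (x j).rep_nonzero) ∈ U := by
          simpa only [Projectivization.mk_rep] using hx
        exact ⟨fun j => (x j).rep, (hUt _ _ hx').isSNC h
          (fun j => isWeightedHomogeneous_toPoly (h j) _) fun j => coe_eq_mul_toPoly (h j) _⟩
      anticanonical := hK }
  refine ⟨hbasic, fun h3 => { hbasic with three_le := h3 }, ?_, U, ⟨x, hx⟩, hU, ?_⟩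
  -- `L ^ d` is isomorphic to a product of effective bundles, hence has a nonnegative multidegree,
  -- as `stdLinearization` requires.
  · obtain ⟨c, hc⟩ := exists_principal_mul_eq (M := ∏ j, T j) (N := L ^ d) hT
    exact ⟨stdLinearization (hasForm_of_principal_mul_prod_eq hc h)⟩
  · intro φ c hc s hs hsU
    have hQ := hUt s hs hsU
    have hN := hasForm_of_principal_mul_prod_eq hc h
    have hw : ∀ j, MvPolynomial.IsWeightedHomogeneous (mdeg n) (toPoly (h j) (s j)) (a j) :=
      fun j => isWeightedHomogeneous_toPoly (h j) (s j)
    obtain ⟨w, hwQ⟩ := exists_toPoly_eq hN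
      (MvPolynomial.IsWeightedHomogeneous.prod Finset.univ _ _ fun j _ => hw j)
    refine ⟨w, ?_, isGITStable_of_isFiniteMorphism hN φ ?_ ?_⟩
    · apply Subtype.ext
      rw [coe_eq_mul_toPoly hN, hwQ, map_prod, mul_assoc, ← Finset.prod_mul_distrib,
        IntermediateField.coe_mul]
      congr 1
      rw [← IntermediateField.algebraMap_apply (functionField n), map_prod]
      exact Finset.prod_congr rfl fun j _ => (coe_eq_mul_toPoly (h j) (s j)).symm
    · rintro rfl
      rw [map_zero] at hwQ
      exact Finset.prod_ne_zero_iff.2 (fun j _ => hQ.ne_zero j) hwQ.symm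
    · rw [hwQ]
      exact hQ.isFiniteMorphism hw hdeg
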